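/- **Setting.** Let $\mathbb K$ be a field of characteristic zero and let $(L,b,B,\langle-,-\rangle)$ be a $\mathbb Z/2$-graded chain complex over $\mathbb K$ with circle action and pairing: $b$ and $B$ are odd, $b^2=B^2=bB+Bb=0$, and $\langle-,-\rangle:L\otimes L\to\mathbb K$ is even and graded symmetric with $\langle bx,y\rangle+(-1)^{|x|}\langle x,by\rangle=0$ and $\langle Bx,y\rangle=(-1)^{|x|}\langle x,By\rangle$. (The main example is the shifted reduced Hochschild chain complex $L=C_*(A)[d]$ of a cyclic unital $A_\infty$-algebra $A$, with the Hochschild differential $b$, the Connes operator $B$ and the chain-level Mukai pairing; the DGLAs below are then denoted $\mathfrak h_A$ and $\mathfrak h_A^{\rm triv}$.) Let $u,\hbar,\lambda$ be even formal variables. Put $L_+=(L[[u]],b+uB)$ and $L_-=(L[u^{-1}],b+uB)=L((u))/u\,L[[u]]$, let $\mathrm{Sym}(L_-)$ be the graded symmetric algebra, and extend $b+uB$ to it as a derivation. Let $\Delta$ be the second order differential operator on $\mathrm{Sym}(L_-)$ that vanishes on $\mathrm{Sym}^{\le 1}$ and satisfies $\Delta(x\cdot y)=\Omega(x,y)=\langle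 Bx_0,y_0\rangle$ for $x=\sum_{k\ge0}x_{-k}u^{-k}$ and $y=\sum_{k\ge0}y_{-k}u^{-k}$ in $L_-$. Let $\mathfrak h$ be the space $\mathrm{Sym}(L_-)[[\hbar,\lambda]][1]$ with differential $b+uB+\hbar\Delta$ and bracket $\{x,y\}=\Delta(xy)-\Delta(x)y-(-1)^{|x|}x\Delta(y)$, where $|x|$ is the degree in $\mathrm{Sym}(L_-)$, and let $\mathfrak h^{\rm triv}$ be the same space with differential $b+uB$ and zero bracket. DGLAs and $L_\infty$ morphisms are taken in the shifted sign convention, in which brackets are symmetric odd operations on $\mathfrak h[1]$. An $L_\infty$ morphism $\mathcal K:\mathfrak h\to\mathfrak h^{\rm triv}$ then consists of even graded symmetric $\mathbb K[[\hbar,\lambda]]$-multilinear maps $\mathcal K_m$ ($m\ge1$) in $m$ variables from $\mathfrak h[1]$ to $\mathfrak h^{\rm triv}[1]$ whose induced coalgebra map commutes with the bar differentials, and it is a quasi-isomorphism if $\mathcal K_1$ induces an isomorphism on homology. A *chain-level splitting* is an even chain map $S=\mathrm{id}+S_1u+S_2u^2+\cdots:(L,b)\to L_+$ with $S_n\in\mathrm{End}(L)$.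 Let $R=\sum_n R_nu^n$ be the inverse of its $u$-linear extension: $R_0=\mathrm{id}$ and $\sum_{i+j=n}R_iS_j=0$ for $n\ge1$. For $i,j\ge 0$ define $H:L_-\otimes L_-\to\mathbb K$ and its symmetrization by $$H(u^{-i}x,u^{-j}y)=\Big\langle(-1)^j\sum_{l=0}^jS_lR_{i+j+1-l}\,x,\;y\Big\rangle,\qquad H^{\rm sym}(\alpha,\beta)=\tfrac12\big(H(\alpha,\beta)+(-1)^{|\alpha||\beta|}H(\beta,\alpha)\big),$$ and let $\Delta^{H^{\rm sym}}$ be the second order differential operator on $\mathrm{Sym}(L_-)$ that vanishes on $\mathrm{Sym}^{\le1}$ and restricts to $H^{\rm sym}$ on $\mathrm{Sym}^2L_-$. **Theorem.** For every chain-level splitting $S$ the following holds. $\mathfrak h$ and $\mathfrak h^{\rm triv}$ are DGLAs, and there is an $L_\infty$ quasi-isomorphism $$\mathcal K:\mathfrak h\longrightarrow\mathfrak h^{\rm triv},$$ uniquely determined by the following explicit formula for its components $\mathcal K_m$, $m\ge1$. For $\gamma_1,\dots,\gamma_m\in \mathrm{Sym}(L_-)$ that are products of $n_1,\dots,n_m$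 homogeneous elements of $L_-$, and integers $g_1,\dots,g_m\ge0$, $$\mathcal K_m(\gamma_1\hbar^{g_1},\dots,\gamma_m\hbar^{g_m})=\sum_{(G,f)}\frac1{|\mathrm{Aut}(G,f)|}\,\mathcal K_{(G,f)}(\gamma_1,\dots,\gamma_m)\,\hbar^{g(G)} .$$ The sum is over the isomorphism classes of connected graphs $G$ (loops, multiple edges and leaves allowed) with $m$ vertices marked by $f$ as $v_1,\dots,v_m$, of valencies $n_1,\dots,n_m$ and with genus labels $g_1,\dots,g_m$; isomorphisms act on half-edges and preserve markings and labels, and $g(G)=\sum_ig_i+\mathrm{rank}\,H_1(G)$. The element $\mathcal K_{(G,f)}(\gamma_1,\dots,\gamma_m)\in\mathrm{Sym}(L_-)$ is obtained by decorating the half-edges at each $v_i$ by the desymmetrization $\sum_{\sigma}\pm x_{\sigma(1)}\otimes\cdots\otimes x_{\sigma(n_i)}$ of $\gamma_i=x_1\cdots x_{n_i}$, contracting the two half-edges of every edge with $H^{\rm sym}$ (after moving them to the front, with Koszul signs), and multiplying the remaining decorations of the leaves in $\mathrm{Sym}(L_-)$. In particular $$\mathcal K_1=e^{\hbar\Delta^{H^{\rm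 sym}}}=\sum_{l\ge0}\frac1{l!}\big(\hbar\Delta^{H^{\rm sym}}\big)^l .$$ -/

import Mathlib

open scoped BigOperators

noncomputable section

/-! ## Signs -/

/-- The sign `(-1)^a` attached to a parity `a`. -/
def sgn (a : ZMod 2) : ℤ := if a = 0 then 1 else -1

theorem sgn_mul_self (a : ZMod 2) : sgn a * sgn a = 1 := by
  unfold sgn; split <;> norm_num

theorem sgn_add (a b : ZMod 2) : sgn (a + b) = sgn a * sgn b := by
  revert a b; decide

/-- The Koszul sign of the rearrangement `x_1 ⊗ ⋯ ⊗ x_N ↦ x_{l_1} ⊗ x_{l_2} ⊗ ⋯`, where `x_k` is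
homogeneous of parity `ε k` and `l` lists the indices in the new order: a factor
`(-1)^{|x_a||x_b|}` for every pair `b < a` such that `a` stands before `b` in `l`. -/
def koszulSign {N : ℕ} (ε : Fin N → ZMod 2) : List (Fin N) → ℤ
  | [] => 1
  | a :: l => (l.map fun b => if b < a then sgn (ε a * ε b) else 1).prod * koszulSign ε l

/-! ## The graded symmetric algebra of a `ℤ/2`-graded vector space -/

section SuperSym

variable {K : Type*} [Field K] {V : Type*} [AddCommGroup V] [Module K V]

/-- The relations `x y = (-1)^{|x||y|} y x`, for homogeneous `x` and `y`. -/
inductive SuperSym.Rel (𝒱 : ZMod 2 → Submodule K V) :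
    TensorAlgebra K V → TensorAlgebra K V → Prop
  | swap {i j : ZMod 2} {x y : V} (hx : x ∈ 𝒱 i) (hy : y ∈ 𝒱 j) :
      SuperSym.Rel 𝒱 (TensorAlgebra.ι K x * TensorAlgebra.ι K y)
        (sgn (i * j) • (TensorAlgebra.ι K y * TensorAlgebra.ι K x))

/-- The graded symmetric algebra `Sym V`. -/
def SuperSym (𝒱 : ZMod 2 → Submodule K V) : Type _ := RingQuot (SuperSym.Rel 𝒱)

namespace SuperSym

instance (𝒱 : ZMod 2 → Submodule K V) : Ring (SuperSym 𝒱) :=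
  inferInstanceAs (Ring (RingQuot (SuperSym.Rel 𝒱)))

instance (𝒱 : ZMod 2 → Submodule K V) : Algebra K (SuperSym 𝒱) :=
  inferInstanceAs (Algebra K (RingQuot (SuperSym.Rel 𝒱)))

/-- The inclusion `V = Sym^1 V → Sym V`. -/
def ι (𝒱 : ZMod 2 → Submodule K V) : V →ₗ[K] SuperSym 𝒱 :=
  (RingQuot.mkAlgHom K (SuperSym.Rel 𝒱)).toLinearMap ∘ₗ TensorAlgebra.ι K

theorem ι_mul_ι {𝒱 : ZMod 2 → Submodule K V} {i j : ZMod 2} {x y : V}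
    (hx : x ∈ 𝒱 i) (hy : y ∈ 𝒱 j) :
    ι 𝒱 x * ι 𝒱 y = sgn (i * j) • (ι 𝒱 y * ι 𝒱 x) := by
  have h := RingQuot.mkAlgHom_rel K (SuperSym.Rel.swap hx hy)
  rw [map_mul, map_zsmul, map_mul] at h
  exact h

/-- The universal property of `Sym V`. -/
def lift (𝒱 : ZMod 2 → Submodule K V) {A : Type*} [Ring A] [Algebra K A] (f : V →ₗ[K] A)
    (hf : ∀ (i j : ZMod 2) (x y : V), x ∈ 𝒱 i → y ∈ 𝒱 j →
      f x * f y = sgn (i * j) • (f y * f x)) : SuperSym 𝒱 →ₐ[K] A :=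
  RingQuot.liftAlgHom K ⟨TensorAlgebra.lift K f, by
    rintro _ _ ⟨hx, hy⟩
    simpa using hf _ _ _ _ hx hy⟩

@[simp] theorem lift_ι (𝒱 : ZMod 2 → Submodule K V) {A : Type*} [Ring A] [Algebra K A]
    (f : V →ₗ[K] A) (hf : ∀ (i j : ZMod 2) (x y : V), x ∈ 𝒱 i → y ∈ 𝒱 j →
      f x * f y = sgn (i * j) • (f y * f x)) (x : V) : lift 𝒱 f hf (ι 𝒱 x) = f x := by
  simp [lift, ι]
  erw [RingQuot.liftAlgHom_mkAlgHom_apply]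
  simp

/-- The `ℤ/2`-grading of `Sym V`: the part of parity `p` is spanned by the products of homogeneous
elements of `V` of total parity `p`. -/
def parity (𝒱 : ZMod 2 → Submodule K V) (p : ZMod 2) : Submodule K (SuperSym 𝒱) :=
  Submodule.span K {s | ∃ (n : ℕ) (ε : Fin n → ZMod 2) (x : Fin n → V),
    (∀ k, x k ∈ 𝒱 (ε k)) ∧ ∑ k, ε k = p ∧ s = (List.ofFn fun k => ι 𝒱 (x k)).prod}

@[elab_as_elim]
theorem induction {𝒱 : ZMod 2 → Submodule K V} {P : SuperSym 𝒱 → Prop}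
    (algebraMap : ∀ r : K, P (algebraMap K (SuperSym 𝒱) r)) (ι : ∀ x : V, P (ι 𝒱 x))
    (mul : ∀ s t, P s → P t → P (s * t)) (add : ∀ s t, P s → P t → P (s + t))
    (s : SuperSym 𝒱) : P s := by
  obtain ⟨t, rfl⟩ := RingQuot.mkAlgHom_surjective K (SuperSym.Rel 𝒱) s
  induction t using TensorAlgebra.induction with
  | algebraMap r =>
    rw [AlgHom.commutes]
    exact algebraMap r
  | ι x => exact ι x
  | mul s t hs ht =>
    rw [map_mul]
    exact mul _ _ hs ht
  | add s t hs ht =>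
    rw [map_add]
    exact add _ _ hs ht

/-- Given homomorphisms `a c : Sym V → A` and a linear map `f : V → A` compatible with the relations
of `Sym V`, the homomorphism to upper triangular matrices with values
`!![a x, f x; 0, c x]` for `x` in `V`. -/
def triangular (𝒱 : ZMod 2 → Submodule K V) {A : Type*} [Ring A] [Algebra K A]
    (a c : SuperSym 𝒱 →ₐ[K] A) (f : V →ₗ[K] A)
    (hf : ∀ (i j : ZMod 2) (x y : V), x ∈ 𝒱 i → y ∈ 𝒱 j →
      a (ι 𝒱 x) * f y + f x * c (ι 𝒱 y) =
        sgn (i * j) • (a (ι 𝒱 y) * f x + f y * c (ι 𝒱 x))) :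
    SuperSym 𝒱 →ₐ[K] Matrix (Fin 2) (Fin 2) A :=
  lift 𝒱
    { toFun := fun x => !![a (ι 𝒱 x), f x; 0, c (ι 𝒱 x)]
      map_add' := fun x y => by
        ext k l; fin_cases k <;> fin_cases l <;> simp
      map_smul' := fun r x => by
        ext k l; fin_cases k <;> fin_cases l <;> simp } (by
    intro i j x y hx hy
    have h1 := hf i j x y hx hy
    have ha := congrArg a (ι_mul_ι hx hy)
    have hc := congrArg c (ι_mul_ι hx hy)
    rw [map_mul, map_zsmul, map_mul] at ha hc
    ext k l
    rw [Matrix.smul_apply]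
    fin_cases k <;> fin_cases l
    · simpa [Matrix.mul_apply] using ha
    · simpa [Matrix.mul_apply] using h1
    · simp
    · simpa [Matrix.mul_apply] using hc)

/-- The linear map `D : Sym V → A` that extends `f : V → A` and satisfies the twisted Leibniz rule
`D (s * t) = a s * D t + D s * c t`; it is the corner entry of `triangular`, because
`!![a s, D s; 0, c s] * !![a t, D t; 0, c t] = !![a (s * t), a s * D t + D s * c t; 0, c (s * t)]`. -/
def extend (𝒱 : ZMod 2 → Submodule K V) {A : Type*} [Ring A] [Algebra K A]
    (a c : SuperSym 𝒱 →ₐ[K] A) (f : V →ₗ[K] A)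
    (hf : ∀ (i j : ZMod 2) (x y : V), x ∈ 𝒱 i → y ∈ 𝒱 j →
      a (ι 𝒱 x) * f y + f x * c (ι 𝒱 y) =
        sgn (i * j) • (a (ι 𝒱 y) * f x + f y * c (ι 𝒱 x))) : SuperSym 𝒱 →ₗ[K] A where
  toFun s := triangular 𝒱 a c f hf s 0 1
  map_add' s t := by simp
  map_smul' r s := by simp

section extend

variable {𝒱 : ZMod 2 → Submodule K V} {A : Type*} [Ring A] [Algebra K A]
    {a c : SuperSym 𝒱 →ₐ[K] A} {f : V →ₗ[K] A}
    {hf : ∀ (i j : ZMod 2) (x y : V), x ∈ 𝒱 i → y ∈ 𝒱 j →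
      a (ι 𝒱 x) * f y + f x * c (ι 𝒱 y) =
        sgn (i * j) • (a (ι 𝒱 y) * f x + f y * c (ι 𝒱 x))}

theorem extend_one : extend 𝒱 a c f hf 1 = 0 := by
  simp [extend]

theorem extend_ι (x : V) : extend 𝒱 a c f hf (ι 𝒱 x) = f x := by
  simp [extend, triangular]

theorem triangular_entries (s : SuperSym 𝒱) : triangular 𝒱 a c f hf s 0 0 = a s ∧
    triangular 𝒱 a c f hf s 1 0 = 0 ∧ triangular 𝒱 a c f hf s 1 1 = c s := by
  induction s using SuperSym.induction with
  | algebraMap r => simp [Matrix.algebraMap_eq_diagonal]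
  | ι x => simp [triangular]
  | mul s t hs ht => simp [Matrix.mul_apply, hs, ht]
  | add s t hs ht => simp [hs, ht]

/-- The twisted Leibniz rule. -/
theorem extend_mul (s t : SuperSym 𝒱) : extend 𝒱 a c f hf (s * t) =
    a s * extend 𝒱 a c f hf t + extend 𝒱 a c f hf s * c t := by
  have hs := triangular_entries (hf := hf) s
  have ht := triangular_entries (hf := hf) t
  simp [extend, Matrix.mul_apply, hs, ht]

end extend

variable (𝒱 : ZMod 2 → Submodule K V) [DirectSum.Decomposition 𝒱]

/-- The projection of `V` onto its part of parity `i`. -/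
def proj (i : ZMod 2) : V →ₗ[K] V :=
  (𝒱 i).subtype ∘ₗ DirectSum.component K (ZMod 2) (fun i => 𝒱 i) i ∘ₗ
    (DirectSum.decomposeLinearEquiv 𝒱).toLinearMap

variable {𝒱} in
theorem proj_same {i : ZMod 2} {x : V} (hx : x ∈ 𝒱 i) : proj 𝒱 i x = x := by
  exact DirectSum.decompose_of_mem_same 𝒱 hx

variable {𝒱} in
theorem proj_ne {i j : ZMod 2} {x : V} (hx : x ∈ 𝒱 i) (h : i ≠ j) : proj 𝒱 j x = 0 := by
  exact DirectSum.decompose_of_mem_ne 𝒱 hx h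

theorem sum_proj (x : V) : ∑ i : ZMod 2, proj 𝒱 i x = x := by
  induction x using DirectSum.Decomposition.inductionOn 𝒱 with
  | zero => simp
  | @homogeneous i x =>
    rw [Finset.sum_eq_single i]
    · exact proj_same x.2
    · exact fun j _ hj => proj_ne x.2 hj.symm
    · simp
  | add x y hx hy => simp only [map_add, Finset.sum_add_distrib, hx, hy]

/-- The linear map `x ↦ (-1)^{p|x|} x` of `V`. -/
def twistMap (p : ZMod 2) : V →ₗ[K] V := ∑ i : ZMod 2, sgn (p * i) • proj 𝒱 i

variable {𝒱} in
theorem twistMap_of_mem (p : ZMod 2) {i : ZMod 2} {x : V} (hx : x ∈ 𝒱 i) :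
    twistMap 𝒱 p x = sgn (p * i) • x := by
  simp only [twistMap, LinearMap.sum_apply, LinearMap.smul_apply]
  rw [Finset.sum_eq_single i]
  · rw [proj_same hx]
  · intro j _ hj
    rw [proj_ne hx hj.symm, smul_zero]
  · simp

/-- The algebra automorphism `s ↦ (-1)^{p|s|} s` of `Sym V`. -/
def twist (p : ZMod 2) : SuperSym 𝒱 →ₐ[K] SuperSym 𝒱 :=
  lift 𝒱 (ι 𝒱 ∘ₗ twistMap 𝒱 p) (by
    intro i j x y hx hy
    simp only [LinearMap.comp_apply, twistMap_of_mem p hx, twistMap_of_mem p hy, map_zsmul,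
      smul_mul_assoc, mul_smul_comm, ι_mul_ι hx hy]
    module)

@[simp] theorem twist_ι (p : ZMod 2) (x : V) : twist 𝒱 p (ι 𝒱 x) = ι 𝒱 (twistMap 𝒱 p x) := by
  simp [twist]

/-- The derivation of parity `p` of `Sym V` that extends a linear map `D : V → V` of parity `p`:
`D (s t) = D(s) t + (-1)^{p|s|} s D(t)`. -/
def derivation (p : ZMod 2) (D : V →ₗ[K] V) (hD : ∀ (i : ZMod 2) (x : V), x ∈ 𝒱 i → D x ∈ 𝒱 (i + p)) :
    SuperSym 𝒱 →ₗ[K] SuperSym 𝒱 :=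
  extend 𝒱 (twist 𝒱 p) (AlgHom.id K _) (ι 𝒱 ∘ₗ D) (by
    intro i j x y hx hy
    have h1 := ι_mul_ι hx (hD j y hy)
    have h2 := ι_mul_ι (hD i x hx) hy
    simp only [twist_ι, twistMap_of_mem p hx, twistMap_of_mem p hy, LinearMap.comp_apply,
      map_zsmul, AlgHom.id_apply, smul_mul_assoc, h1, h2, smul_smul, smul_add]
    rw [add_comm]
    congr 2
    · rw [add_mul, sgn_add]
    · rw [mul_add, sgn_add, mul_comm i p, mul_left_comm, sgn_mul_self, mul_one])

theorem contract_aux (p : ZMod 2) (φ : V →ₗ[K] K) (i j : ZMod 2) (x y : V)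
    (hx : x ∈ 𝒱 i) (hy : y ∈ 𝒱 j) :
    twist 𝒱 p (ι 𝒱 x) * (Algebra.linearMap K (SuperSym 𝒱) ∘ₗ φ ∘ₗ proj 𝒱 p) y +
        (Algebra.linearMap K (SuperSym 𝒱) ∘ₗ φ ∘ₗ proj 𝒱 p) x * AlgHom.id K _ (ι 𝒱 y) =
      sgn (i * j) •
        (twist 𝒱 p (ι 𝒱 y) * (Algebra.linearMap K (SuperSym 𝒱) ∘ₗ φ ∘ₗ proj 𝒱 p) x +
          (Algebra.linearMap K (SuperSym 𝒱) ∘ₗ φ ∘ₗ proj 𝒱 p) y * AlgHom.id K _ (ι 𝒱 x)) := by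
  simp only [twist_ι, twistMap_of_mem p hx, twistMap_of_mem p hy, LinearMap.comp_apply,
    map_zsmul, AlgHom.id_apply, Algebra.linearMap_apply, smul_mul_assoc]
  rw [← Algebra.commutes (φ (proj 𝒱 p y)), ← Algebra.commutes (φ (proj 𝒱 p x)), smul_add,
    smul_smul, add_comm]
  congr 1
  · by_cases h : i = p
    · subst h
      rw [sgn_mul_self, one_smul]
    · simp [proj_ne hx h]
  · by_cases h : j = p
    · subst h
      rw [mul_comm]
    · simp [proj_ne hy h]

/-- The part of parity `p` of the contraction with a linear form `φ`: with `φ_p = φ ∘ proj p`, the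
derivation `∂` of parity `p`, `∂(s t) = ∂(s) t + (-1)^{p|s|} s ∂(t)`, with `∂(x) = φ_p(x)` for `x`
in `V`. -/
def contractHom (p : ZMod 2) : (V →ₗ[K] K) →ₗ[K] Module.End K (SuperSym 𝒱) where
  toFun φ := extend 𝒱 (twist 𝒱 p) (AlgHom.id K _)
    (Algebra.linearMap K _ ∘ₗ φ ∘ₗ proj 𝒱 p) (contract_aux 𝒱 p φ)
  map_add' φ ψ := by
    ext s
    induction s using SuperSym.induction with
    | algebraMap r => simp [Algebra.algebraMap_eq_smul_one, extend_one]
    | ι x => simp [extend_ι]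
    | mul s t hs ht =>
      simp only [LinearMap.add_apply, extend_mul] at hs ht ⊢
      rw [hs, ht]
      simp only [mul_add, add_mul]
      abel
    | add s t hs ht => simp only [map_add, hs, ht]
  map_smul' r φ := by
    ext s
    induction s using SuperSym.induction with
    | algebraMap r => simp [Algebra.algebraMap_eq_smul_one, extend_one]
    | ι x => simp [extend_ι, Algebra.smul_def]
    | mul s t hs ht =>
      simp only [LinearMap.smul_apply, RingHom.id_apply, extend_mul] at hs ht ⊢
      rw [hs, ht]
      simp only [mul_smul_comm, smul_mul_assoc, smul_add]
    | add s t hs ht => simp only [map_add, hs, ht]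

/-- The contraction of `Sym V` with a linear form `φ`,
`x_1 ⋯ x_n ↦ ∑ j, ± φ(x_j) x_1 ⋯ (omit x_j) ⋯ x_n` for homogeneous `x_1, …, x_n`,
with the Koszul sign of the permutation that moves `x_j` to the front. -/
def contract : (V →ₗ[K] K) →ₗ[K] Module.End K (SuperSym 𝒱) := ∑ p : ZMod 2, contractHom 𝒱 p

variable {𝒱}

theorem contract_one (φ : V →ₗ[K] K) : contract 𝒱 φ 1 = 0 := by
  simp [contract, contractHom, extend_one]

theorem contract_ι_mul {i p : ZMod 2} {φ : V →ₗ[K] K} (hφ : ∀ j ≠ p, φ ∘ₗ proj 𝒱 j = 0)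
    {x : V} (hx : x ∈ 𝒱 i) (s : SuperSym 𝒱) :
    contract 𝒱 φ (ι 𝒱 x * s) = φ x • s + sgn (p * i) • (ι 𝒱 x * contract 𝒱 φ s) := by
  have h0 : ∀ j ≠ p, contractHom 𝒱 j φ = 0 := by
    intro j hj
    ext s
    induction s using SuperSym.induction with
    | algebraMap r => simp [contractHom, Algebra.algebraMap_eq_smul_one, extend_one]
    | ι x =>
      have := LinearMap.congr_fun (hφ j hj) x
      simp only [LinearMap.comp_apply, LinearMap.zero_apply] at this
      simp [contractHom, extend_ι, this]
    | mul s t hs ht =>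
      simp only [contractHom, LinearMap.coe_mk, AddHom.coe_mk, LinearMap.zero_apply] at hs ht ⊢
      simp [extend_mul, hs, ht]
    | add s t hs ht => simp only [map_add, hs, ht]
  have h1 : contract 𝒱 φ = contractHom 𝒱 p φ := by
    rw [contract, LinearMap.sum_apply]
    exact Finset.sum_eq_single p (fun j _ hj => h0 j hj) (by simp)
  have h2 : φ (proj 𝒱 p x) = φ x := by
    by_cases h : i = p
    · rw [← h, proj_same hx]
    · have := LinearMap.congr_fun (hφ i h) x
      simp only [LinearMap.comp_apply, LinearMap.zero_apply, proj_same hx] at this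
      rw [this, proj_ne hx h, map_zero]
  rw [h1]
  simp [contractHom, extend_mul, extend_ι, h2, twistMap_of_mem p hx, Algebra.smul_def,
    add_comm, mul_assoc]

variable (𝒱)

/-- The bilinear form `Q` on `V` has parity `q`. -/
def HasParity (q : ZMod 2) (Q : V →ₗ[K] V →ₗ[K] K) : Prop :=
  ∀ (i j : ZMod 2) (x y : V), x ∈ 𝒱 i → y ∈ 𝒱 j → i + j ≠ q → Q x y = 0

/-- The bilinear form `Q` on `V` is graded symmetric. -/
def IsGradedSymm (Q : V →ₗ[K] V →ₗ[K] K) : Prop :=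
  ∀ (i j : ZMod 2) (x y : V), x ∈ 𝒱 i → y ∈ 𝒱 j → Q x y = sgn (i * j) • Q y x

/-- The form `(x, y) ↦ (-1)^{|x||y|} Q(y, x)`. -/
def gradedFlip (Q : V →ₗ[K] V →ₗ[K] K) : V →ₗ[K] V →ₗ[K] K :=
  ∑ i : ZMod 2, ∑ j : ZMod 2, sgn (i * j) • Q.flip.compl₁₂ (proj 𝒱 i) (proj 𝒱 j)

theorem gradedFlip_apply (Q : V →ₗ[K] V →ₗ[K] K) {i j : ZMod 2} {x y : V} (hx : x ∈ 𝒱 i)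
    (hy : y ∈ 𝒱 j) : gradedFlip 𝒱 Q x y = sgn (i * j) • Q y x := by
  simp only [gradedFlip, LinearMap.sum_apply, LinearMap.smul_apply, LinearMap.compl₁₂_apply,
    LinearMap.flip_apply]
  rw [Finset.sum_eq_single i, Finset.sum_eq_single j]
  · rw [proj_same hx, proj_same hy]
  · intro k _ hk
    simp [proj_ne hy hk.symm]
  · simp
  · intro k _ hk
    simp [proj_ne hx hk.symm]
  · simp

variable {𝒱} in
theorem HasParity.comp_proj {q : ZMod 2} {Q : V →ₗ[K] V →ₗ[K] K} (hQ : HasParity 𝒱 q Q)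
    {i : ZMod 2} {x : V} (hx : x ∈ 𝒱 i) : ∀ j ≠ i + q, Q x ∘ₗ proj 𝒱 j = 0 := by
  intro j hj
  ext y
  refine hQ i j x _ hx (Submodule.coe_mem _) fun h => hj ?_
  rw [← h, ← add_assoc, CharTwo.add_self_eq_zero, zero_add]

/-- The second order differential operator `Δ` of parity `q` on `Sym V` that extends a graded
symmetric bilinear form `Q` of parity `q` on `V`: it vanishes on `Sym^{≤ 1} V`, it has
`Δ(x y) = Q(x, y)`, and in general
`Δ(x_1 ⋯ x_n) = ∑ i < j, ± Q(x_i, x_j) x_1 ⋯ (omit x_i, x_j) ⋯ x_n` for homogeneous `x_1, …, x_n`,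
with the Koszul sign of the permutation that moves `x_i, x_j` to the front. It is defined through
the recursion `Δ(x s) = (-1)^{q|x|} x Δ(s) + ∂_{Q(x, ·)} s`. -/
def secondOrder (q : ZMod 2) (Q : V →ₗ[K] V →ₗ[K] K) (hq : HasParity 𝒱 q Q)
    (hs : IsGradedSymm 𝒱 Q) : Module.End K (SuperSym 𝒱) :=
  LinearMap.applyₗ (1 : SuperSym 𝒱) ∘ₗ
    extend 𝒱 ((Algebra.lmul K (SuperSym 𝒱)).comp (twist 𝒱 q)) (Algebra.lmul K (SuperSym 𝒱))
      (contract 𝒱 ∘ₗ Q) (by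
        intro i j x y hx hy
        ext s
        have h1 := contract_ι_mul (hq.comp_proj hx) hy s
        have h2 := contract_ι_mul (hq.comp_proj hy) hx s
        simp only [AlgHom.comp_apply, twist_ι, twistMap_of_mem q hx, twistMap_of_mem q hy,
          LinearMap.add_apply, LinearMap.smul_apply, Module.End.mul_apply, LinearMap.comp_apply,
          map_zsmul, Algebra.coe_lmul_eq_mul, LinearMap.mul_apply', h1, h2, smul_add, smul_smul]
        rw [hs i j x y hx hy, add_mul, add_mul, sgn_add, sgn_add, mul_comm j i,
          show sgn (i * j) * (sgn (i * j) * sgn (q * i)) = sgn (q * i) by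
            rw [← mul_assoc, sgn_mul_self, one_mul], smul_assoc]
        abel)

theorem secondOrder_one (q : ZMod 2) (Q : V →ₗ[K] V →ₗ[K] K) (hq : HasParity 𝒱 q Q)
    (hs : IsGradedSymm 𝒱 Q) : secondOrder 𝒱 q Q hq hs 1 = 0 := by
  simp [secondOrder, extend_one]

theorem secondOrder_ι_mul (q : ZMod 2) (Q : V →ₗ[K] V →ₗ[K] K) (hq : HasParity 𝒱 q Q)
    (hs : IsGradedSymm 𝒱 Q) {i : ZMod 2} {x : V} (hx : x ∈ 𝒱 i) (s : SuperSym 𝒱) :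
    secondOrder 𝒱 q Q hq hs (ι 𝒱 x * s) =
      sgn (q * i) • (ι 𝒱 x * secondOrder 𝒱 q Q hq hs s) + contract 𝒱 (Q x) s := by
  simp [secondOrder, extend_mul, extend_ι, twistMap_of_mem q hx, mul_assoc]

end SuperSym

end SuperSym

/-! ## Differential graded Lie algebras and `L_∞` morphisms

All operations are written in the shifted sign convention: for a DGLA `𝔤` they live on `V = 𝔤[1]`,
degrees of elements are those of `V`, and the Lie bracket is a symmetric odd operation on `V`. -/

section LInfinity

/-- The data of a `ℤ/2`-graded DGLA `𝔤` over `R`, on the underlying module `V` of `𝔤[1]`. -/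
structure ShiftedLieData (R : Type*) (V : Type*) [CommRing R] [AddCommGroup V] [Module R V] where
  /-- the part of `V = 𝔤[1]` of given parity -/
  grading : ZMod 2 → Submodule R V
  /-- the differential -/
  d : V →ₗ[R] V
  /-- the Lie bracket -/
  bracket : V →ₗ[R] V →ₗ[R] V

variable {R V W : Type*} [CommRing R] [AddCommGroup V] [Module R V] [AddCommGroup W] [Module R W]

/-- The axioms of a DGLA, in the shifted sign convention. -/
structure ShiftedLieData.IsDGLA (𝔤 : ShiftedLieData R V) : Prop where
  isInternal : DirectSum.IsInternal 𝔤.grading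
  d_odd : ∀ (i : ZMod 2) (x : V), x ∈ 𝔤.grading i → 𝔤.d x ∈ 𝔤.grading (i + 1)
  bracket_odd : ∀ (i j : ZMod 2) (x y : V), x ∈ 𝔤.grading i → y ∈ 𝔤.grading j →
    𝔤.bracket x y ∈ 𝔤.grading (i + j + 1)
  d_d : ∀ x : V, 𝔤.d (𝔤.d x) = 0
  bracket_symm : ∀ (i j : ZMod 2) (x y : V), x ∈ 𝔤.grading i → y ∈ 𝔤.grading j →
    𝔤.bracket x y = sgn (i * j) • 𝔤.bracket y x
  leibniz : ∀ (i : ZMod 2) (x y : V), x ∈ 𝔤.grading i →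
    𝔤.d (𝔤.bracket x y) + 𝔤.bracket (𝔤.d x) y + sgn i • 𝔤.bracket x (𝔤.d y) = 0
  jacobi : ∀ (i j k : ZMod 2) (x y z : V), x ∈ 𝔤.grading i → y ∈ 𝔤.grading j → z ∈ 𝔤.grading k →
    𝔤.bracket (𝔤.bracket x y) z + sgn (k * j) • 𝔤.bracket (𝔤.bracket x z) y +
      sgn (i * j + i * k) • 𝔤.bracket (𝔤.bracket y z) x = 0

/-- The subfamily `x_I` of a family `x_1, …, x_m`, in increasing order of the indices. -/
def subfamily {m : ℕ} (x : Fin m → V) (I : Finset (Fin m)) : Fin I.card → V :=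
  fun k => x (I.orderEmbOfFin rfl k)

/-- The elements of a set of indices, in increasing order. -/
def indexList {m : ℕ} (I : Finset (Fin m)) : List (Fin m) :=
  List.ofFn fun k : Fin I.card => I.orderEmbOfFin rfl k

/-- An `L_∞` morphism `𝔤 → 𝔥` of DGLAs: even graded symmetric multilinear maps
`𝒦_m : Sym^m (𝔤[1]) → 𝔥[1]` for `m ≥ 1`, such that the induced morphism of the cofree coalgebras
`Sym (𝔤[1]) → Sym (𝔥[1])` commutes with the differentials of the bar constructions. The last
condition is spelled out in `map_bar`. There is no component `𝒦_0`; it is `0` by convention. -/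
structure LInftyMorphism (𝔤 : ShiftedLieData R V) (𝔥 : ShiftedLieData R W) where
  comp : ∀ m : ℕ, MultilinearMap R (fun _ : Fin m => V) W
  comp_zero : comp 0 = 0
  even : ∀ (m : ℕ) (ε : Fin m → ZMod 2) (x : Fin m → V), (∀ k, x k ∈ 𝔤.grading (ε k)) →
    comp m x ∈ 𝔥.grading (∑ k, ε k)
  symm : ∀ (m : ℕ) (ε : Fin m → ZMod 2) (x : Fin m → V), (∀ k, x k ∈ 𝔤.grading (ε k)) →
    ∀ π : Equiv.Perm (Fin m),
      comp m (fun k => x (π k)) = koszulSign ε (List.ofFn π) • comp m x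
  /-- For homogeneous `x_1, …, x_m`,
  `d 𝒦_m(x_1, …, x_m) + ∑_{ {I, J} } ± {𝒦(x_I), 𝒦(x_J)}`
  `= ∑_i ± 𝒦_m(x_1, …, d x_i, …, x_m) + ∑_{i < j} ± 𝒦_{m-1}({x_i, x_j}, …)`
  with Koszul signs. The first sum is over the unordered partitions of the set of indices into two
  non-empty sets; the name `I` is given to the one that contains the first index (the improper
  choice of all the indices contributes `0`, because `𝒦_0 = 0`). -/
  map_bar : ∀ (m : ℕ) (ε : Fin (m + 1) → ZMod 2) (x : Fin (m + 1) → V),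
    (∀ k, x k ∈ 𝔤.grading (ε k)) →
    𝔥.d (comp (m + 1) x) +
      ∑ I : Finset (Fin (m + 1)) with 0 ∈ I,
        koszulSign ε (indexList I ++ indexList Iᶜ) •
          𝔥.bracket (comp I.card (subfamily x I)) (comp Iᶜ.card (subfamily x Iᶜ)) =
    ∑ i : Fin (m + 1),
        (∏ k ∈ Finset.Iio i, sgn (ε k)) • comp (m + 1) (Function.update x i (𝔤.d (x i))) +
      ∑ i : Fin (m + 1), ∑ j ∈ Finset.Ioi i,
        koszulSign ε (i :: j :: indexList {i, j}ᶜ) •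
          comp (({i, j}ᶜ : Finset (Fin (m + 1))).card + 1)
            (Fin.cons (𝔤.bracket (x i) (x j)) (subfamily x {i, j}ᶜ))

/-- An `L_∞` morphism is a quasi-isomorphism if `𝒦_1` induces a bijection on homology: `injective`
and `surjective` are injectivity and surjectivity on homology classes of cycles. -/
structure LInftyMorphism.IsQuasiIso {𝔤 : ShiftedLieData R V} {𝔥 : ShiftedLieData R W}
    (𝒦 : LInftyMorphism 𝔤 𝔥) : Prop where
  injective : ∀ x : V, 𝔤.d x = 0 → (∃ w : W, 𝒦.comp 1 (fun _ => x) = 𝔥.d w) → ∃ v : V, x = 𝔤.d v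
  surjective : ∀ y : W, 𝔥.d y = 0 →
    ∃ x : V, 𝔤.d x = 0 ∧ ∃ w : W, y = 𝒦.comp 1 (fun _ => x) + 𝔥.d w

end LInfinity

/-! ## Complexes with circle action and pairing -/

section Circle

variable {K L : Type*} [Field K] [AddCommGroup L] [Module K L]

/-- A `ℤ/2`-graded chain complex `(L, b)` over `K` with a circle action `B` and a pairing: `b` and
`B` are odd, `b² = B² = bB + Bb = 0`, and the pairing is an even graded symmetric chain map
`L ⊗ L → K` for which `B` is self-adjoint. The main example is the shifted reduced Hochschild chain
complex of a cyclic unital `A_∞`-algebra with its Hochschild differential `b`, the Connes operator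
`B` and the chain-level Mukai pairing. -/
structure CircleComplex (𝓛 : ZMod 2 → Submodule K L) where
  b : L →ₗ[K] L
  B : L →ₗ[K] L
  pairing : L →ₗ[K] L →ₗ[K] K
  b_odd : ∀ (i : ZMod 2) (x : L), x ∈ 𝓛 i → b x ∈ 𝓛 (i + 1)
  B_odd : ∀ (i : ZMod 2) (x : L), x ∈ 𝓛 i → B x ∈ 𝓛 (i + 1)
  b_b : ∀ x : L, b (b x) = 0
  B_B : ∀ x : L, B (B x) = 0
  b_B : ∀ x : L, b (B x) + B (b x) = 0
  pairing_even : SuperSym.HasParity 𝓛 0 pairing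
  pairing_symm : SuperSym.IsGradedSymm 𝓛 pairing
  pairing_b : ∀ (i : ZMod 2) (x y : L), x ∈ 𝓛 i → pairing (b x) y + sgn i • pairing x (b y) = 0
  pairing_B : ∀ (i : ZMod 2) (x y : L), x ∈ 𝓛 i → pairing (B x) y = sgn i • pairing x (B y)

/-- The grading of `L_- = L[u⁻¹]`. An element of `L_-` is a finitely supported function
`α : ℕ →₀ L`, where `α n` is the coefficient of `u^{-n}`; the variable `u` is even. -/
def minusGrading (𝓛 : ZMod 2 → Submodule K L) (i : ZMod 2) : Submodule K (ℕ →₀ L) where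
  carrier := {α | ∀ n, α n ∈ 𝓛 i}
  add_mem' h h' n := add_mem (h n) (h' n)
  zero_mem' _ := zero_mem (𝓛 i)
  smul_mem' c _ h n := (𝓛 i).smul_mem c (h n)

/-- Every element of `L[u⁻¹]` is uniquely the sum of an even and an odd one, coefficientwise. -/
instance minusDecomposition (𝓛 : ZMod 2 → Submodule K L) [DirectSum.Decomposition 𝓛] :
    DirectSum.Decomposition (minusGrading 𝓛) :=
  DirectSum.Decomposition.ofLinearMap (minusGrading 𝓛)
    (∑ i : ZMod 2, DirectSum.lof K (ZMod 2) (fun i => minusGrading 𝓛 i) i ∘ₗ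
      (Finsupp.mapRange.linearMap (SuperSym.proj 𝓛 i)).codRestrict (minusGrading 𝓛 i)
        (fun _ _ => by simp [SuperSym.proj]))
    (by
      refine LinearMap.ext fun α => Finsupp.ext fun n => ?_
      simp only [LinearMap.comp_apply, LinearMap.sum_apply, map_sum, DirectSum.coeLinearMap_lof,
        Finsupp.finsetSum_apply, LinearMap.id_apply]
      exact SuperSym.sum_proj 𝓛 (α n))
    (by
      refine DirectSum.linearMap_ext K fun i => LinearMap.ext fun α => ?_
      simp only [LinearMap.comp_apply, DirectSum.coeLinearMap_lof, LinearMap.sum_apply,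
        LinearMap.id_apply]
      rw [Finset.sum_eq_single i]
      · exact congrArg _ (Subtype.ext (Finsupp.ext fun n => SuperSym.proj_same (α.2 n)))
      · intro j _ hj
        exact (congrArg _ (Subtype.ext (Finsupp.ext fun n =>
          SuperSym.proj_ne (α.2 n) hj.symm))).trans (map_zero _)
      · simp)

namespace CircleComplex

variable {𝓛 : ZMod 2 → Submodule K L} (X : CircleComplex 𝓛)

/-- The differential `b + uB` of `L_+ = L[[u]]`; an element of `L_+` is a function `ℕ → L`, whose
value at `n` is the coefficient of `u^n`. -/
def plusDiff : (ℕ → L) →ₗ[K] (ℕ → L) where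
  toFun α n := X.b (α n) + if n = 0 then 0 else X.B (α (n - 1))
  map_add' α β := by
    funext n
    by_cases h : n = 0
    · simp [h]
    · simp only [h, if_false, Pi.add_apply, map_add]
      abel
  map_smul' c α := by
    funext n
    by_cases h : n = 0 <;> simp [h]

/-- The differential `b + uB` of `L_- = L[u⁻¹] = L((u)) / u L[[u]]`:
`u^{-n} x ↦ u^{-n} b x + u^{-n+1} B x`, where the second term is `0` if `n = 0`. -/
def minusDiff : (ℕ →₀ L) →ₗ[K] (ℕ →₀ L) :=
  Finsupp.lsum K fun n =>
    match n with
    | 0 => Finsupp.lsingle 0 ∘ₗ X.b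
    | n + 1 => Finsupp.lsingle (n + 1) ∘ₗ X.b + Finsupp.lsingle n ∘ₗ X.B

theorem minusDiff_apply (α : ℕ →₀ L) (n : ℕ) :
    X.minusDiff α n = X.b (α n) + X.B (α (n + 1)) := by
  induction α using Finsupp.induction_linear with
  | zero => simp
  | add f g hf hg =>
    simp only [map_add, Finsupp.add_apply, hf, hg]
    abel
  | single k x =>
    cases k with
    | zero => cases n <;> simp [minusDiff]
    | succ k =>
      simp only [minusDiff, Finsupp.lsum_single, LinearMap.add_apply, LinearMap.comp_apply,
        Finsupp.lsingle_apply, Finsupp.add_apply, Finsupp.single_apply, add_left_inj]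
      split_ifs <;> simp

theorem minusDiff_odd (i : ZMod 2) (α : ℕ →₀ L) (hα : α ∈ minusGrading 𝓛 i) :
    X.minusDiff α ∈ minusGrading 𝓛 (i + 1) := fun n => by
  rw [minusDiff_apply]
  exact add_mem (X.b_odd i _ (hα n)) (X.B_odd i _ (hα (n + 1)))

/-- The form `Ω(α, β) = ⟨B α_0, β_0⟩` on `L_-`. -/
def Omega : (ℕ →₀ L) →ₗ[K] (ℕ →₀ L) →ₗ[K] K :=
  X.pairing.compl₁₂ (X.B ∘ₗ Finsupp.lapply 0) (Finsupp.lapply 0)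

theorem Omega_odd : SuperSym.HasParity (minusGrading 𝓛) 1 X.Omega := by
  intro i j α β hα hβ h
  refine X.pairing_even (i + 1) j _ _ (X.B_odd i _ (hα 0)) (hβ 0) fun h0 => h ?_
  revert h0
  clear h hα hβ
  revert i j
  decide

theorem Omega_symm : SuperSym.IsGradedSymm (minusGrading 𝓛) X.Omega := by
  intro i j α β hα hβ
  have h1 := X.pairing_symm (i + 1) j _ _ (X.B_odd i _ (hα 0)) (hβ 0)
  have h2 := X.pairing_B j (β 0) (α 0) (hβ 0)
  simp only [Omega, LinearMap.compl₁₂_apply, LinearMap.comp_apply, Finsupp.lapply_apply]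
  rw [h1, h2, smul_smul, add_mul, one_mul, sgn_add]

end CircleComplex

/-- A chain-level splitting of the Hodge filtration: an (even) map of complexes
`S : (L, b) → (L_+, b + uB)` of the form `S = id + S_1 u + S_2 u² + ⋯`. -/
structure ChainSplitting {𝓛 : ZMod 2 → Submodule K L} (X : CircleComplex 𝓛) where
  toFun : L →ₗ[K] (ℕ → L)
  even : ∀ (i : ZMod 2) (x : L), x ∈ 𝓛 i → ∀ n, toFun x n ∈ 𝓛 i
  map_diff : ∀ x : L, toFun (X.b x) = X.plusDiff (toFun x)
  apply_zero : ∀ x : L, toFun x 0 = x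

namespace ChainSplitting

variable {𝓛 : ZMod 2 → Submodule K L} {X : CircleComplex 𝓛} (S : ChainSplitting X)

/-- The coefficient `S_n` of `u^n` in `S`. -/
def coeff (n : ℕ) : Module.End K L := LinearMap.proj n ∘ₗ S.toFun

/-- The coefficients `R_n` of the inverse `R = id + R_1 u + R_2 u² + ⋯` of the `u`-linear extension
of `S`, determined by `R_0 = id` and `∑_{i + j = n} R_i S_j = 0` for `n ≥ 1`. -/
def invCoeff : ℕ → Module.End K L
  | 0 => LinearMap.id
  | n + 1 => -∑ i : Fin (n + 1), invCoeff i ∘ₗ S.coeff (n + 1 - i)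

theorem invCoeff_even (n : ℕ) : ∀ (i : ZMod 2) (x : L), x ∈ 𝓛 i → S.invCoeff n x ∈ 𝓛 i := by
  induction n using Nat.strong_induction_on with
  | _ n ih =>
    intro i x hx
    match n with
    | 0 => simpa [invCoeff] using hx
    | n + 1 =>
      rw [invCoeff]
      simp only [LinearMap.neg_apply, LinearMap.sum_apply, LinearMap.comp_apply]
      exact neg_mem (sum_mem fun k _ => ih k k.isLt i _ (S.even i x hx _))

/-- The homotopy operator `H : L_- ⊗ L_- → K`,
`H(u^{-i} x, u^{-j} y) = ⟨(-1)^j ∑_{l=0}^{j} S_l R_{i+j+1-l} x, y⟩`. -/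
def homotopy : (ℕ →₀ L) →ₗ[K] (ℕ →₀ L) →ₗ[K] K :=
  Finsupp.lsum K fun i => LinearMap.flip <| Finsupp.lsum K fun j => LinearMap.flip <|
    X.pairing ∘ₗ
      ((-1 : K) ^ j • ∑ l ∈ Finset.range (j + 1), S.coeff l ∘ₗ S.invCoeff (i + j + 1 - l))

theorem homotopy_single (i j : ℕ) (x y : L) :
    S.homotopy (Finsupp.single i x) (Finsupp.single j y) = X.pairing
      ((-1 : K) ^ j • ∑ l ∈ Finset.range (j + 1), S.coeff l (S.invCoeff (i + j + 1 - l) x)) y := by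
  simp [homotopy]

theorem homotopy_even : SuperSym.HasParity (minusGrading 𝓛) 0 S.homotopy := by
  intro i j α β hα hβ h
  rw [← Finsupp.sum_single α, ← Finsupp.sum_single β]
  simp only [Finsupp.sum, map_sum, LinearMap.sum_apply, homotopy_single]
  refine Finset.sum_eq_zero fun k _ => Finset.sum_eq_zero fun l _ => ?_
  exact X.pairing_even i j _ _ (Submodule.smul_mem _ _ (sum_mem fun r _ =>
    S.even i _ (S.invCoeff_even _ i _ (hα _)) r)) (hβ _) h

variable [DirectSum.Decomposition 𝓛]

/-- The symmetrization `H^sym(x, y) = (1/2) (H(x, y) + (-1)^{|x||y|} H(y, x))`. -/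
def homotopySym : (ℕ →₀ L) →ₗ[K] (ℕ →₀ L) →ₗ[K] K :=
  (2⁻¹ : K) • (S.homotopy + SuperSym.gradedFlip (minusGrading 𝓛) S.homotopy)

theorem homotopySym_even : SuperSym.HasParity (minusGrading 𝓛) 0 S.homotopySym := by
  intro i j α β hα hβ h
  have h1 := S.homotopy_even i j α β hα hβ h
  have h2 := S.homotopy_even j i β α hβ hα (by rwa [add_comm])
  simp [homotopySym, SuperSym.gradedFlip_apply _ _ hα hβ, h1, h2]

theorem homotopySym_symm : SuperSym.IsGradedSymm (minusGrading 𝓛) S.homotopySym := by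
  intro i j α β hα hβ
  simp only [homotopySym, LinearMap.smul_apply, LinearMap.add_apply,
    SuperSym.gradedFlip_apply _ _ hα hβ, SuperSym.gradedFlip_apply _ _ hβ hα, mul_comm j i]
  rw [smul_comm, smul_add (sgn (i * j)), smul_smul (sgn (i * j)), sgn_mul_self, one_smul, add_comm]

end ChainSplitting

/-! ## The two DGLAs -/

/-- The space `Sym(L_-)`. -/
abbrev SymMinus (𝓛 : ZMod 2 → Submodule K L) : Type _ := SuperSym (minusGrading 𝓛)

/-- The ring `K[[ħ, λ]]`; `ħ` is the variable `0` and `λ` is the variable `1`. -/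
abbrev Scalars (K : Type*) [Field K] : Type _ := MvPowerSeries (Fin 2) K

/-- The space `Sym(L_-)[[ħ, λ]]`, which is the space `𝔥[1]` up to an even shift. -/
abbrev SymSeries (𝓛 : ZMod 2 → Submodule K L) : Type _ := MvPowerSeries (Fin 2) (SymMinus 𝓛)

/-- `Sym(L_-)[[ħ, λ]]` is an algebra over `K[[ħ, λ]]`. -/
instance SymSeries.algebra (𝓛 : ZMod 2 → Submodule K L) : Algebra (Scalars K) (SymSeries 𝓛) :=
  (MvPowerSeries.map (algebraMap K (SymMinus 𝓛))).toAlgebra' fun r x => by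
    ext n
    simp only [MvPowerSeries.coeff_mul, MvPowerSeries.coeff_map]
    exact Finset.sum_nbij' Prod.swap Prod.swap (by simp [add_comm]) (by simp [add_comm])
      (by simp) (by simp) fun p _ => Algebra.commutes _ _

theorem SymSeries.coeff_smul {𝓛 : ZMod 2 → Submodule K L} (r : Scalars K) (x : SymSeries 𝓛)
    (n : Fin 2 →₀ ℕ) : MvPowerSeries.coeff n (r • x) =
      ∑ p ∈ Finset.HasAntidiagonal.antidiagonal n, MvPowerSeries.coeff p.1 r • MvPowerSeries.coeff p.2 x := by
  rw [Algebra.smul_def]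
  simp only [MvPowerSeries.coeff_mul, Algebra.smul_def]
  rfl

/-- The `K[[ħ, λ]]`-linear extension of a linear map `T : Sym(L_-) → Sym(L_-)`; it acts on the
coefficients. -/
def SymSeries.mapCoeff {𝓛 : ZMod 2 → Submodule K L} (T : Module.End K (SymMinus 𝓛)) :
    Module.End (Scalars K) (SymSeries 𝓛) where
  toFun x := fun n => T (MvPowerSeries.coeff n x)
  map_add' x y := by
    funext n
    simp
    rfl
  map_smul' r x := by
    refine MvPowerSeries.ext fun n => ?_
    refine (congrArg T (SymSeries.coeff_smul r x n)).trans
      (Eq.trans ?_ (SymSeries.coeff_smul r _ n).symm)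
    simp only [map_sum, map_smul]
    rfl

/-- The `ℤ/2`-grading of `Sym(L_-)[[ħ, λ]]`; the variables are even. -/
def SymSeries.parity (𝓛 : ZMod 2 → Submodule K L) (p : ZMod 2) :
    Submodule (Scalars K) (SymSeries 𝓛) where
  carrier := {x | ∀ n, MvPowerSeries.coeff n x ∈ SuperSym.parity (minusGrading 𝓛) p}
  add_mem' h h' n := by
    rw [map_add]
    exact add_mem (h n) (h' n)
  zero_mem' n := by
    rw [map_zero]
    exact zero_mem _
  smul_mem' r x h n := by
    rw [SymSeries.coeff_smul]
    exact sum_mem fun q _ => Submodule.smul_mem _ _ (h _)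

namespace CircleComplex

variable {𝓛 : ZMod 2 → Submodule K L} [DirectSum.Decomposition 𝓛] (X : CircleComplex 𝓛)

/-- The differential `b + uB` of `Sym(L_-)`, extended from `L_-` as a derivation. -/
def symDiff : Module.End K (SymMinus 𝓛) :=
  SuperSym.derivation (minusGrading 𝓛) 1 X.minusDiff X.minusDiff_odd

/-- The BV operator `Δ` of `Sym(L_-)`, the second order differential operator that vanishes on
`Sym^{≤ 1}` and has `Δ(x y) = Ω(x, y)` for `x, y` in `L_-`. -/
def Delta : Module.End K (SymMinus 𝓛) :=
  SuperSym.secondOrder (minusGrading 𝓛) 1 X.Omega X.Omega_odd X.Omega_symm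

/-- The DGLA `𝔥 = Sym(L_-)[[ħ, λ]][1]` with differential `b + uB + ħΔ` and bracket
`{x, y} = Δ(x y) - Δ(x) y - (-1)^{|x|} x Δ(y)`. -/
def dgla : ShiftedLieData (Scalars K) (SymSeries 𝓛) where
  grading := SymSeries.parity 𝓛
  d := SymSeries.mapCoeff X.symDiff + (MvPowerSeries.X 0 : Scalars K) • SymSeries.mapCoeff X.Delta
  bracket :=
    (LinearMap.mul (Scalars K) (SymSeries 𝓛)).compr₂ (SymSeries.mapCoeff X.Delta) -
      (LinearMap.mul (Scalars K) (SymSeries 𝓛)).compl₁₂ (SymSeries.mapCoeff X.Delta) LinearMap.id -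
      (LinearMap.mul (Scalars K) (SymSeries 𝓛)).compl₁₂
        (SymSeries.mapCoeff (SuperSym.twist (minusGrading 𝓛) 1).toLinearMap)
        (SymSeries.mapCoeff X.Delta)

/-- The DGLA `𝔥^triv`: the same space with differential `b + uB` and zero bracket. -/
def trivialDgla : ShiftedLieData (Scalars K) (SymSeries 𝓛) where
  grading := SymSeries.parity 𝓛
  d := SymSeries.mapCoeff X.symDiff
  bracket := 0

end CircleComplex

/-! ## Marked graphs and Feynman sums -/

/-- A marked graph with vertices `1, …, m` and `N` half-edges (flags). The half-edge `h` is
attached to the vertex `vert h`; the involution `inv` glues pairs of half-edges to edges, and its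
fixed points are the leaves. Loops, multiple edges, and vertices without half-edges are allowed. -/
@[ext]
structure MarkedGraph (m N : ℕ) where
  vert : Fin N → Fin m
  inv : Equiv.Perm (Fin N)
  inv_inv : ∀ h, inv (inv h) = h

namespace MarkedGraph

variable {m N : ℕ}

instance : Finite (MarkedGraph m N) :=
  Finite.of_injective (fun G : MarkedGraph m N => (G.vert, G.inv)) fun G G' h => by
    ext1
    · exact congrArg Prod.fst h
    · exact congrArg Prod.snd h

/-- Renaming of the half-edges. Two marked graphs are isomorphic, by an isomorphism that preserves
the marking of the vertices, exactly if a renaming of the half-edges takes one to the other. The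
automorphism group of a marked graph is its stabilizer. -/
instance : MulAction (Equiv.Perm (Fin N)) (MarkedGraph m N) where
  smul τ G :=
    { vert := fun h => G.vert (τ⁻¹ h)
      inv := τ * G.inv * τ⁻¹
      inv_inv := fun h => by simp [Equiv.Perm.mul_apply, G.inv_inv] }
  one_smul G := by
    ext1
    · funext h
      simp [HSMul.hSMul]
    · simp [HSMul.hSMul]
  mul_smul σ τ G := by
    ext1
    · funext h
      simp [HSMul.hSMul]
    · simp [HSMul.hSMul, mul_assoc]

/-- The set of isomorphism classes of marked graphs. -/
abbrev IsoClass (m N : ℕ) : Type :=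
  MulAction.orbitRel.Quotient (Equiv.Perm (Fin N)) (MarkedGraph m N)

instance : Fintype (IsoClass m N) := Fintype.ofFinite _

/-- The order of the automorphism group. -/
def autCard (G : MarkedGraph m N) : ℕ :=
  Nat.card (MulAction.stabilizer (Equiv.Perm (Fin N)) G)

/-- Every two vertices are joined by a path of edges. -/
def Connected (G : MarkedGraph m N) : Prop :=
  ∀ v w : Fin m, Relation.EqvGen (fun v w => ∃ h, G.vert h = v ∧ G.vert (G.inv h) = w) v w

/-- The edges, in some order; the edge with half-edges `h < inv h` is represented by `h`. -/
def edges (G : MarkedGraph m N) : List (Fin N) :=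
  (List.finRange N).filter fun h => h < G.inv h

/-- The leaves, in some order. -/
def leaves (G : MarkedGraph m N) : List (Fin N) :=
  (List.finRange N).filter fun h => G.inv h = h

/-- The genus `∑_v g(v) + rank H_1` of a connected graph with genus labels `g`; the rank of `H_1` is
the number of edges minus the number of vertices plus `1`. -/
def genus (G : MarkedGraph m N) (g : Fin m → ℕ) : ℕ :=
  ∑ v, g v + (G.edges.length + 1 - m)

/-- The order in which the half-edges are contracted: the edges first, the two half-edges of an
edge next to each other, and then the leaves. -/
def contractionOrder (G : MarkedGraph m N) : List (Fin N) :=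
  (G.edges.flatMap fun h => [h, G.inv h]) ++ G.leaves

end MarkedGraph

/-- The block of the elements `x_k` with `β k = v`, multiplied in `Sym V`. -/
def blockProduct {V : Type*} [AddCommGroup V] [Module K V] (𝒱 : ZMod 2 → Submodule K V) {m N : ℕ}
    (β : Fin N → Fin m) (x : Fin N → V) (v : Fin m) : SuperSym 𝒱 :=
  (((List.finRange N).filter fun k => β k = v).map fun k => SuperSym.ι 𝒱 (x k)).prod

open Classical in
/-- The value `𝒦_G(γ_1, …, γ_m)` in `Sym V` of the Feynman contraction for the marked graph `G` with
edge contractions by the form `Q`, where `γ_v` is the product of the homogeneous elements `x_k` with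
`β k = v`, `x_k` has parity `ε k`, and `β` is monotone, so that
`γ_1 ⊗ ⋯ ⊗ γ_m` is the image of `x_1 ⊗ ⋯ ⊗ x_N`.
The desymmetrizations of `γ_1, …, γ_m` amount to the sum over all the bijections `π` from the
half-edges to `{1, …, N}` that decorate the half-edges at the vertex `v` by the factors of `γ_v`.
In each summand the factors `x_{π h}` are permuted, with the Koszul sign, into the contraction
order, the pairs that belong to edges are contracted, and the decorations of the leaves are
multiplied in `Sym V`. If the valencies of `G` are not the numbers of factors of `γ_1, …, γ_m`,
there is no such `π` and the value is `0`. -/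
def feynmanContraction {V : Type*} [AddCommGroup V] [Module K V] (𝒱 : ZMod 2 → Submodule K V)
    (Q : V →ₗ[K] V →ₗ[K] K) {m N : ℕ} (G : MarkedGraph m N) (β : Fin N → Fin m)
    (ε : Fin N → ZMod 2) (x : Fin N → V) : SuperSym 𝒱 :=
  ∑ π : Equiv.Perm (Fin N) with ∀ h, β (π h) = G.vert h,
    koszulSign ε (G.contractionOrder.map π) •
      (G.edges.map fun h => Q (x (π h)) (x (π (G.inv h)))).prod •
        (G.leaves.map fun h => SuperSym.ι 𝒱 (x (π h))).prod

section

variable {𝓛 : ZMod 2 → Submodule K L} [DirectSum.Decomposition 𝓛] {X : CircleComplex 𝓛}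

/-- The operator `Δ^{H^sym}`, the second order differential operator on `Sym(L_-)` that extends
`H^sym`. -/
def ChainSplitting.deltaHSym (S : ChainSplitting X) : Module.End K (SymMinus 𝓛) :=
  SuperSym.secondOrder (minusGrading 𝓛) 0 S.homotopySym S.homotopySym_even S.homotopySym_symm

/-- The operator `exp(ħT) = ∑_l (1/l!) ħ^l T^l` on `Sym(L_-)[[ħ, λ]]`. The coefficient at
`ħ^g λ^p` involves only the terms with `l ≤ g`. -/
def SymSeries.expHbar (T : Module.End K (SymMinus 𝓛)) (x : SymSeries 𝓛) : SymSeries 𝓛 := fun n =>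
  ∑ l ∈ Finset.range (n 0 + 1),
    ((Nat.factorial l : K)⁻¹) • (T ^ l) (MvPowerSeries.coeff (n - Finsupp.single 0 l) x)

open Classical in
/-- The components of `𝒦` are the Feynman sums
`𝒦_m(γ_1 ħ^{g_1}, …, γ_m ħ^{g_m}) = ∑_{(G, f)} |Aut(G, f)|⁻¹ 𝒦_{(G, f)}(γ_1, …, γ_m) ħ^{g(G)}`
over the isomorphism classes of connected marked graphs with `m` vertices, where the vertices have
the genus labels `g_1, …, g_m` and `𝒦_{(G, f)}` contracts the edges by `H^sym`. As the components
are `K[[ħ, λ]]`-multilinear, their values on products `γ_v` of homogeneous elements of `L_-`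
determine them. The graphs have as many half-edges as there are factors in all the `γ_v`. -/
def IsFeynmanSum (S : ChainSplitting X) (𝒦 : LInftyMorphism X.dgla X.trivialDgla) : Prop :=
  ∀ (m N : ℕ), 0 < m → ∀ (g : Fin m → ℕ) (β : Fin N → Fin m), Monotone β →
    ∀ (ε : Fin N → ZMod 2) (x : Fin N → ℕ →₀ L), (∀ k, x k ∈ minusGrading 𝓛 (ε k)) →
      𝒦.comp m (fun v => (MvPowerSeries.X 0 : Scalars K) ^ g v •
          MvPowerSeries.C (blockProduct (minusGrading 𝓛) β x v)) =
        ∑ c : MarkedGraph.IsoClass m N with (Quotient.out c).Connected,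
          (MvPowerSeries.X 0 : Scalars K) ^ (Quotient.out c).genus g •
            MvPowerSeries.C (((Quotient.out c).autCard : K)⁻¹ •
              feynmanContraction (minusGrading 𝓛) S.homotopySym (Quotient.out c) β ε x)

end

end Circle

end

noncomputable section

set_option linter.unusedSectionVars false

/-! ## Operators on the graded symmetric algebra -/

/-! All arguments are handled at once in `Sym((L_-)^m)`, where the slot `v` of `(L_-)^m` carries the
`v`-th argument. For an ordered pair `e = (v, w)` of slots let `T_e` contract a factor in slot `v`
with a factor in slot `w` by `H^sym`, halved if `v ≠ w`. Then `𝒦_m(x_1, …, x_m)` is the part of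
`exp(∑_e T_e)`, applied to `x_1 ⋯ x_m`, that comes from the words `T_{e_1} ⋯ T_{e_n}` whose edges
connect all the slots, followed by the multiplication of the slots; a word of length `n = l + m - 1`
carries `ħ^l`. This is `component`, built from the weighted divided powers `edgeOp`.

The bar equation rests on one identity: the coboundary of `H^sym` is `-Ω` (`homotopySym_diff`), a
telescoping consequence of `S b = (b + uB) S` and `S R = 1` (`partialSum_b`). So the commutator of
`b + uB` with `T_e` is the contraction `Ω_e`, which commutes with every `T_f`, and moving `b + uB`
through a divided power replaces one `H^sym`-edge by an `Ω`-edge (`edgeOp_succ_mul`,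
`symDiff_contraction`). If the `Ω`-edge is a loop at `v`, it does not matter for connectedness and
yields `ħ Δ x_v`. If it joins `i ≠ j`, the graph is connected exactly if it is so after collapsing
that edge (`edgesConnect_insert_iff`), and contracting and merging two slots gives the bracket
(`pushHom_slotOp_bracket`). These are the terms of the bar differential of `𝔥`; the target
contributes only `b + uB`.

The Feynman formula is Wick's theorem (`edgeOp_list_prod`), which writes a divided power on a
product of generators as a sum over involutions of the factors, together with orbit counting
(`sum_orbits`), which turns the sum over labelled graphs into one over isomorphism classes weighted
by `1/|Aut|`. With one slot every set of edges is connected, so `𝒦_1 = exp(ħ Δ^{H^sym})`, which has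
the inverse `exp(-ħ Δ^{H^sym})`; hence the quasi-isomorphism.

The DGLA axioms follow formally from `Δ² = 0`, from `Δ` being of second order, and from its
anticommuting with `b + uB`. Uniqueness holds because a `K[[ħ, λ]]`-multilinear map is determined by
its values on products of homogeneous elements (`multilinearMap_eq_zero`); no continuity is needed.
-/

theorem sgn_zero : sgn 0 = 1 := rfl

theorem sgn_one : sgn 1 = -1 := rfl

theorem zmod_two_cases (a : ZMod 2) : a = 0 ∨ a = 1 := by
  revert a; decide

theorem sum_zmod_two {M : Type*} [AddCommMonoid M] (f : ZMod 2 → M) :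
    ∑ i, f i = f 0 + f 1 := Fin.sum_univ_two f

namespace SuperSym

section Graded

variable {K : Type*} [Field K] {V : Type*} [AddCommGroup V] [Module K V]
  {𝒱 : ZMod 2 → Submodule K V} [DirectSum.Decomposition 𝒱]

theorem proj_mem (i : ZMod 2) (x : V) : proj 𝒱 i x ∈ 𝒱 i := by
  simp [proj]

/-- A linear form is homogeneous of parity `p`. -/
def IsHom (𝒱 : ZMod 2 → Submodule K V) [DirectSum.Decomposition 𝒱] (p : ZMod 2)
    (φ : V →ₗ[K] K) : Prop :=
  ∀ i x, x ∈ 𝒱 i → i ≠ p → φ x = 0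

theorem IsHom.comp_proj {p : ZMod 2} {φ : V →ₗ[K] K} (h : IsHom 𝒱 p φ) :
    ∀ j ≠ p, φ ∘ₗ proj 𝒱 j = 0 := fun j hj => by
  ext x
  exact h j _ (proj_mem j x) hj

theorem HasParity.isHom {q : ZMod 2} {Q : V →ₗ[K] V →ₗ[K] K} (hQ : HasParity 𝒱 q Q)
    {i : ZMod 2} {x : V} (hx : x ∈ 𝒱 i) : IsHom 𝒱 (i + q) (Q x) := by
  intro j y hy hj
  refine hQ i j x y hx hy fun h => hj ?_
  rw [← h, ← add_assoc, CharTwo.add_self_eq_zero, zero_add]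

theorem isHom_contract_ι_mul {i p : ZMod 2} {φ : V →ₗ[K] K} (hφ : IsHom 𝒱 p φ)
    {x : V} (hx : x ∈ 𝒱 i) (s : SuperSym 𝒱) :
    contract 𝒱 φ (ι 𝒱 x * s) = φ x • s + sgn (p * i) • (ι 𝒱 x * contract 𝒱 φ s) :=
  contract_ι_mul hφ.comp_proj hx s

variable (𝒱) in
/-- Induction by left multiplication with homogeneous elements of `V`. -/
theorem left_induction {P : SuperSym 𝒱 → Prop} (one : P 1)
    (add : ∀ s t, P s → P t → P (s + t)) (smul : ∀ (r : K) s, P s → P (r • s))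
    (ι_mul : ∀ i x, x ∈ 𝒱 i → ∀ s, P s → P (ι 𝒱 x * s)) (s : SuperSym 𝒱) : P s := by
  -- Strengthened to "multiplication by any `t` preserves `P`", so that a product `t = a * b` acts
  -- as a composite.
  suffices h : ∀ t s, P s → P (t * s) by simpa using h s 1 one
  intro t
  induction t using SuperSym.induction with
  | algebraMap r => intro s hs; rw [← Algebra.smul_def]; exact smul r s hs
  | ι x =>
    intro s hs
    rw [← sum_proj 𝒱 x, map_sum, sum_zmod_two, add_mul]
    exact add _ _ (ι_mul _ _ (proj_mem _ x) s hs) (ι_mul _ _ (proj_mem _ x) s hs)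
  | mul a b ha hb => intro s hs; rw [mul_assoc]; exact ha _ (hb _ hs)
  | add a b ha hb => intro s hs; rw [add_mul]; exact add _ _ (ha _ hs) (hb _ hs)

theorem linearMap_ext {M : Type*} [AddCommGroup M] [Module K M] {f g : SuperSym 𝒱 →ₗ[K] M}
    (one : f 1 = g 1)
    (ι_mul : ∀ i x, x ∈ 𝒱 i → ∀ s, f s = g s → f (ι 𝒱 x * s) = g (ι 𝒱 x * s)) : f = g := by
  ext s
  induction s using left_induction 𝒱 with
  | one => exact one
  | add s t hs ht => rw [map_add, map_add, hs, ht]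
  | smul r s hs => rw [map_smul, map_smul, hs]
  | ι_mul i x hx s hs => exact ι_mul i x hx s hs

theorem algHom_ext {A : Type*} [Ring A] [Algebra K A] {f g : SuperSym 𝒱 →ₐ[K] A}
    (h : ∀ i x, x ∈ 𝒱 i → f (ι 𝒱 x) = g (ι 𝒱 x)) : f = g := by
  have : f.toLinearMap = g.toLinearMap := linearMap_ext (by simp) (by
    intro i x hx s hs
    simp only [AlgHom.toLinearMap_apply, map_mul] at hs ⊢
    rw [hs, h i x hx])
  ext s
  exact LinearMap.congr_fun this s

/-! ### Parity and the twist -/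

theorem twist_ι_of_mem (p : ZMod 2) {i : ZMod 2} {x : V} (hx : x ∈ 𝒱 i) :
    twist 𝒱 p (ι 𝒱 x) = sgn (p * i) • ι 𝒱 x := by
  rw [twist_ι, twistMap_of_mem p hx, map_zsmul]

theorem twist_twist (p q : ZMod 2) (s : SuperSym 𝒱) :
    twist 𝒱 p (twist 𝒱 q s) = twist 𝒱 (p + q) s := by
  refine AlgHom.congr_fun (φ₁ := (twist 𝒱 p).comp (twist 𝒱 q)) (algHom_ext fun i x hx => ?_) s
  rw [AlgHom.comp_apply, twist_ι_of_mem q hx, map_zsmul, twist_ι_of_mem p hx,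
    twist_ι_of_mem _ hx, smul_smul, ← sgn_add, add_mul, add_comm]

theorem twist_zero (s : SuperSym 𝒱) : twist 𝒱 0 s = s := by
  refine AlgHom.congr_fun (φ₂ := AlgHom.id K _) (algHom_ext fun i x hx => ?_) s
  rw [twist_ι_of_mem _ hx, zero_mul, sgn_zero, one_smul, AlgHom.id_apply]

theorem one_mem_parity : (1 : SuperSym 𝒱) ∈ parity 𝒱 0 :=
  Submodule.subset_span ⟨0, Fin.elim0, Fin.elim0, fun k => k.elim0, by simp, by simp⟩

theorem ι_mul_mem_parity {i j : ZMod 2} {x : V} (hx : x ∈ 𝒱 i) {s : SuperSym 𝒱}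
    (hs : s ∈ parity 𝒱 j) : ι 𝒱 x * s ∈ parity 𝒱 (i + j) := by
  induction hs using Submodule.span_induction with
  | mem s h =>
    obtain ⟨n, ε, y, hy, hε, rfl⟩ := h
    refine Submodule.subset_span ⟨n + 1, Fin.cons i ε, Fin.cons x y, fun k => ?_, ?_, ?_⟩
    · refine Fin.cases ?_ (fun k => ?_) k
      · simpa using hx
      · simpa using hy k
    · simp [Fin.sum_univ_succ, hε]
    · simp [List.ofFn_succ]
  | zero => simp
  | add s t _ _ hs ht => rw [mul_add]; exact add_mem hs ht
  | smul r s _ hs => rw [mul_smul_comm]; exact Submodule.smul_mem _ _ hs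

theorem twist_of_mem_parity (p : ZMod 2) {j : ZMod 2} {s : SuperSym 𝒱} (hs : s ∈ parity 𝒱 j) :
    twist 𝒱 p s = sgn (p * j) • s := by
  induction hs using Submodule.span_induction with
  | mem s h =>
    obtain ⟨n, ε, y, hy, rfl, rfl⟩ := h
    induction n with
    | zero => simp [sgn_zero]
    | succ n ih =>
      rw [List.ofFn_succ, List.prod_cons, map_mul, twist_ι_of_mem p (hy 0),
        ih (fun k => ε k.succ) (fun k => y k.succ) (fun k => hy _), Fin.sum_univ_succ, mul_add,
        sgn_add, smul_mul_smul_comm]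
  | zero => simp
  | add s t _ _ hs ht => rw [map_add, hs, ht, smul_add]
  | smul r s _ hs => rw [map_smul, hs, smul_comm]

theorem exists_parity_add (s : SuperSym 𝒱) :
    ∃ a ∈ parity 𝒱 0, ∃ b ∈ parity 𝒱 1, s = a + b := by
  induction s using left_induction 𝒱 with
  | one => exact ⟨1, one_mem_parity, 0, zero_mem _, by simp⟩
  | add s t hs ht =>
    obtain ⟨a, ha, b, hb, rfl⟩ := hs
    obtain ⟨c, hc, d, hd, rfl⟩ := ht
    exact ⟨a + c, add_mem ha hc, b + d, add_mem hb hd, by abel⟩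
  | smul r s hs =>
    obtain ⟨a, ha, b, hb, rfl⟩ := hs
    exact ⟨r • a, Submodule.smul_mem _ _ ha, r • b, Submodule.smul_mem _ _ hb, smul_add _ _ _⟩
  | ι_mul i x hx s hs =>
    obtain ⟨a, ha, b, hb, rfl⟩ := hs
    have h0 := ι_mul_mem_parity hx ha
    have h1 := ι_mul_mem_parity hx hb
    obtain rfl | rfl := zmod_two_cases i
    · rw [zero_add] at h0 h1
      exact ⟨_, h0, _, h1, mul_add _ _ _⟩
    · rw [add_zero] at h0
      rw [CharTwo.add_self_eq_zero] at h1
      exact ⟨_, h1, _, h0, by rw [mul_add, add_comm]⟩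

/-- The basic use of characteristic zero: it separates the two parity parts, and it makes an odd
operator that anticommutes with itself square to zero. -/
theorem smul_two_eq_zero [CharZero K] {M : Type*} [AddCommGroup M] [Module K M] {x : M}
    (h : x = -x) : x = 0 := by
  have h2 : (2 : K) • x = 0 := by
    rw [two_smul]
    exact eq_neg_iff_add_eq_zero.1 h
  exact (smul_eq_zero.1 h2).resolve_left two_ne_zero

/-- The parity parts become eigenspaces of the grading automorphism, because the component of the
wrong parity equals its own negative. Homogeneity of an image is then a commutation relation with
`twist`. -/
theorem mem_parity_iff [CharZero K] {p : ZMod 2} {s : SuperSym 𝒱} :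
    s ∈ parity 𝒱 p ↔ twist 𝒱 1 s = sgn p • s := by
  refine ⟨fun h => by simpa using twist_of_mem_parity 1 h, fun h => ?_⟩
  obtain ⟨a, ha, b, hb, rfl⟩ := exists_parity_add s
  have h0 := twist_of_mem_parity 1 ha
  have h1 := twist_of_mem_parity 1 hb
  rw [map_add, h0, h1] at h
  obtain rfl | rfl := zmod_two_cases p
  · have : b = 0 := smul_two_eq_zero (K := K) (by simpa [sgn] using h.symm)
    simpa [this] using ha
  · have : a = 0 := smul_two_eq_zero (K := K) (by simpa [sgn] using h)
    simpa [this] using hb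

theorem mul_mem_parity [CharZero K] {i j : ZMod 2} {s t : SuperSym 𝒱} (hs : s ∈ parity 𝒱 i)
    (ht : t ∈ parity 𝒱 j) : s * t ∈ parity 𝒱 (i + j) := by
  rw [mem_parity_iff] at *
  rw [map_mul, hs, ht, sgn_add, smul_mul_smul_comm]

theorem ι_mul_eq {i : ZMod 2} {x : V} (hx : x ∈ 𝒱 i) (s : SuperSym 𝒱) :
    ι 𝒱 x * s = twist 𝒱 i s * ι 𝒱 x := by
  induction s using left_induction 𝒱 with
  | one => simp
  | add s t hs ht => rw [mul_add, map_add, add_mul, hs, ht]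
  | smul r s hs => rw [map_smul, mul_smul_comm, hs, smul_mul_assoc]
  | ι_mul j y hy s hs =>
    rw [← mul_assoc, ι_mul_ι hx hy, map_mul, twist_ι_of_mem i hy, smul_mul_assoc, mul_assoc, hs,
      smul_mul_assoc, smul_mul_assoc, mul_assoc]

/-- Only one factor has to be homogeneous, since `twist` carries the sign for the other one. This
spares decomposing `t`. -/
theorem mul_eq_of_mem_parity {i : ZMod 2} {s : SuperSym 𝒱} (hs : s ∈ parity 𝒱 i)
    (t : SuperSym 𝒱) : s * t = twist 𝒱 i t * s := by
  induction hs using Submodule.span_induction generalizing t with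
  | mem s h =>
    obtain ⟨n, ε, y, hy, rfl, rfl⟩ := h
    induction n generalizing t with
    | zero => simp [twist_zero]
    | succ n ih =>
      rw [List.ofFn_succ, List.prod_cons, mul_assoc,
        ih _ (fun k => ε k.succ) (fun k => y k.succ) (fun k => hy _), ← mul_assoc, ι_mul_eq (hy 0),
        twist_twist, Fin.sum_univ_succ, mul_assoc]
  | zero => simp
  | add s u _ _ hs hu => rw [add_mul, mul_add, hs, hu]
  | smul r s _ hs => rw [smul_mul_assoc, hs, mul_smul_comm]

theorem mul_comm_of_mem_parity {i j : ZMod 2} {s t : SuperSym 𝒱} (hs : s ∈ parity 𝒱 i)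
    (ht : t ∈ parity 𝒱 j) : s * t = sgn (i * j) • (t * s) := by
  rw [mul_eq_of_mem_parity hs, twist_of_mem_parity i ht, smul_mul_assoc]

/-! ### Contractions -/

theorem twist_contract {p : ZMod 2} {φ : V →ₗ[K] K} (hφ : IsHom 𝒱 p φ) (q : ZMod 2)
    (s : SuperSym 𝒱) :
    twist 𝒱 q (contract 𝒱 φ s) = sgn (q * p) • contract 𝒱 φ (twist 𝒱 q s) := by
  induction s using left_induction 𝒱 with
  | one => simp [contract_one]
  | add s t hs ht => simp only [map_add, hs, ht, smul_add]
  | smul r s hs => simp only [map_smul, hs]; rw [smul_comm]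
  | ι_mul i x hx s hs =>
    rw [isHom_contract_ι_mul hφ hx, map_add, map_smul, map_zsmul, map_mul, map_mul, hs,
      twist_ι_of_mem q hx, smul_mul_assoc, smul_mul_assoc, map_zsmul, isHom_contract_ι_mul hφ hx]
    simp only [smul_add, mul_smul_comm, smul_smul]
    congr 1
    -- The scalar `φ x` survives only for `i = p`, and there the two signs cancel. The same case
    -- split recurs in the next commutation rules.
    · by_cases h : i = p
      · rw [h, sgn_mul_self, one_smul]
      · rw [hφ i x hx h]; simp
    · congr 1; ring

theorem contract_mul {p : ZMod 2} {φ : V →ₗ[K] K} (hφ : IsHom 𝒱 p φ) (s t : SuperSym 𝒱) :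
    contract 𝒱 φ (s * t) = contract 𝒱 φ s * t + twist 𝒱 p s * contract 𝒱 φ t := by
  induction s using left_induction 𝒱 with
  | one => simp [contract_one]
  | add s u hs hu => simp only [add_mul, map_add, hs, hu]; abel
  | smul r s hs => simp only [smul_mul_assoc, map_smul, hs, smul_add]
  | ι_mul i x hx s hs =>
    rw [mul_assoc, isHom_contract_ι_mul hφ hx, isHom_contract_ι_mul hφ hx, hs, map_mul,
      twist_ι_of_mem p hx]
    simp only [smul_add, mul_add, add_mul, smul_mul_assoc, mul_assoc, add_assoc]

/-- The supercommutator of two derivations is a derivation, and this one vanishes on generators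
because a contraction turns them into scalars. -/
theorem contract_contract {p q : ZMod 2} {φ ψ : V →ₗ[K] K} (hφ : IsHom 𝒱 p φ)
    (hψ : IsHom 𝒱 q ψ) (s : SuperSym 𝒱) :
    contract 𝒱 φ (contract 𝒱 ψ s) = sgn (p * q) • contract 𝒱 ψ (contract 𝒱 φ s) := by
  induction s using left_induction 𝒱 with
  | one => simp [contract_one]
  | add s t hs ht => simp only [map_add, hs, ht, smul_add]
  | smul r s hs => simp only [map_smul, hs]; rw [smul_comm]
  | ι_mul i x hx s hs =>
    rw [isHom_contract_ι_mul hφ hx, isHom_contract_ι_mul hψ hx]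
    simp only [map_add, map_smul, map_zsmul, isHom_contract_ι_mul hφ hx,
      isHom_contract_ι_mul hψ hx, hs, smul_add, mul_smul_comm, smul_smul]
    have e1 : (sgn (p * q) * sgn (p * i)) • ψ x • contract 𝒱 φ s = ψ x • contract 𝒱 φ s := by
      by_cases h : i = q
      · rw [h, sgn_mul_self, one_smul]
      · rw [hψ i x hx h]; simp
    have e2 : sgn (q * i) • φ x • contract 𝒱 ψ s = sgn (p * q) • φ x • contract 𝒱 ψ s := by
      by_cases h : i = p
      · rw [h, mul_comm q p]
      · rw [hφ i x hx h]; simp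
    rw [e1, e2, show sgn (q * i) * (sgn (p * i) * sgn (p * q)) =
      sgn (p * q) * (sgn (p * i) * sgn (q * i)) by ring]
    abel

end Graded

end SuperSym

namespace SuperSym

section Operators

variable {K : Type*} [Field K] {V : Type*} [AddCommGroup V] [Module K V]
  {𝒱 : ZMod 2 → Submodule K V} [DirectSum.Decomposition 𝒱]

/-! ### Second order operators -/

theorem twist_secondOrder {q : ZMod 2} {Q : V →ₗ[K] V →ₗ[K] K} (hq : HasParity 𝒱 q Q)
    (hs : IsGradedSymm 𝒱 Q) (p : ZMod 2) (s : SuperSym 𝒱) :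
    twist 𝒱 p (secondOrder 𝒱 q Q hq hs s) =
      sgn (p * q) • secondOrder 𝒱 q Q hq hs (twist 𝒱 p s) := by
  induction s using left_induction 𝒱 with
  | one => simp [secondOrder_one]
  | add s t hs ht => simp only [map_add, hs, ht, smul_add]
  | smul r s hs => simp only [map_smul, hs]; rw [smul_comm]
  | ι_mul i x hx s ih =>
    rw [secondOrder_ι_mul _ _ _ _ _ hx, map_add, map_zsmul, map_mul, map_mul, ih,
      twist_ι_of_mem p hx, smul_mul_assoc, smul_mul_assoc, map_zsmul,
      secondOrder_ι_mul _ _ _ _ _ hx, twist_contract (hq.isHom hx)]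
    simp only [smul_add, mul_smul_comm, smul_smul, mul_add, sgn_add]
    congr 2
    · ring
    · ring

/-- Like partial derivatives, operators with constant coefficients supercommute. Splitting off a
left factor reduces this case to `contract_contract`, and that of two second order operators to this
one. -/
theorem secondOrder_contract {q p : ZMod 2} {Q : V →ₗ[K] V →ₗ[K] K} (hq : HasParity 𝒱 q Q)
    (hs : IsGradedSymm 𝒱 Q) {φ : V →ₗ[K] K} (hφ : IsHom 𝒱 p φ) (s : SuperSym 𝒱) :
    secondOrder 𝒱 q Q hq hs (contract 𝒱 φ s) =
      sgn (q * p) • contract 𝒱 φ (secondOrder 𝒱 q Q hq hs s) := by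
  induction s using left_induction 𝒱 with
  | one => simp [secondOrder_one, contract_one]
  | add s t hs ht => simp only [map_add, hs, ht, smul_add]
  | smul r s hs => simp only [map_smul, hs]; rw [smul_comm]
  | ι_mul i x hx s ih =>
    rw [secondOrder_ι_mul _ _ _ _ _ hx, isHom_contract_ι_mul hφ hx]
    simp only [map_add, map_smul, map_zsmul, secondOrder_ι_mul _ _ _ _ _ hx,
      isHom_contract_ι_mul hφ hx, ih, smul_add, mul_smul_comm, smul_smul,
      contract_contract hφ (hq.isHom hx)]
    have e1 : (sgn (q * p) * sgn (q * i)) • φ x • secondOrder 𝒱 q Q hq hs s =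
        φ x • secondOrder 𝒱 q Q hq hs s := by
      by_cases h : i = p
      · rw [h, sgn_mul_self, one_smul]
      · rw [hφ i x hx h]; simp
    rw [e1, show sgn (q * p) * sgn (p * (i + q)) = sgn (p * i) by
      rw [mul_add, sgn_add, mul_comm p q, mul_left_comm, sgn_mul_self, mul_one],
      show sgn (p * i) * (sgn (q * i) * sgn (q * p)) =
        sgn (q * p) * (sgn (q * i) * sgn (p * i)) by ring]
    abel

theorem secondOrder_secondOrder {q q' : ZMod 2} {Q Q' : V →ₗ[K] V →ₗ[K] K}
    (hq : HasParity 𝒱 q Q) (hs : IsGradedSymm 𝒱 Q) (hq' : HasParity 𝒱 q' Q')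
    (hs' : IsGradedSymm 𝒱 Q') (s : SuperSym 𝒱) :
    secondOrder 𝒱 q Q hq hs (secondOrder 𝒱 q' Q' hq' hs' s) =
      sgn (q * q') • secondOrder 𝒱 q' Q' hq' hs' (secondOrder 𝒱 q Q hq hs s) := by
  induction s using left_induction 𝒱 with
  | one => simp [secondOrder_one]
  | add s t hs ht => simp only [map_add, hs, ht, smul_add]
  | smul r s hs => simp only [map_smul, hs]; rw [smul_comm]
  | ι_mul i x hx s ih =>
    simp only [map_add, map_zsmul, secondOrder_ι_mul _ _ _ _ _ hx,
      ih, smul_add, mul_smul_comm, smul_smul,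
      secondOrder_contract hq hs (hq'.isHom hx), secondOrder_contract hq' hs' (hq.isHom hx),
      mul_add, sgn_add]
    rw [show sgn (q * q') * (sgn (q' * i) * sgn (q' * q)) = sgn (q' * i) by
      rw [mul_comm q' q, mul_left_comm, sgn_mul_self, mul_one],
      show sgn (q' * i) * (sgn (q * i) * sgn (q * q')) =
        sgn (q * q') * (sgn (q * i) * sgn (q' * i)) by ring, mul_comm (sgn (q * q')) (sgn (q * i))]
    abel

/-- An odd operator that supercommutes with itself satisfies `Δ² = -Δ²`. -/
theorem secondOrder_odd_square [CharZero K] {Q : V →ₗ[K] V →ₗ[K] K} (hq : HasParity 𝒱 1 Q)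
    (hs : IsGradedSymm 𝒱 Q) (s : SuperSym 𝒱) :
    secondOrder 𝒱 1 Q hq hs (secondOrder 𝒱 1 Q hq hs s) = 0 := by
  refine smul_two_eq_zero (K := K) ?_
  have h := secondOrder_secondOrder hq hs hq hs s
  rwa [mul_one, sgn_one, neg_one_smul] at h

/-! ### Derivations -/

section Derivation

variable {D : V →ₗ[K] V} (hD : ∀ (i : ZMod 2) (x : V), x ∈ 𝒱 i → D x ∈ 𝒱 (i + 1))

theorem derivation_one : derivation 𝒱 1 D hD 1 = 0 := by
  rw [derivation, extend_one]

theorem derivation_ι (x : V) : derivation 𝒱 1 D hD (ι 𝒱 x) = ι 𝒱 (D x) := by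
  rw [derivation, extend_ι, LinearMap.comp_apply]

theorem derivation_mul (s t : SuperSym 𝒱) : derivation 𝒱 1 D hD (s * t) =
    derivation 𝒱 1 D hD s * t + twist 𝒱 1 s * derivation 𝒱 1 D hD t := by
  rw [derivation, extend_mul, AlgHom.id_apply, add_comm]

theorem derivation_ι_mul {i : ZMod 2} {x : V} (hx : x ∈ 𝒱 i) (s : SuperSym 𝒱) :
    derivation 𝒱 1 D hD (ι 𝒱 x * s) =
      ι 𝒱 (D x) * s + sgn i • (ι 𝒱 x * derivation 𝒱 1 D hD s) := by
  rw [derivation_mul, derivation_ι, twist_ι_of_mem 1 hx, one_mul, smul_mul_assoc]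

theorem twist_derivation (p : ZMod 2) (s : SuperSym 𝒱) :
    twist 𝒱 p (derivation 𝒱 1 D hD s) = sgn p • derivation 𝒱 1 D hD (twist 𝒱 p s) := by
  induction s using left_induction 𝒱 with
  | one => simp [derivation_one]
  | add s t hs ht => simp only [map_add, hs, ht, smul_add]
  | smul r s hs => simp only [map_smul, hs]; rw [smul_comm]
  | ι_mul i x hx s ih =>
    rw [derivation_ι_mul hD hx, map_add, map_zsmul, map_mul, map_mul, map_mul, ih,
      twist_ι_of_mem p hx, twist_ι_of_mem p (hD i x hx), smul_mul_assoc, smul_mul_assoc,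
      smul_mul_assoc, map_zsmul, derivation_ι_mul hD hx]
    simp only [smul_add, mul_smul_comm, smul_smul, mul_add, sgn_add, mul_one]
    congr 2
    · ring
    · ring

theorem derivation_derivation (h0 : ∀ x, D (D x) = 0) (s : SuperSym 𝒱) :
    derivation 𝒱 1 D hD (derivation 𝒱 1 D hD s) = 0 := by
  induction s using left_induction 𝒱 with
  | one => simp [derivation_one]
  | add s t hs ht => simp only [map_add, hs, ht, add_zero]
  | smul r s hs => simp only [map_smul, hs, smul_zero]
  | ι_mul i x hx s ih =>
    rw [derivation_ι_mul hD hx, map_add, derivation_ι_mul hD (hD i x hx), map_zsmul,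
      derivation_ι_mul hD hx, ih, h0, sgn_add, sgn_one]
    simp

/-- The commutator of a derivation with a contraction is a derivation with scalar values on
generators, hence again a contraction; evaluating on a generator shows that its form is `φ ∘ D` up
to sign. -/
theorem derivation_contract {p : ZMod 2} {φ : V →ₗ[K] K} (hφ : IsHom 𝒱 p φ) (s : SuperSym 𝒱) :
    derivation 𝒱 1 D hD (contract 𝒱 φ s) =
      sgn p • (contract 𝒱 φ (derivation 𝒱 1 D hD s) - contract 𝒱 (φ ∘ₗ D) s) := by
  have hφD : IsHom 𝒱 (p + 1) (φ ∘ₗ D) := fun i x hx hi =>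
    hφ (i + 1) _ (hD i x hx) fun h => hi (by
      rw [← h, add_assoc, CharTwo.add_self_eq_zero, add_zero])
  induction s using left_induction 𝒱 with
  | one => simp [derivation_one, contract_one]
  | add s t hs ht => simp only [map_add, hs, ht, ← smul_add]; congr 1; abel
  | smul r s hs => simp only [map_smul, hs]; rw [smul_comm, smul_sub]
  | ι_mul i x hx s ih =>
    rw [derivation_ι_mul hD hx, isHom_contract_ι_mul hφ hx, isHom_contract_ι_mul hφD hx]
    simp only [map_add, map_smul, map_zsmul, derivation_ι_mul hD hx, ih,
      isHom_contract_ι_mul hφ hx, isHom_contract_ι_mul hφ (hD i x hx), smul_add, smul_sub,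
      mul_smul_comm, smul_smul, LinearMap.comp_apply, mul_add, add_mul, sgn_add, mul_one, one_mul,
      mul_sub]
    have e1 : (sgn p * sgn i) • φ x • derivation 𝒱 1 D hD s = φ x • derivation 𝒱 1 D hD s := by
      by_cases h : i = p
      · rw [h, sgn_mul_self, one_smul]
      · rw [hφ i x hx h]; simp
    rw [e1, show sgn p * (sgn (p * i) * sgn p) = sgn (p * i) by
      rw [mul_left_comm, sgn_mul_self, mul_one],
      show sgn p * (sgn i * sgn (p * i)) = sgn (p * i) * (sgn i * sgn p) by ring,
      show sgn p * (sgn (p * i) * sgn i) = sgn (p * i) * (sgn i * sgn p) by ring]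
    abel

/-- The coboundary of the form `Q` governs the commutator. It is used with `P = 0` for `Q = Ω`, and,
slot by slot, with `P = Ω` for `Q = H^sym`. The equation `q' = q + 1` is a hypothesis so that `q'`
may be given in reduced form. -/
theorem derivation_secondOrder {q q' : ZMod 2} (hqq' : q' = q + 1) {Q P : V →ₗ[K] V →ₗ[K] K}
    (hq : HasParity 𝒱 q Q) (hs : IsGradedSymm 𝒱 Q) (hp : HasParity 𝒱 q' P)
    (hs' : IsGradedSymm 𝒱 P) (hP : ∀ i x y, x ∈ 𝒱 i →
      P x y = -(sgn q • (Q (D x) y + sgn i • Q x (D y)))) (s : SuperSym 𝒱) :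
    derivation 𝒱 1 D hD (secondOrder 𝒱 q Q hq hs s) =
      sgn q • secondOrder 𝒱 q Q hq hs (derivation 𝒱 1 D hD s) +
        secondOrder 𝒱 q' P hp hs' s := by
  subst hqq'
  induction s using left_induction 𝒱 with
  | one => simp [derivation_one, secondOrder_one]
  | add s t hs ht => simp only [map_add, hs, ht, smul_add]; abel
  | smul r s hs => simp only [map_smul, hs, smul_add]; rw [smul_comm]
  | ι_mul i x hx s ih =>
    have hPx : P x = -(sgn q • (Q (D x) + sgn i • (Q x ∘ₗ D))) := LinearMap.ext fun y => hP i x y hx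
    simp only [secondOrder_ι_mul _ _ _ _ _ hx, derivation_ι_mul hD hx, map_add, map_zsmul, map_neg,
      secondOrder_ι_mul _ _ _ _ _ (hD i x hx), derivation_contract hD (hq.isHom hx), ih, hPx,
      LinearMap.add_apply, LinearMap.smul_apply, LinearMap.neg_apply, mul_add, smul_add, sgn_add,
      mul_smul_comm, smul_smul, smul_sub, mul_one, one_mul, add_mul]
    rw [show sgn q * (sgn (q * i) * sgn q) = sgn (q * i) by
      rw [mul_left_comm, sgn_mul_self, mul_one],
      show sgn q * (sgn i * sgn (q * i)) = sgn (q * i) * (sgn i * sgn q) by ring,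
      show sgn i * sgn q = sgn q * sgn i by ring, show sgn (q * i) * sgn i = sgn i * sgn (q * i) by ring]
    abel

end Derivation

/-- If `Q` pairs to zero with a set of elements of `V`, then the operator of `Q` and its
contractions are linear over the subalgebra that they generate. -/
def radical (𝒱 : ZMod 2 → Submodule K V) (Q : V →ₗ[K] V →ₗ[K] K) : Subalgebra K (SuperSym 𝒱) :=
  Algebra.adjoin K {s | ∃ i, ∃ x ∈ 𝒱 i, s = ι 𝒱 x ∧ Q x = 0 ∧ ∀ y, Q y x = 0}

theorem contract_mul_radical {q : ZMod 2} {Q : V →ₗ[K] V →ₗ[K] K} (hq : HasParity 𝒱 q Q)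
    {i : ZMod 2} {x : V} (hx : x ∈ 𝒱 i) {t : SuperSym 𝒱} (ht : t ∈ radical 𝒱 Q)
    (s : SuperSym 𝒱) : contract 𝒱 (Q x) (s * t) = contract 𝒱 (Q x) s * t := by
  have h0 : contract 𝒱 (Q x) t = 0 := by
    induction ht using Algebra.adjoin_induction with
    | mem t h =>
      obtain ⟨j, y, hy, rfl, -, h⟩ := h
      rw [← mul_one (ι 𝒱 y), isHom_contract_ι_mul (hq.isHom hx) hy, h, contract_one]
      simp
    | algebraMap r => rw [Algebra.algebraMap_eq_smul_one, map_smul, contract_one, smul_zero]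
    | add a b _ _ ha hb => rw [map_add, ha, hb, add_zero]
    | mul a b _ _ ha hb => rw [contract_mul (hq.isHom hx), ha, hb, zero_mul, mul_zero, add_zero]
  rw [contract_mul (hq.isHom hx), h0, mul_zero, add_zero]

/-- Factors invisible to `Q` behave as constants, up to the sign of moving an operator of parity `q`
past them. This will isolate the slots that an edge touches from all the others. -/
theorem secondOrder_radical_mul {q : ZMod 2} {Q : V →ₗ[K] V →ₗ[K] K} (hq : HasParity 𝒱 q Q)
    (hs : IsGradedSymm 𝒱 Q) {t : SuperSym 𝒱} (ht : t ∈ radical 𝒱 Q) (s : SuperSym 𝒱) :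
    secondOrder 𝒱 q Q hq hs (t * s) = twist 𝒱 q t * secondOrder 𝒱 q Q hq hs s := by
  induction ht using Algebra.adjoin_induction generalizing s with
  | mem t h =>
    obtain ⟨j, y, hy, rfl, h, -⟩ := h
    rw [secondOrder_ι_mul _ _ _ _ _ hy, h, twist_ι_of_mem q hy, smul_mul_assoc]
    simp
  | algebraMap r => simp only [← Algebra.smul_def, map_smul, AlgHom.commutes]
  | add a b _ _ ha hb => simp only [add_mul, map_add, ha, hb]
  | mul a b _ _ ha hb => rw [mul_assoc, ha, hb, map_mul, mul_assoc]

theorem secondOrder_mul_radical {q : ZMod 2} {Q : V →ₗ[K] V →ₗ[K] K} (hq : HasParity 𝒱 q Q)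
    (hs : IsGradedSymm 𝒱 Q) {t : SuperSym 𝒱} (ht : t ∈ radical 𝒱 Q) (s : SuperSym 𝒱) :
    secondOrder 𝒱 q Q hq hs (s * t) = secondOrder 𝒱 q Q hq hs s * t := by
  induction s using left_induction 𝒱 with
  | one =>
    rw [one_mul, ← mul_one t, secondOrder_radical_mul hq hs ht, secondOrder_one]
    simp
  | add s u hs hu => simp only [add_mul, map_add, hs, hu]
  | smul r s hs => simp only [smul_mul_assoc, map_smul, hs]
  | ι_mul i x hx s ih =>
    rw [mul_assoc, secondOrder_ι_mul _ _ _ _ _ hx, secondOrder_ι_mul _ _ _ _ _ hx, ih,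
      contract_mul_radical hq hx ht, add_mul, smul_mul_assoc, mul_assoc]

/-! ### Functoriality -/

section Map

variable {V' : Type*} [AddCommGroup V'] [Module K V']
  {𝒱' : ZMod 2 → Submodule K V'} [DirectSum.Decomposition 𝒱']
  {f : V →ₗ[K] V'} (hf : ∀ i x, x ∈ 𝒱 i → f x ∈ 𝒱' i)

/-- The homomorphism `Sym V → Sym V'` induced by an even linear map `V → V'`. -/
def map : SuperSym 𝒱 →ₐ[K] SuperSym 𝒱' :=
  lift 𝒱 (ι 𝒱' ∘ₗ f) fun i j x y hx hy => ι_mul_ι (hf i x hx) (hf j y hy)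

theorem map_ι (x : V) : map hf (ι 𝒱 x) = ι 𝒱' (f x) := by
  rw [map, lift_ι, LinearMap.comp_apply]

theorem map_twist (p : ZMod 2) (s : SuperSym 𝒱) :
    map hf (twist 𝒱 p s) = twist 𝒱' p (map hf s) := by
  refine AlgHom.congr_fun (φ₁ := (map hf).comp (twist 𝒱 p)) (φ₂ := (twist 𝒱' p).comp (map hf))
    (algHom_ext fun i x hx => ?_) s
  rw [AlgHom.comp_apply, AlgHom.comp_apply, map_ι, twist_ι_of_mem p hx, map_zsmul,
    twist_ι_of_mem p (hf i x hx), map_ι]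

theorem map_derivation {D : V →ₗ[K] V} (hD : ∀ (i : ZMod 2) (x : V), x ∈ 𝒱 i → D x ∈ 𝒱 (i + 1))
    {D' : V' →ₗ[K] V'} (hD' : ∀ (i : ZMod 2) (x : V'), x ∈ 𝒱' i → D' x ∈ 𝒱' (i + 1))
    (h : ∀ x, f (D x) = D' (f x)) (s : SuperSym 𝒱) :
    map hf (derivation 𝒱 1 D hD s) = derivation 𝒱' 1 D' hD' (map hf s) := by
  induction s using left_induction 𝒱 with
  | one => simp [derivation_one]
  | add s t hs ht => simp only [map_add, hs, ht]
  | smul r s hs => simp only [map_smul, hs]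
  | ι_mul i x hx s ih =>
    rw [derivation_ι_mul hD hx, map_mul, map_ι, derivation_ι_mul hD' (hf i x hx), map_add,
      map_zsmul, map_mul, map_mul, map_ι, map_ι, ih, h]

theorem map_contract {p : ZMod 2} {φ : V' →ₗ[K] K} (hφ : IsHom 𝒱' p φ) (s : SuperSym 𝒱) :
    contract 𝒱' φ (map hf s) = map hf (contract 𝒱 (φ ∘ₗ f) s) := by
  have hφf : IsHom 𝒱 p (φ ∘ₗ f) := fun i x hx hi => hφ i _ (hf i x hx) hi
  induction s using left_induction 𝒱 with
  | one => simp [contract_one]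
  | add s t hs ht => simp only [map_add, hs, ht]
  | smul r s hs => simp only [map_smul, hs]
  | ι_mul i x hx s ih =>
    rw [map_mul, map_ι, isHom_contract_ι_mul hφ (hf i x hx), isHom_contract_ι_mul hφf hx, ih,
      map_add, map_smul, map_zsmul, map_mul, map_ι, LinearMap.comp_apply]

/-- A form that pulls back to a sum of forms induces an operator that lifts to the sum of their
operators. -/
theorem secondOrder_map {q : ZMod 2} {Q' : V' →ₗ[K] V' →ₗ[K] K} (hq' : HasParity 𝒱' q Q')
    (hs' : IsGradedSymm 𝒱' Q') {E : Type*} (F : Finset E) {Q : E → V →ₗ[K] V →ₗ[K] K}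
    (hq : ∀ e, HasParity 𝒱 q (Q e)) (hs : ∀ e, IsGradedSymm 𝒱 (Q e))
    (h : ∀ x y, Q' (f x) (f y) = ∑ e ∈ F, Q e x y) (s : SuperSym 𝒱) :
    secondOrder 𝒱' q Q' hq' hs' (map hf s) =
      map hf (∑ e ∈ F, secondOrder 𝒱 q (Q e) (hq e) (hs e) s) := by
  induction s using left_induction 𝒱 with
  | one => simp [secondOrder_one]
  | add s t hs ht => simp only [map_add, hs, ht, Finset.sum_add_distrib]
  | smul r s hs => simp only [map_smul, hs, ← Finset.smul_sum]
  | ι_mul i x hx s ih =>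
    have hx' : Q' (f x) ∘ₗ f = ∑ e ∈ F, Q e x := by
      ext y
      simp [h]
    rw [map_mul, map_ι, secondOrder_ι_mul _ _ _ _ _ (hf i x hx), ih,
      map_contract hf (hq'.isHom (hf i x hx)), hx']
    simp only [secondOrder_ι_mul _ _ _ _ _ hx, Finset.sum_add_distrib, map_add, map_sum,
      LinearMap.sum_apply, ← Finset.smul_sum, ← Finset.mul_sum, map_zsmul, map_mul, map_ι]

end Map

end Operators

end SuperSym

/-! ## Divided powers of a sum of operators, weighted by the set of summands that occur -/

section EdgeOp

variable {K : Type*} [Field K] {M : Type*} [AddCommGroup M] [Module K M]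
  {E : Type*} [Fintype E]

/-- The part of `(∑ e, T e)^n / n!` in which every word `T e_1 ⋯ T e_n` is weighted by
`χ {e_1, …, e_n}`. -/
def edgeOp (T : E → Module.End K M) : ℕ → (Set E → K) → Module.End K M
  | 0, χ => χ ∅ • 1
  | n + 1, χ => ((n : K) + 1)⁻¹ • ∑ e, edgeOp T n (fun s => χ (insert e s)) * T e

variable {T : E → Module.End K M}

theorem edgeOp_zero_mul (χ : Set E → K) (Y : Module.End K M) :
    edgeOp T 0 χ * Y = Y * edgeOp T 0 χ := by
  simp [edgeOp]

/-- This is `[T^{n+1}/(n+1)!, Y] = (T^n/n!) [T, Y]`, valid since the commutators `Z e` commute with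
all the summands. The letter replaced by `Z e` still counts in the weight, hence the `insert`. -/
theorem edgeOp_succ_mul [CharZero K] {Y : Module.End K M} {Z : E → Module.End K M}
    (hY : ∀ e, T e * Y = Y * T e + Z e) (hZ : ∀ e f, Z f * T e = T e * Z f) (n : ℕ)
    (χ : Set E → K) : edgeOp T (n + 1) χ * Y = Y * edgeOp T (n + 1) χ +
      ∑ e, edgeOp T n (fun s => χ (insert e s)) * Z e := by
  induction n generalizing χ with
  | zero =>
    simp only [edgeOp, smul_mul_assoc, Finset.sum_mul, mul_smul_comm, hY,
      Finset.mul_sum, one_mul, Finset.sum_add_distrib, smul_add]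
    simp
  | succ n ih =>
    have h : ∀ e, edgeOp T (n + 1) (fun s => χ (insert e s)) * T e * Y =
        Y * (edgeOp T (n + 1) (fun s => χ (insert e s)) * T e) +
          ∑ f, edgeOp T n (fun s => χ (insert f (insert e s))) * T e * Z f +
          edgeOp T (n + 1) (fun s => χ (insert e s)) * Z e := by
      intro e
      rw [mul_assoc, hY, mul_add, ← mul_assoc, ih, add_mul, Finset.sum_mul, mul_assoc Y]
      simp only [mul_assoc, hZ, Set.insert_comm e]
    -- By the recursion, the words in which an earlier letter was replaced give `n + 1` times the
    -- expected sum. The last letter gives it once more, and the total `n + 2` cancels the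
    -- denominator. The weight sees only the set of letters, so their order is immaterial.
    have h2 : ∑ e, ∑ f, edgeOp T n (fun s => χ (insert f (insert e s))) * T e * Z f =
        ((n : K) + 1) • ∑ f, edgeOp T (n + 1) (fun s => χ (insert f s)) * Z f := by
      rw [Finset.sum_comm, Finset.smul_sum]
      refine Finset.sum_congr rfl fun f _ => ?_
      rw [edgeOp, smul_mul_assoc, smul_smul, mul_inv_cancel₀ (Nat.cast_add_one_ne_zero n),
        one_smul, Finset.sum_mul]
    rw [edgeOp, smul_mul_assoc, Finset.sum_mul, Finset.sum_congr rfl fun e _ => h e,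
      Finset.sum_add_distrib, Finset.sum_add_distrib, h2, ← Finset.mul_sum, add_assoc,
      show ∀ S : Module.End K M, ((n : K) + 1) • S + S = ((n : K) + 1 + 1) • S from
        fun S => by rw [add_smul ((n : K) + 1) 1 S, one_smul], smul_add, smul_smul, mul_smul_comm, Nat.cast_succ,
      inv_mul_cancel₀ (by
        have := Nat.cast_add_one_ne_zero (R := K) (n + 1)
        rwa [Nat.cast_succ] at this), one_smul]

/-- A word of `n` letters involves at most `n` different summands. -/
theorem edgeOp_eq_zero {χ : Set E → K} {n : ℕ} (h : ∀ s : Set E, s.ncard ≤ n → χ s = 0) :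
    edgeOp T n χ = 0 := by
  induction n generalizing χ with
  | zero => rw [edgeOp, h ∅ (by simp), zero_smul]
  | succ n ih =>
    rw [edgeOp, Finset.sum_eq_zero, smul_zero]
    intro e _
    rw [ih fun s hs => h _ ((Set.ncard_insert_le e s).trans (by lia)), zero_mul]

theorem edgeOp_const [CharZero K] (n : ℕ) :
    edgeOp T n (fun _ => 1) = ((n.factorial : K))⁻¹ • (∑ e, T e) ^ n := by
  induction n with
  | zero => simp [edgeOp]
  | succ n ih =>
    rw [edgeOp, ih, ← Finset.mul_sum, smul_mul_assoc, smul_smul, ← pow_succ, Nat.factorial_succ,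
      Nat.cast_mul, mul_inv, Nat.cast_succ]

/-- Naturality with respect to a map of the sets of summands. -/
theorem edgeOp_map {M' : Type*} [AddCommGroup M'] [Module K M'] {E' : Type*} [Fintype E']
    [DecidableEq E'] {T' : E' → Module.End K M'} (f : M →ₗ[K] M') (c : E → E')
    (h : ∀ e' x, T' e' (f x) = f (∑ e with c e = e', T e x)) (n : ℕ) (χ : Set E' → K) (x : M) :
    edgeOp T' n χ (f x) = f (edgeOp T n (fun s => χ (c '' s)) x) := by
  induction n generalizing χ x with
  | zero => simp [edgeOp]
  | succ n ih =>
    simp only [edgeOp, LinearMap.smul_apply, LinearMap.sum_apply, Module.End.mul_apply, h, ih,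
      map_smul, map_sum, Set.image_insert_eq]
    congr 1
    rw [← Finset.sum_fiberwise (s := Finset.univ) (g := c)]
    refine Finset.sum_congr rfl fun e' _ => Finset.sum_congr rfl fun e he => ?_
    rw [(Finset.mem_filter.1 he).2]

/-- Naturality for the identity map of the set of summands. -/
theorem edgeOp_comm {Z : Module.End K M} (h : ∀ e x, T e (Z x) = Z (T e x)) (n : ℕ)
    (χ : Set E → K) (x : M) : edgeOp T n χ (Z x) = Z (edgeOp T n χ x) := by
  classical
  refine (edgeOp_map (T := T) Z id (fun e x => ?_) n χ x).trans ?_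
  · rw [h]
    simp only [id]
    rw [Finset.filter_eq' Finset.univ e, if_pos (Finset.mem_univ e), Finset.sum_singleton]
  · simp

end EdgeOp

/-! ## Connected sets of edges -/

section Connectivity

variable {J J' : Type*}

/-- The graph with the set `s` of edges is connected. -/
def EdgesConnect (s : Set (J × J)) : Prop :=
  ∀ v w, Relation.EqvGen (fun v w => (v, w) ∈ s) v w

open Classical in
/-- The indicator function of the connected sets of edges. -/
def connWeight (K : Type*) [Field K] (J : Type*) (s : Set (J × J)) : K :=
  if EdgesConnect s then 1 else 0

theorem edgesConnect_congr {s t : Set (J × J)}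
    (hst : ∀ v w, (v, w) ∈ s → Relation.EqvGen (fun v w => (v, w) ∈ t) v w)
    (hs : EdgesConnect s) : EdgesConnect t := by
  intro v w
  have h := hs v w
  induction h with
  | rel v w h => exact hst v w h
  | refl v => exact .refl v
  | symm v w _ h => exact h.symm
  | trans u v w _ _ h1 h2 => exact h1.trans _ _ _ h2

theorem edgesConnect_insert_swap (v w : J) (s : Set (J × J)) :
    EdgesConnect (insert (v, w) s) ↔ EdgesConnect (insert (w, v) s) := by
  suffices h : ∀ v w, EdgesConnect (insert (v, w) s) → EdgesConnect (insert (w, v) s) from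
    ⟨h v w, h w v⟩
  refine fun v w => edgesConnect_congr fun a b hab => ?_
  obtain h | h := hab
  · cases h
    exact .symm _ _ (.rel _ _ (Or.inl rfl))
  · exact .rel _ _ (Or.inr h)

/-- A loop relates a vertex only to itself. This is why the loop terms of the bar equation keep the
same weight. -/
theorem edgesConnect_insert_diag (v : J) (s : Set (J × J)) :
    EdgesConnect (insert (v, v) s) ↔ EdgesConnect s := by
  refine ⟨edgesConnect_congr fun a b hab => ?_, edgesConnect_congr fun a b hab =>
    .rel _ _ (Or.inr hab)⟩
  obtain h | h := hab
  · cases h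
    exact .refl _
  · exact .rel _ _ h

/-- Contraction of an edge. -/
theorem edgesConnect_insert_iff {c : J → J'} (hc : Function.Surjective c) {i j : J}
    (hij : c i = c j) (h : ∀ a b, c a = c b → a = b ∨ (a = i ∧ b = j) ∨ (a = j ∧ b = i))
    (s : Set (J × J)) : EdgesConnect (insert (i, j) s) ↔ EdgesConnect (Prod.map c c '' s) := by
  constructor
  · intro hs v' w'
    obtain ⟨v, rfl⟩ := hc v'
    obtain ⟨w, rfl⟩ := hc w'
    have h1 := hs v w
    induction h1 with
    | rel v w h =>
      obtain h | h := h
      · cases h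
        rw [hij]
        exact .refl _
      · exact .rel _ _ ⟨_, h, rfl⟩
    | refl v => exact .refl _
    | symm v w _ h => exact h.symm
    | trans u v w _ _ h1 h2 => exact h1.trans _ _ _ h2
  · intro hs
    -- The only fibre with more than one point is `{i, j}`, and its points are joined by the
    -- inserted edge.
    have hfib : ∀ a b, c a = c b →
        Relation.EqvGen (fun v w => (v, w) ∈ insert (i, j) s) a b := by
      intro a b hab
      obtain rfl | ⟨rfl, rfl⟩ | ⟨rfl, rfl⟩ := h a b hab
      · exact .refl _
      · exact .rel _ _ (Or.inl rfl)
      · exact .symm _ _ (.rel _ _ (Or.inl rfl))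
    -- The induction runs over paths downstairs, for all lifts of the end points at once; the middle
    -- vertex in transitivity is lifted by surjectivity.
    suffices key : ∀ v' w', Relation.EqvGen (fun v w => (v, w) ∈ Prod.map c c '' s) v' w' →
        ∀ v w, c v = v' → c w = w' →
          Relation.EqvGen (fun v w => (v, w) ∈ insert (i, j) s) v w from
      fun v w => key _ _ (hs (c v) (c w)) v w rfl rfl
    intro v' w' h1
    induction h1 with
    | rel v' w' h =>
      obtain ⟨⟨a, b⟩, hab, he⟩ := h
      cases he
      intro v w hv hw
      exact (hfib v a hv).trans _ _ _ (.trans _ _ _ (.rel _ _ (Or.inr hab)) (hfib b w hw.symm))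
    | refl v' => exact fun v w hv hw => hfib v w (hv.trans hw.symm)
    | symm v' w' _ h => exact fun v w hv hw => (h w v hw hv).symm
    | trans u' v' w' _ _ h1 h2 =>
      intro u w hu hw
      obtain ⟨v, hv⟩ := hc v'
      exact (h1 u v hu hv).trans _ _ _ (h2 v w hv hw)

/-- The spanning tree bound. Loops and orientations are forgotten to pass to a simple graph, which
can only lower the number of edges. -/
theorem EdgesConnect.card_le [Finite J] {s : Set (J × J)} (hs : EdgesConnect s) :
    Nat.card J ≤ s.ncard + 1 := by
  classical
  -- A connected `SimpleGraph` has a vertex by definition, so the empty case is separate.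
  rcases isEmpty_or_nonempty J with hJ | hJ
  · simp
  let G : SimpleGraph J := SimpleGraph.fromRel fun v w => (v, w) ∈ s
  have hG : G.Connected := by
    refine ⟨fun v w => ?_⟩
    have h := hs v w
    induction h with
    | rel v w h =>
      by_cases hvw : v = w
      · rw [hvw]
      · exact SimpleGraph.Adj.reachable ((SimpleGraph.fromRel_adj _ _ _).2 ⟨hvw, Or.inl h⟩)
    | refl v => exact SimpleGraph.Reachable.refl _
    | symm v w _ h => exact h.symm
    | trans u v w _ _ h1 h2 => exact h1.trans h2
  refine hG.card_vert_le_card_edgeSet_add_one.trans (Nat.add_le_add_right ?_ 1)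
  have hsub : G.edgeSet ⊆ (fun p : J × J => s(p.1, p.2)) '' s := by
    intro e
    induction e using Sym2.ind with
    | _ v w =>
      intro he
      obtain ⟨-, h | h⟩ := (SimpleGraph.fromRel_adj _ _ _).1 (SimpleGraph.mem_edgeSet _ |>.1 he)
      · exact ⟨_, h, rfl⟩
      · exact ⟨_, h, Sym2.eq_swap⟩
  exact (Set.ncard_le_ncard hsub (Set.toFinite _)).trans (Set.ncard_image_le (Set.toFinite _))

variable {K : Type*} [Field K]

theorem connWeight_congr {s : Set (J × J)} {t : Set (J' × J')}
    (h : EdgesConnect s ↔ EdgesConnect t) : connWeight K J s = connWeight K J' t := by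
  classical
  exact if_congr h rfl rfl

theorem edgeOp_connWeight_eq_zero [Fintype J] {M : Type*} [AddCommGroup M] [Module K M]
    {T : J × J → Module.End K M} {n : ℕ} (h : n + 1 < Fintype.card J) :
    edgeOp T n (connWeight K J) = 0 := by
  refine edgeOp_eq_zero fun s hs => if_neg fun hc => ?_
  have := hc.card_le
  rw [Nat.card_eq_fintype_card] at this
  lia

end Connectivity

/-! ## Powers of a graded vector space -/

namespace SuperSym

section Slots

variable {K : Type*} [Field K] {V : Type*} [AddCommGroup V] [Module K V]

/-- The grading of `V^J`. -/
def piGrading (J : Type*) (𝒱 : ZMod 2 → Submodule K V) (i : ZMod 2) : Submodule K (J → V) where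
  carrier := {x | ∀ j, x j ∈ 𝒱 i}
  add_mem' h h' j := add_mem (h j) (h' j)
  zero_mem' _ := zero_mem (𝒱 i)
  smul_mem' c _ h j := (𝒱 i).smul_mem c (h j)

variable {J J' : Type*} {𝒱 : ZMod 2 → Submodule K V} [DirectSum.Decomposition 𝒱]

instance piDecomposition : DirectSum.Decomposition (piGrading J 𝒱) :=
  DirectSum.Decomposition.ofLinearMap (piGrading J 𝒱)
    (∑ i : ZMod 2, DirectSum.lof K (ZMod 2) (fun i => piGrading J 𝒱 i) i ∘ₗ
      (LinearMap.pi fun j => proj 𝒱 i ∘ₗ LinearMap.proj j).codRestrict (piGrading J 𝒱 i)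
        (fun _ _ => proj_mem _ _))
    (by
      refine LinearMap.ext fun x => funext fun j => ?_
      simp only [LinearMap.comp_apply, LinearMap.sum_apply, map_sum, DirectSum.coeLinearMap_lof,
        Finset.sum_apply, LinearMap.id_apply]
      exact sum_proj 𝒱 (x j))
    (by
      refine DirectSum.linearMap_ext K fun i => LinearMap.ext fun x => ?_
      simp only [LinearMap.comp_apply, DirectSum.coeLinearMap_lof, LinearMap.sum_apply,
        LinearMap.id_apply]
      rw [Finset.sum_eq_single i]
      · exact congrArg _ (Subtype.ext (funext fun j => proj_same (x.2 j)))
      · intro k _ hk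
        exact (congrArg _ (Subtype.ext (funext fun j => proj_ne (x.2 j) hk.symm))).trans
          (map_zero _)
      · simp)

/-- The form `(x, y) ↦ (Q(x_v, y_w) + Q(x_w, y_v)) / 2` on `V^J`, for `e = (v, w)`. -/
def slotForm (Q : V →ₗ[K] V →ₗ[K] K) (e : J × J) : (J → V) →ₗ[K] (J → V) →ₗ[K] K :=
  (2⁻¹ : K) • (Q.compl₁₂ (LinearMap.proj e.1) (LinearMap.proj e.2) +
    Q.compl₁₂ (LinearMap.proj e.2) (LinearMap.proj e.1))

theorem slotForm_apply (Q : V →ₗ[K] V →ₗ[K] K) (e : J × J) (x y : J → V) :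
    slotForm Q e x y = 2⁻¹ * (Q (x e.1) (y e.2) + Q (x e.2) (y e.1)) := by
  simp [slotForm, mul_add]

theorem slotForm_swap (Q : V →ₗ[K] V →ₗ[K] K) (v w : J) :
    slotForm Q (v, w) = slotForm Q (w, v) := by
  simp only [slotForm, add_comm]

variable {q : ZMod 2} {Q : V →ₗ[K] V →ₗ[K] K}

theorem slotForm_parity (hq : HasParity 𝒱 q Q) (e : J × J) :
    HasParity (piGrading J 𝒱) q (slotForm Q e) := by
  intro i j x y hx hy h
  rw [slotForm_apply, hq i j _ _ (hx _) (hy _) h, hq i j _ _ (hx _) (hy _) h, add_zero, mul_zero]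

theorem slotForm_symm (hs : IsGradedSymm 𝒱 Q) (e : J × J) :
    IsGradedSymm (piGrading J 𝒱) (slotForm Q e) := by
  intro i j x y hx hy
  rw [slotForm_apply, slotForm_apply, hs i j _ _ (hx _) (hy e.2), hs i j _ _ (hx _) (hy e.1),
    ← smul_add, mul_smul_comm, add_comm]

/-- The operator on `Sym(V^J)` that applies `Q` to one factor in the slot `v` and one factor in the
slot `w`, halved unless `v = w`, for `e = (v, w)`. -/
def slotOp (hq : HasParity 𝒱 q Q) (hs : IsGradedSymm 𝒱 Q) (e : J × J) :
    Module.End K (SuperSym (piGrading J 𝒱)) :=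
  secondOrder (piGrading J 𝒱) q (slotForm Q e) (slotForm_parity hq e) (slotForm_symm hs e)

theorem slotOp_swap (hq : HasParity 𝒱 q Q) (hs : IsGradedSymm 𝒱 Q) (v w : J) :
    slotOp hq hs (v, w) = slotOp hq hs (w, v) := by
  unfold slotOp
  simp only [slotForm_swap Q v w]

theorem map_map {V₁ V₂ V₃ : Type*} [AddCommGroup V₁] [Module K V₁] [AddCommGroup V₂] [Module K V₂]
    [AddCommGroup V₃] [Module K V₃] {𝒱₁ : ZMod 2 → Submodule K V₁}
    {𝒱₂ : ZMod 2 → Submodule K V₂} {𝒱₃ : ZMod 2 → Submodule K V₃} [DirectSum.Decomposition 𝒱₁]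
    [DirectSum.Decomposition 𝒱₂] [DirectSum.Decomposition 𝒱₃]
    {f : V₁ →ₗ[K] V₂} {g : V₂ →ₗ[K] V₃} {k : V₁ →ₗ[K] V₃}
    (hf : ∀ i x, x ∈ 𝒱₁ i → f x ∈ 𝒱₂ i) (hg : ∀ i x, x ∈ 𝒱₂ i → g x ∈ 𝒱₃ i)
    (hk : ∀ i x, x ∈ 𝒱₁ i → k x ∈ 𝒱₃ i) (h : ∀ x, g (f x) = k x) (s : SuperSym 𝒱₁) :
    map hg (map hf s) = map hk s := by
  refine AlgHom.congr_fun (φ₁ := (map hg).comp (map hf)) (algHom_ext fun i x _ => ?_) s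
  rw [AlgHom.comp_apply, map_ι, map_ι, map_ι, h]

theorem single_mem_piGrading [DecidableEq J] (v : J) (i : ZMod 2) (x : V) (hx : x ∈ 𝒱 i) :
    LinearMap.single K (fun _ => V) v x ∈ piGrading J 𝒱 i := fun j => by
  by_cases h : j = v
  · subst h; simpa using hx
  · simp [h]

variable (𝒱) in
/-- The inclusion of the slot `v`. -/
def slotHom [DecidableEq J] (v : J) :
    SuperSym 𝒱 →ₐ[K] SuperSym (piGrading J 𝒱) :=
  map (single_mem_piGrading v)

theorem slotHom_twist [DecidableEq J] (v : J) (p : ZMod 2) (s : SuperSym 𝒱) :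
    slotHom 𝒱 v (twist 𝒱 p s) = twist (piGrading J 𝒱) p (slotHom 𝒱 v s) := map_twist _ p s

theorem slotHom_ι [DecidableEq J] (v : J) (x : V) :
    slotHom 𝒱 v (ι 𝒱 x) = ι (piGrading J 𝒱) (Pi.single v x) := map_ι _ x

variable (𝒱) in
/-- The sum of all the slots. -/
def sumHom [Fintype J] :
    SuperSym (piGrading J 𝒱) →ₐ[K] SuperSym 𝒱 :=
  map (f := ∑ j : J, LinearMap.proj j) fun i x hx => by
    simp only [LinearMap.sum_apply, LinearMap.proj_apply]
    exact sum_mem fun j _ => hx j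

theorem sumHom_slotHom [Fintype J] [DecidableEq J] (v : J) (s : SuperSym 𝒱) :
    sumHom 𝒱 (slotHom 𝒱 v s) = s := by
  refine AlgHom.congr_fun (φ₁ := (sumHom 𝒱).comp (slotHom 𝒱 v)) (φ₂ := AlgHom.id K _)
    (algHom_ext fun i x _ => ?_) s
  rw [AlgHom.comp_apply, slotHom_ι, sumHom, map_ι]
  simp [Pi.single_apply]

/-- The linear map `V^J → V^J'` that adds up the slots along a map `J → J'`. -/
def pushLin (V : Type*) [AddCommGroup V] [Module K V] [Fintype J] [DecidableEq J']
    (c : J → J') : (J → V) →ₗ[K] (J' → V) :=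
  LinearMap.pi fun j' => ∑ j with c j = j', LinearMap.proj j

theorem pushLin_apply [Fintype J] [DecidableEq J'] (c : J → J') (x : J → V) (j' : J') :
    pushLin (K := K) V c x j' = ∑ j with c j = j', x j := by
  simp [pushLin]

theorem pushLin_single [Fintype J] [DecidableEq J] [DecidableEq J'] (c : J → J') (v : J) (x : V) :
    pushLin (K := K) V c (Pi.single v x) = Pi.single (c v) x := by
  ext j'
  rw [pushLin_apply, Finset.sum_filter]
  simp only [Pi.single_apply]
  rw [Finset.sum_eq_single v]
  · simp only [if_true, eq_comm]
  · intro j _ hj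
    simp [hj]
  · simp

variable (𝒱) in
/-- The homomorphism `Sym(V^J) → Sym(V^J')` that adds up the slots along a map `J → J'`. -/
def pushHom [Fintype J] [DecidableEq J'] (c : J → J') :
    SuperSym (piGrading J 𝒱) →ₐ[K] SuperSym (piGrading J' 𝒱) :=
  map (f := pushLin V c) fun i x hx j' => by
    rw [pushLin_apply]
    exact sum_mem fun j _ => hx j

theorem pushHom_slotHom [Fintype J] [DecidableEq J] [DecidableEq J'] (c : J → J') (v : J)
    (s : SuperSym 𝒱) : pushHom 𝒱 c (slotHom 𝒱 v s) = slotHom 𝒱 (c v) s :=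
  map_map _ _ _ (fun x => pushLin_single c v x) s

theorem sumHom_pushHom [Fintype J] [Fintype J'] [DecidableEq J'] (c : J → J')
    (s : SuperSym (piGrading J 𝒱)) : sumHom 𝒱 (pushHom 𝒱 c s) = sumHom 𝒱 s :=
  map_map _ _ _ (fun x => by
    simp only [LinearMap.sum_apply, LinearMap.proj_apply, pushLin_apply]
    exact Finset.sum_fiberwise _ _ _) s

/-- Bilinearity expands over the two fibres of `c`, and their product is the fibre of `Prod.map c
c`. -/
theorem slotForm_pushLin [Fintype J] [DecidableEq J'] (c : J → J') (e' : J' × J') (x y : J → V) :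
    slotForm Q e' (pushLin (K := K) V c x) (pushLin (K := K) V c y) =
      ∑ e with Prod.map c c e = e', slotForm Q e x y := by
  classical
  have h : (Finset.univ.filter fun e : J × J => Prod.map c c e = e') =
      (Finset.univ.filter fun j => c j = e'.1) ×ˢ (Finset.univ.filter fun j => c j = e'.2) := by
    ext e
    simp [Prod.ext_iff]
  rw [h, Finset.sum_product]
  simp only [slotForm_apply, pushLin_apply, map_sum, LinearMap.sum_apply, ← Finset.mul_sum,
    Finset.sum_add_distrib]
  rw [Finset.sum_comm (f := fun a b => Q (x b) (y a))]

theorem slotOp_pushHom [Fintype J] [DecidableEq J'] (hq : HasParity 𝒱 q Q)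
    (hs : IsGradedSymm 𝒱 Q) (c : J → J') (e' : J' × J') (s : SuperSym (piGrading J 𝒱)) :
    slotOp hq hs e' (pushHom 𝒱 c s) =
      pushHom 𝒱 c (∑ e with Prod.map c c e = e', slotOp hq hs e s) :=
  secondOrder_map _ _ _ _ _ _ (slotForm_pushLin c e') s

/-- Every unordered pair of different slots occurs twice among the ordered pairs, which the factor
`1/2` in `slotForm` compensates. -/
theorem secondOrder_sumHom [CharZero K] [Fintype J] (hq : HasParity 𝒱 q Q)
    (hs : IsGradedSymm 𝒱 Q) (s : SuperSym (piGrading J 𝒱)) :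
    secondOrder 𝒱 q Q hq hs (sumHom 𝒱 s) = sumHom 𝒱 (∑ e, slotOp hq hs e s) := by
  refine secondOrder_map _ _ _ _ _ _ (fun x y => ?_) s
  simp only [LinearMap.sum_apply, LinearMap.proj_apply, map_sum, slotForm_apply,
    Fintype.sum_prod_type, ← Finset.mul_sum, Finset.sum_add_distrib]
  rw [Finset.sum_comm (f := fun a b => Q (x b) (y a)), ← two_mul, ← mul_assoc,
    inv_mul_cancel₀ two_ne_zero, one_mul, Finset.sum_comm]

theorem slotOp_slotHom [CharZero K] [DecidableEq J] (hq : HasParity 𝒱 q Q)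
    (hs : IsGradedSymm 𝒱 Q) (v : J) (s : SuperSym 𝒱) :
    slotOp hq hs (v, v) (slotHom 𝒱 v s) = slotHom 𝒱 v (secondOrder 𝒱 q Q hq hs s) := by
  have := secondOrder_map (single_mem_piGrading (𝒱 := 𝒱) v) (slotForm_parity hq (v, v)) (slotForm_symm hs (v, v)) {()}
    (Q := fun _ => Q) (fun _ => hq) (fun _ => hs) (fun x y => by
      simp [slotForm_apply, ← two_mul]) s
  rwa [Finset.sum_singleton] at this

theorem slotHom_mem_radical [DecidableEq J] {v w u : J} (hv : u ≠ v) (hw : u ≠ w)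
    (s : SuperSym 𝒱) : slotHom 𝒱 u s ∈ radical (piGrading J 𝒱) (slotForm Q (v, w)) := by
  induction s using left_induction 𝒱 with
  | one => rw [map_one]; exact one_mem _
  | add s t hs ht => rw [map_add]; exact add_mem hs ht
  | smul r s hs => rw [map_smul]; exact Subalgebra.smul_mem _ hs r
  | ι_mul i x hx s hs =>
    rw [map_mul, slotHom_ι]
    refine mul_mem (Algebra.subset_adjoin ⟨i, _, single_mem_piGrading u i x hx, rfl, ?_,
      fun y => ?_⟩) hs
    · ext y
      simp [slotForm_apply, hv.symm, hw.symm]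
    · simp [slotForm_apply, hv.symm, hw.symm]

/-- Contracting two slots and merging them computes the bracket. -/
theorem pushHom_slotOp_bracket [CharZero K] [Fintype J] [DecidableEq J] [DecidableEq J']
    (hq : HasParity 𝒱 q Q) (hs : IsGradedSymm 𝒱 Q) {c : J → J'} {i j : J} (hij : i ≠ j) {w : J'}
    (hc : ∀ k, c k = w ↔ k = i ∨ k = j) (s t : SuperSym 𝒱) :
    pushHom 𝒱 c (slotOp hq hs (i, j) (slotHom 𝒱 i s * slotHom 𝒱 j t) +
        slotOp hq hs (j, i) (slotHom 𝒱 i s * slotHom 𝒱 j t)) =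
      slotHom 𝒱 w (secondOrder 𝒱 q Q hq hs (s * t) - secondOrder 𝒱 q Q hq hs s * t -
        twist 𝒱 q s * secondOrder 𝒱 q Q hq hs t) := by
  have hci : c i = w := (hc i).2 (Or.inl rfl)
  have hcj : c j = w := (hc j).2 (Or.inr rfl)
  -- The form on the merged slot `w` pulls back to four pairs of slots. The diagonal ones give `Δ(s)
  -- t` and `± s Δ(t)`, which the bracket subtracts; the two mixed ones remain.
  have hF : (Finset.univ.filter fun e : J × J => Prod.map c c e = (w, w)) =
      {(i, i), (i, j), (j, i), (j, j)} := by
    ext ⟨a, b⟩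
    simp only [Finset.mem_filter, Finset.mem_univ, true_and, Prod.map_apply, Prod.mk.injEq, hc,
      Finset.mem_insert, Finset.mem_singleton]
    tauto
  have h1 := slotOp_pushHom hq hs c (w, w) (slotHom 𝒱 i s * slotHom 𝒱 j t)
  have hii : slotOp hq hs (i, i) (slotHom 𝒱 i s * slotHom 𝒱 j t) =
      slotHom 𝒱 i (secondOrder 𝒱 q Q hq hs s) * slotHom 𝒱 j t := by
    rw [← slotOp_slotHom]
    exact secondOrder_mul_radical _ _ (slotHom_mem_radical hij.symm hij.symm t) _
  have hjj : slotOp hq hs (j, j) (slotHom 𝒱 i s * slotHom 𝒱 j t) =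
      slotHom 𝒱 i (twist 𝒱 q s) * slotHom 𝒱 j (secondOrder 𝒱 q Q hq hs t) := by
    rw [← slotOp_slotHom, slotHom_twist]
    exact secondOrder_radical_mul _ _ (slotHom_mem_radical hij hij s) _
  rw [map_mul, pushHom_slotHom, pushHom_slotHom, hci, hcj, ← map_mul, slotOp_slotHom, hF,
    Finset.sum_insert (by simp [hij]), Finset.sum_insert (by simp [hij]),
    Finset.sum_insert (by simp [hij]), Finset.sum_singleton, hii, hjj] at h1
  simp only [map_add, map_mul, pushHom_slotHom, hci, hcj] at h1
  simp only [map_sub, h1, map_add, map_mul]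
  abel

end Slots

end SuperSym

/-! ## The homotopy operator trivializes the BV operator -/

namespace ChainSplitting

variable {K L : Type*} [Field K] [AddCommGroup L] [Module K L]
  {𝓛 : ZMod 2 → Submodule K L} {X : CircleComplex 𝓛} (S : ChainSplitting X)

theorem coeff_zero : S.coeff 0 = 1 := LinearMap.ext S.apply_zero

theorem coeff_zero_b (x : L) : S.coeff 0 (X.b x) = X.b (S.coeff 0 x) := by
  rw [coeff_zero]; rfl

theorem coeff_succ_b (n : ℕ) (x : L) :
    S.coeff (n + 1) (X.b x) = X.b (S.coeff (n + 1) x) + X.B (S.coeff n x) := by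
  have h := congrFun (S.map_diff x) (n + 1)
  exact h.trans (by simp [CircleComplex.plusDiff]; rfl)

/-- The generating series of the splitting. -/
def series : PowerSeries (Module.End K L) := PowerSeries.mk S.coeff

/-- The generating series of the inverse of the splitting. -/
def invSeries : PowerSeries (Module.End K L) := PowerSeries.mk S.invCoeff

theorem invSeries_mul_series : S.invSeries * S.series = 1 := by
  ext1 n
  rw [PowerSeries.coeff_mul, PowerSeries.coeff_one]
  simp only [invSeries, series, PowerSeries.coeff_mk]
  rw [Finset.Nat.sum_antidiagonal_eq_sum_range_succ (fun i j => S.invCoeff i * S.coeff j)]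
  cases n with
  | zero => simp [coeff_zero, invCoeff]; rfl
  | succ n =>
    rw [Finset.sum_range_succ, Nat.sub_self, coeff_zero, mul_one, invCoeff, if_neg (by lia),
      ← Fin.sum_univ_eq_sum_range (fun k => S.invCoeff k * S.coeff (n + 1 - k)) (n + 1)]
    exact add_neg_cancel _

/-- The recursion for `R` only makes it a left inverse of `S`, in a noncommutative ring of series.
As `R` has constant term `1`, it has a left inverse too, which must equal its right inverse `S`. -/
theorem series_mul_invSeries : S.series * S.invSeries = 1 := by
  have h : PowerSeries.constantCoeff S.invSeries = ((1 : (Module.End K L)ˣ) : Module.End K L) := by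
    rw [← PowerSeries.coeff_zero_eq_constantCoeff_apply, invSeries, PowerSeries.coeff_mk, invCoeff]
    rfl
  have h1 := PowerSeries.invOfUnit_mul S.invSeries 1 h
  rwa [left_inv_eq_right_inv h1 S.invSeries_mul_series] at h1

/-- The chain map condition as the identity `S b = (b + uB) S` of series of endomorphisms.
Multiplying by `R` on both sides gives the rule for `b R`. -/
theorem series_mul_b :
    S.series * PowerSeries.C X.b = (PowerSeries.C X.b + PowerSeries.C X.B * .X) * S.series := by
  ext1 n
  rw [add_mul, mul_assoc, map_add, PowerSeries.coeff_mul_C, PowerSeries.coeff_C_mul,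
    PowerSeries.coeff_C_mul]
  cases n with
  | zero =>
    simp only [series, PowerSeries.coeff_mk, PowerSeries.coeff_zero_X_mul, mul_zero, add_zero]
    exact LinearMap.ext S.coeff_zero_b
  | succ n =>
    simp only [series, PowerSeries.coeff_mk, PowerSeries.coeff_succ_X_mul]
    exact LinearMap.ext (S.coeff_succ_b n)

theorem b_mul_invSeries :
    PowerSeries.C X.b * S.invSeries = S.invSeries * (PowerSeries.C X.b + PowerSeries.C X.B * .X) :=
  calc PowerSeries.C X.b * S.invSeries
      = S.invSeries * (S.series * PowerSeries.C X.b) * S.invSeries := by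
        rw [← mul_assoc S.invSeries, invSeries_mul_series, one_mul]
    _ = S.invSeries * (PowerSeries.C X.b + PowerSeries.C X.B * .X) := by
        rw [series_mul_b, mul_assoc, mul_assoc, series_mul_invSeries, mul_one]

theorem b_invCoeff_succ (n : ℕ) (x : L) :
    S.invCoeff (n + 1) (X.b x) = X.b (S.invCoeff (n + 1) x) - S.invCoeff n (X.B x) := by
  have h := congrArg (PowerSeries.coeff (n + 1)) S.b_mul_invSeries
  rw [mul_add, ← mul_assoc, map_add, PowerSeries.coeff_mul_C, PowerSeries.coeff_C_mul,
    PowerSeries.coeff_succ_mul_X, PowerSeries.coeff_mul_C] at h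
  simp only [invSeries, PowerSeries.coeff_mk] at h
  exact eq_sub_of_add_eq (LinearMap.congr_fun h x).symm

/-- The operator `∑_{l < j} S_l R_{n - l}`. -/
def partialSum (n j : ℕ) : Module.End K L := ∑ l ∈ Finset.range j, S.coeff l * S.invCoeff (n - l)

/-- The full sum is a coefficient of `S R = 1`. Its one nonzero value, at `n = 0`, is the source of
`Ω`. -/
theorem partialSum_self (n : ℕ) (x : L) :
    S.partialSum n (n + 1) x = if n = 0 then x else 0 := by
  have h := congrArg (PowerSeries.coeff n) S.series_mul_invSeries
  rw [PowerSeries.coeff_mul, PowerSeries.coeff_one] at h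
  simp only [invSeries, series, PowerSeries.coeff_mk] at h
  rw [Finset.Nat.sum_antidiagonal_eq_sum_range_succ (fun i j => S.coeff i * S.invCoeff j)] at h
  rw [partialSum, h]
  split_ifs <;> rfl

/-- Moving `b` through `R_{n+1-l}` costs `-R_{n-l} B`, and through `S_l` it costs `B S_{l-1}`. The
former costs add up to the last term. The latter give one summand less, because `S_0 = id` commutes
with `b`. -/
theorem partialSum_b (n j : ℕ) (hj : j ≤ n) (x : L) :
    S.partialSum (n + 1) (j + 1) (X.b x) = X.b (S.partialSum (n + 1) (j + 1) x) +
      X.B (S.partialSum n j x) - S.partialSum n (j + 1) (X.B x) := by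
  induction j with
  | zero =>
    simp only [partialSum, Finset.sum_range_succ, Finset.sum_range_zero, zero_add,
      Module.End.mul_apply, Nat.sub_zero, b_invCoeff_succ, map_sub, coeff_zero_b,
      LinearMap.zero_apply, map_zero, add_zero]
  | succ j ih =>
    have h1 : ∀ m k, S.partialSum m (k + 1) = S.partialSum m k + S.coeff k * S.invCoeff (m - k) :=
      fun m k => Finset.sum_range_succ _ _
    obtain ⟨m, rfl⟩ := Nat.exists_eq_add_of_le hj
    have e1 : j + 1 + m + 1 - (j + 1) = m + 1 := by lia
    have e2 : j + 1 + m - (j + 1) = m := by lia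
    have e3 : j + 1 + m - j = m + 1 := by lia
    rw [h1 (j + 1 + m + 1) (j + 1), h1 (j + 1 + m) (j + 1), e1, e2]
    simp only [LinearMap.add_apply, Module.End.mul_apply, ih (by lia), b_invCoeff_succ, map_sub,
      coeff_succ_b, map_add]
    rw [h1 (j + 1 + m) j, e3]
    simp only [LinearMap.add_apply, Module.End.mul_apply, map_add]
    abel

theorem homotopy_single_eq (i j : ℕ) (x y : L) :
    S.homotopy (Finsupp.single i x) (Finsupp.single j y) =
      (-1) ^ j * X.pairing (S.partialSum (i + j + 1) (j + 1) x) y := by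
  rw [homotopy_single, map_smul, LinearMap.smul_apply, smul_eq_mul, partialSum,
    LinearMap.sum_apply]
  rfl

theorem partialSum_even (n j : ℕ) (i : ZMod 2) (x : L) (hx : x ∈ 𝓛 i) :
    S.partialSum n j x ∈ 𝓛 i := by
  rw [partialSum, LinearMap.sum_apply]
  exact sum_mem fun l _ => S.even i _ (S.invCoeff_even _ i _ hx) l

/-- By adjointness of `b` and `B`, both differentials act on truncations of `S R`, where
`partialSum_b` cancels everything except the effect of cutting `L_-` off at `u^0`. -/
theorem homotopy_diff_single (p : ZMod 2) (i j : ℕ) (x y : L) (hx : x ∈ 𝓛 p) :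
    S.homotopy (X.minusDiff (Finsupp.single i x)) (Finsupp.single j y) +
      sgn p • S.homotopy (Finsupp.single i x) (X.minusDiff (Finsupp.single j y)) =
        -X.Omega (Finsupp.single i x) (Finsupp.single j y) := by
  have hb := X.pairing_b p (S.partialSum (i + j + 1) (j + 1) x) y (S.partialSum_even _ _ p x hx)
  have hB := X.pairing_B p (S.partialSum (i + j) j x) y (S.partialSum_even _ _ p x hx)
  -- For `i = 0` the `B`-term is cut off. The formula still includes it, as a full sum; by
  -- `partialSum_self` that is nonzero only for `j = 0`, and there it equals the subtracted `Ω`.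
  have h1 : S.homotopy (X.minusDiff (Finsupp.single i x)) (Finsupp.single j y) =
      (-1) ^ j * (X.pairing (S.partialSum (i + j + 1) (j + 1) (X.b x)) y +
        X.pairing (S.partialSum (i + j) (j + 1) (X.B x)) y) -
        X.Omega (Finsupp.single i x) (Finsupp.single j y) := by
    cases i with
    | zero =>
      simp only [CircleComplex.minusDiff, Finsupp.lsum_single, LinearMap.comp_apply,
        Finsupp.lsingle_apply, homotopy_single_eq, zero_add, partialSum_self,
        CircleComplex.Omega, LinearMap.compl₁₂_apply, Finsupp.lapply_apply,
        Finsupp.single_eq_same]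
      cases j with
      | zero => simp
      | succ j => simp
    | succ i =>
      simp only [CircleComplex.minusDiff, Finsupp.lsum_single, LinearMap.comp_apply,
        LinearMap.add_apply, map_add, Finsupp.lsingle_apply, homotopy_single_eq,
        CircleComplex.Omega, LinearMap.compl₁₂_apply, Finsupp.lapply_apply]
      rw [show i + 1 + j = i + j + 1 by lia]
      simp [mul_add]
  -- For `j = 0` the cut-off of `B y` agrees with the empty `partialSum (i + 0) 0`.
  have h2 : S.homotopy (Finsupp.single i x) (X.minusDiff (Finsupp.single j y)) =
      (-1) ^ j * (X.pairing (S.partialSum (i + j + 1) (j + 1) x) (X.b y) -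
        X.pairing (S.partialSum (i + j) j x) (X.B y)) := by
    cases j with
    | zero =>
      simp only [CircleComplex.minusDiff, Finsupp.lsum_single, LinearMap.comp_apply,
        Finsupp.lsingle_apply, homotopy_single_eq]
      simp [partialSum]
    | succ j =>
      simp only [CircleComplex.minusDiff, Finsupp.lsum_single, LinearMap.comp_apply,
        LinearMap.add_apply, map_add, Finsupp.lsingle_apply, homotopy_single_eq]
      rw [show i + (j + 1) = i + j + 1 by lia]
      ring
  rw [h1, h2, S.partialSum_b (i + j) j (by lia)]
  simp only [map_add, map_sub, LinearMap.add_apply, LinearMap.sub_apply, zsmul_eq_mul] at hb hB ⊢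
  linear_combination (-1) ^ j * (hb + hB)

theorem homotopy_diff (p : ZMod 2) (α β : ℕ →₀ L) (hα : α ∈ minusGrading 𝓛 p) :
    S.homotopy (X.minusDiff α) β + sgn p • S.homotopy α (X.minusDiff β) = -X.Omega α β := by
  induction β using Finsupp.induction_linear with
  | zero => simp
  | add β γ hβ hγ =>
    simp only [map_add, smul_add, neg_add, ← hβ, ← hγ]
    abel
  | single j y =>
    rw [← Finsupp.sum_single α]
    simp only [Finsupp.sum, map_sum, LinearMap.sum_apply, Finset.smul_sum,
      ← Finset.sum_add_distrib, ← Finset.sum_neg_distrib]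
    exact Finset.sum_congr rfl fun i _ => S.homotopy_diff_single p i j _ y (hα i)

variable [DirectSum.Decomposition 𝓛]

/-- The flipped form satisfies the same equation because `Ω` is graded symmetric; averaging keeps
it. -/
theorem homotopySym_diff [CharZero K] (p : ZMod 2) (α β : ℕ →₀ L) (hα : α ∈ minusGrading 𝓛 p) :
    S.homotopySym (X.minusDiff α) β + sgn p • S.homotopySym α (X.minusDiff β) =
      -X.Omega α β := by
  rw [← SuperSym.sum_proj (minusGrading 𝓛) β, sum_zmod_two]
  simp only [map_add, smul_add, neg_add]
  suffices h : ∀ q β, β ∈ minusGrading 𝓛 q → S.homotopySym (X.minusDiff α) β +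
      sgn p • S.homotopySym α (X.minusDiff β) = -X.Omega α β by
    rw [← h _ _ (SuperSym.proj_mem 0 β), ← h _ _ (SuperSym.proj_mem 1 β)]
    abel
  intro q β hβ
  have h1 := S.homotopy_diff p α β hα
  have h2 := S.homotopy_diff q β α hβ
  have h3 := X.Omega_symm p q α β hα hβ
  simp only [homotopySym, LinearMap.smul_apply, LinearMap.add_apply, smul_eq_mul,
    SuperSym.gradedFlip_apply _ _ (X.minusDiff_odd p α hα) hβ,
    SuperSym.gradedFlip_apply _ _ hα (X.minusDiff_odd q β hβ), add_mul, mul_add, one_mul, mul_one,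
    sgn_add, zsmul_eq_mul, Int.cast_mul] at h1 h2 h3 ⊢
  have e1 : (sgn p : K) * sgn p = 1 := by exact_mod_cast congrArg (Int.cast (R := K)) (sgn_mul_self p)
  have e2 : (sgn q : K) * sgn q = 1 := by exact_mod_cast congrArg (Int.cast (R := K)) (sgn_mul_self q)
  field_simp
  linear_combination h1 + (sgn (p * q) : K) * h2 + h3 + (sgn (p * q) : K) * S.homotopy (X.minusDiff β) α * e1

end ChainSplitting

/-! ### The antibracket of an odd second order operator -/

namespace SuperSym

section Bracket

variable {K : Type*} [Field K] {V : Type*} [AddCommGroup V] [Module K V]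
  {𝒱 : ZMod 2 → Submodule K V} [DirectSum.Decomposition 𝒱]
  {Q : V →ₗ[K] V →ₗ[K] K} (hq : HasParity 𝒱 1 Q) (hs : IsGradedSymm 𝒱 Q)

/-- The failure of an odd second order operator `Δ` to be a derivation. -/
def antibracket (s t : SuperSym 𝒱) : SuperSym 𝒱 :=
  secondOrder 𝒱 1 Q hq hs (s * t) - secondOrder 𝒱 1 Q hq hs s * t -
    twist 𝒱 1 s * secondOrder 𝒱 1 Q hq hs t

theorem secondOrder_mul (s t : SuperSym 𝒱) : secondOrder 𝒱 1 Q hq hs (s * t) =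
    antibracket hq hs s t + secondOrder 𝒱 1 Q hq hs s * t +
      twist 𝒱 1 s * secondOrder 𝒱 1 Q hq hs t := by
  rw [antibracket]; abel

theorem antibracket_add_left (s s' t : SuperSym 𝒱) :
    antibracket hq hs (s + s') t = antibracket hq hs s t + antibracket hq hs s' t := by
  simp only [antibracket, add_mul, map_add]; abel

theorem antibracket_add_right (s t t' : SuperSym 𝒱) :
    antibracket hq hs s (t + t') = antibracket hq hs s t + antibracket hq hs s t' := by
  simp only [antibracket, mul_add, map_add]; abel

theorem antibracket_smul_left (r : K) (s t : SuperSym 𝒱) :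
    antibracket hq hs (r • s) t = r • antibracket hq hs s t := by
  simp only [antibracket, smul_mul_assoc, map_smul, smul_sub]

theorem antibracket_zsmul_right (n : ℤ) (s t : SuperSym 𝒱) :
    antibracket hq hs s (n • t) = n • antibracket hq hs s t := by
  simp only [antibracket, mul_smul_comm, map_zsmul, smul_sub]

/-- Bracketing with a generator is a contraction, and the rest is recursion on the first argument.
-/
theorem antibracket_ι_mul {a : ZMod 2} {x : V} (hx : x ∈ 𝒱 a) (s t : SuperSym 𝒱) :
    antibracket hq hs (ι 𝒱 x * s) t = sgn a • (ι 𝒱 x * antibracket hq hs s t) +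
      twist 𝒱 (a + 1) s * contract 𝒱 (Q x) t := by
  simp only [antibracket, mul_assoc, secondOrder_ι_mul _ _ _ _ _ hx,
    contract_mul (hq.isHom hx), map_mul, twist_ι_of_mem 1 hx, one_mul, add_mul, smul_mul_assoc,
    mul_sub, smul_sub]
  abel

/-- The Poisson rule expresses that `Δ` has order two. Induction on the first argument reduces it to
the Leibniz rule of contractions. -/
theorem antibracket_mul {i : ZMod 2} {s : SuperSym 𝒱} (h : s ∈ parity 𝒱 i) (t u : SuperSym 𝒱) :
    antibracket hq hs s (t * u) =
      antibracket hq hs s t * u + twist 𝒱 (i + 1) t * antibracket hq hs s u := by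
  induction h using Submodule.span_induction with
  | mem s h =>
    obtain ⟨n, ε, y, hy, rfl, rfl⟩ := h
    induction n with
    | zero => simp [antibracket, secondOrder_one]
    | succ n ih =>
      have ih' := ih _ (fun k => y k.succ) (fun k => hy k.succ)
      have hp : (List.ofFn fun k : Fin n => ι 𝒱 (y k.succ)).prod ∈ parity 𝒱 (∑ k : Fin n, ε k.succ) :=
        Submodule.subset_span ⟨n, _, _, fun k => hy k.succ, rfl, rfl⟩
      rw [List.ofFn_succ, List.prod_cons, Fin.sum_univ_succ, antibracket_ι_mul hq hs (hy 0),
        antibracket_ι_mul hq hs (hy 0), antibracket_ι_mul hq hs (hy 0), ih',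
        contract_mul (hq.isHom (hy 0)), twist_of_mem_parity _ hp]
      generalize (List.ofFn fun k : Fin n => ι 𝒱 (y k.succ)).prod = s at hp ⊢
      generalize ∑ k : Fin n, ε k.succ = b at hp ⊢
      have e1 : ι 𝒱 (y 0) * twist 𝒱 (b + 1) t = twist 𝒱 (ε 0 + b + 1) t * ι 𝒱 (y 0) := by
        rw [ι_mul_eq (hy 0), twist_twist, add_assoc]
      have e2 : s * twist 𝒱 (ε 0 + 1) t = twist 𝒱 (ε 0 + b + 1) t * s := by
        rw [mul_eq_of_mem_parity hp, twist_twist, ← add_assoc, add_comm b]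
      simp only [mul_add, add_mul, smul_add, smul_mul_assoc, mul_smul_comm, ← mul_assoc, e1, e2]
      abel
  | zero => simp [antibracket]
  | add s s' _ _ hs hs' =>
    simp only [antibracket_add_left, hs, hs', add_mul, mul_add]; abel
  | smul r s _ hs =>
    simp only [antibracket_smul_left, hs, smul_mul_assoc, mul_smul_comm, smul_add]

variable [CharZero K]

theorem secondOrder_mem_parity {q : ZMod 2} {Q : V →ₗ[K] V →ₗ[K] K} (hq : HasParity 𝒱 q Q)
    (hs : IsGradedSymm 𝒱 Q) {i : ZMod 2} {s : SuperSym 𝒱} (h : s ∈ parity 𝒱 i) :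
    secondOrder 𝒱 q Q hq hs s ∈ parity 𝒱 (i + q) := by
  rw [mem_parity_iff] at h ⊢
  rw [twist_secondOrder, h, map_zsmul, smul_smul, one_mul, add_comm, sgn_add]

theorem derivation_mem_parity {D : V →ₗ[K] V}
    (hD : ∀ (i : ZMod 2) (x : V), x ∈ 𝒱 i → D x ∈ 𝒱 (i + 1)) {i : ZMod 2} {s : SuperSym 𝒱}
    (h : s ∈ parity 𝒱 i) : derivation 𝒱 1 D hD s ∈ parity 𝒱 (i + 1) := by
  rw [mem_parity_iff] at h ⊢
  rw [twist_derivation, h, map_zsmul, smul_smul, add_comm, sgn_add]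

theorem antibracket_mem_parity {i j : ZMod 2} {s t : SuperSym 𝒱} (h : s ∈ parity 𝒱 i)
    (h' : t ∈ parity 𝒱 j) : antibracket hq hs s t ∈ parity 𝒱 (i + j + 1) := by
  have h1 := secondOrder_mem_parity hq hs (mul_mem_parity h h')
  have h2 := mul_mem_parity (secondOrder_mem_parity hq hs h) h'
  have h3 := mul_mem_parity h (secondOrder_mem_parity hq hs h')
  rw [add_right_comm] at h2
  rw [← add_assoc] at h3
  rw [antibracket, twist_of_mem_parity 1 h, smul_mul_assoc]
  exact sub_mem (sub_mem h1 h2) (zsmul_mem h3 _)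

theorem antibracket_symm {i j : ZMod 2} {s t : SuperSym 𝒱} (h : s ∈ parity 𝒱 i)
    (h' : t ∈ parity 𝒱 j) : antibracket hq hs s t = sgn (i * j) • antibracket hq hs t s := by
  have hs1 := secondOrder_mem_parity hq hs h
  have ht1 := secondOrder_mem_parity hq hs h'
  rw [antibracket, antibracket, mul_comm_of_mem_parity h h', twist_of_mem_parity 1 h,
    twist_of_mem_parity 1 h', mul_comm_of_mem_parity hs1 h', smul_mul_assoc, smul_mul_assoc,
    mul_comm_of_mem_parity h ht1, map_zsmul]
  simp only [smul_sub, smul_smul, mul_add, add_mul, sgn_add, mul_one, one_mul]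
  rw [mul_left_comm (sgn i), sgn_mul_self, mul_one]
  abel

/-- Apply `Δ` to the definition of the bracket; only `Δ² = 0` is needed. -/
theorem secondOrder_antibracket {i : ZMod 2} {s : SuperSym 𝒱} (h : s ∈ parity 𝒱 i)
    (t : SuperSym 𝒱) : secondOrder 𝒱 1 Q hq hs (antibracket hq hs s t) =
      -antibracket hq hs (secondOrder 𝒱 1 Q hq hs s) t -
        sgn i • antibracket hq hs s (secondOrder 𝒱 1 Q hq hs t) := by
  have h1 := secondOrder_mem_parity hq hs h
  simp only [antibracket, map_sub, secondOrder_odd_square, twist_of_mem_parity 1 h,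
    twist_of_mem_parity 1 h1, smul_mul_assoc, map_zsmul, zero_mul, mul_zero, smul_sub, one_mul,
    sgn_add, sgn_one, smul_zero]
  simp only [mul_neg, mul_one, neg_smul]
  abel

/-- Expand the rule for `Δ{s, t u}` on both sides with the Poisson rule and `secondOrder_mul`. All
terms that still contain `Δ` cancel, and the remaining iterated brackets form the Jacobi identity.
-/
theorem antibracket_jacobi {i j k : ZMod 2} {s t u : SuperSym 𝒱} (hi : s ∈ parity 𝒱 i)
    (hj : t ∈ parity 𝒱 j) (hk : u ∈ parity 𝒱 k) :
    antibracket hq hs (antibracket hq hs s t) u +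
      sgn (k * j) • antibracket hq hs (antibracket hq hs s u) t +
        sgn (i * j + i * k) • antibracket hq hs (antibracket hq hs t u) s = 0 := by
  have hst := antibracket_mem_parity hq hs hi hj
  have hsu := antibracket_mem_parity hq hs hi hk
  have htu := antibracket_mem_parity hq hs hj hk
  have h1 := secondOrder_antibracket hq hs hi (t * u)
  have hds := secondOrder_mem_parity hq hs hi
  have hdt := secondOrder_mem_parity hq hs hj
  rw [antibracket_mul hq hs hi, antibracket_mul hq hs hds, secondOrder_mul,
    antibracket_add_right, antibracket_add_right, antibracket_mul hq hs hi,
    twist_of_mem_parity 1 hj, smul_mul_assoc, antibracket_zsmul_right, antibracket_mul hq hs hi,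
    twist_of_mem_parity _ hj, twist_of_mem_parity _ hj, twist_of_mem_parity _ hdt, map_add,
    secondOrder_mul, smul_mul_assoc, map_zsmul, secondOrder_mul, secondOrder_antibracket hq hs hi,
    secondOrder_antibracket hq hs hi, twist_of_mem_parity _ hst, twist_of_mem_parity _ hj,
    antibracket_symm hq hs hi htu, antibracket_symm hq hs hj hsu] at h1
  -- In each of the eight cases of parities the signs are numbers, and linear arithmetic finishes.
  obtain rfl | rfl := zmod_two_cases i <;> obtain rfl | rfl := zmod_two_cases j <;>
    obtain rfl | rfl := zmod_two_cases k <;>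
    simp [sgn, smul_add, mul_sub, sub_mul, mul_add, add_mul, CharTwo.add_self_eq_zero] at h1 ⊢ <;>
    rw [← sub_eq_zero] at h1 <;> (try rw [← h1]) <;> abel_nf at h1 ⊢

end Bracket

end SuperSym

/-! ### The operator of the zero form -/

namespace SuperSym

variable {K : Type*} [Field K] {V : Type*} [AddCommGroup V] [Module K V]
  {𝒱 : ZMod 2 → Submodule K V}

theorem hasParity_zero (q : ZMod 2) : HasParity 𝒱 q 0 := fun _ _ _ _ _ _ _ => rfl

theorem isGradedSymm_zero : IsGradedSymm 𝒱 0 := fun _ _ _ _ _ _ => (smul_zero _).symm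

theorem secondOrder_zero [DirectSum.Decomposition 𝒱] (q : ZMod 2) (s : SuperSym 𝒱) :
    secondOrder 𝒱 q 0 (hasParity_zero q) isGradedSymm_zero s = 0 := by
  induction s using left_induction 𝒱 with
  | one => exact secondOrder_one _ _ _ _ _
  | add s t hs ht => rw [map_add, hs, ht, add_zero]
  | smul r s hs => rw [map_smul, hs, smul_zero]
  | ι_mul i x hx s hs => rw [secondOrder_ι_mul _ _ _ _ _ hx, hs]; simp

end SuperSym

/-! ## Power series with coefficients in a graded symmetric algebra -/

namespace SymSeries

variable {K L : Type*} [Field K] [AddCommGroup L] [Module K L] {𝓛 : ZMod 2 → Submodule K L}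

theorem coeff_mapCoeff (T : Module.End K (SymMinus 𝓛)) (x : SymSeries 𝓛) (n : Fin 2 →₀ ℕ) :
    MvPowerSeries.coeff n (mapCoeff T x) = T (MvPowerSeries.coeff n x) := rfl

theorem mapCoeff_C (T : Module.End K (SymMinus 𝓛)) (a : SymMinus 𝓛) :
    mapCoeff T (MvPowerSeries.C a) = MvPowerSeries.C (T a) := by
  ext n
  rw [coeff_mapCoeff, MvPowerSeries.coeff_C, MvPowerSeries.coeff_C]
  split_ifs <;> simp

theorem X_pow_smul (x : SymSeries 𝓛) (i : Fin 2) (k : ℕ) :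
    (MvPowerSeries.X i : Scalars K) ^ k • x = MvPowerSeries.X i ^ k * x := by
  rw [Algebra.smul_def]
  change MvPowerSeries.map _ (MvPowerSeries.X i ^ k) * x = _
  rw [map_pow, MvPowerSeries.map_X]

theorem coeff_X_pow_smul (x : SymSeries 𝓛) (i : Fin 2) (k : ℕ) (n : Fin 2 →₀ ℕ) :
    MvPowerSeries.coeff n ((MvPowerSeries.X i : Scalars K) ^ k • x) =
      if k ≤ n i then MvPowerSeries.coeff (n - Finsupp.single i k) x else 0 := by
  rw [X_pow_smul, MvPowerSeries.X_pow_eq, MvPowerSeries.coeff_monomial_mul, one_mul]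
  simp only [Finsupp.single_le_iff]

theorem coeff_smul_C (r : Scalars K) (a : SymMinus 𝓛) (n : Fin 2 →₀ ℕ) :
    MvPowerSeries.coeff n (r • (MvPowerSeries.C a : SymSeries 𝓛)) =
      MvPowerSeries.coeff n r • a := by
  rw [coeff_smul, Finset.sum_eq_single (n, 0)]
  · simp
  · rintro ⟨p, q⟩ hpq hne
    rw [MvPowerSeries.coeff_C, if_neg, smul_zero]
    rintro rfl
    rw [Finset.HasAntidiagonal.mem_antidiagonal, add_zero] at hpq
    exact hne (by rw [← hpq])
  · simp

/-- A linear map of modules of power series is determined by its values on constants. -/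
theorem eq_zero_of_C (g : SymSeries 𝓛 →ₗ[Scalars K] SymSeries 𝓛)
    (h : ∀ a, g (MvPowerSeries.C a) = 0) : g = 0 := by
  refine LinearMap.ext fun x => MvPowerSeries.ext fun n => ?_
  -- The series `x` splits into finitely many monomials of exponent at most `n`, a multiple of `ħ^{n
  -- 0 + 1}` and a multiple of `λ^{n 1 + 1}`. Linearity over `K[[ħ, λ]]` makes the last two
  -- invisible in the coefficient at `n`, so continuity of `g` plays no role.
  let y : SymSeries 𝓛 := fun k => MvPowerSeries.coeff (k + Finsupp.single 0 (n 0 + 1)) x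
  let z : SymSeries 𝓛 := fun k =>
    if k 0 ≤ n 0 then MvPowerSeries.coeff (k + Finsupp.single 1 (n 1 + 1)) x else 0
  have hx : x = ∑ k ∈ Finset.Iic n,
      (MvPowerSeries.monomial k (1 : K) : Scalars K) •
        (MvPowerSeries.C (MvPowerSeries.coeff k x) : SymSeries 𝓛) +
      (MvPowerSeries.X 0 : Scalars K) ^ (n 0 + 1) • y +
      (MvPowerSeries.X 1 : Scalars K) ^ (n 1 + 1) • z := by
    ext k
    rw [map_add, map_add, map_sum, coeff_X_pow_smul, coeff_X_pow_smul]
    have hk : k ∈ Finset.Iic n ↔ k 0 ≤ n 0 ∧ k 1 ≤ n 1 := by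
      rw [Finset.mem_Iic, Finsupp.le_def, Fin.forall_fin_two]
    have hs : ∑ j ∈ Finset.Iic n, MvPowerSeries.coeff k
        ((MvPowerSeries.monomial j (1 : K) : Scalars K) •
          (MvPowerSeries.C (MvPowerSeries.coeff j x) : SymSeries 𝓛)) =
        if k 0 ≤ n 0 ∧ k 1 ≤ n 1 then MvPowerSeries.coeff k x else 0 := by
      simp only [coeff_smul_C, MvPowerSeries.coeff_monomial, ite_smul, one_smul, zero_smul,
        Finset.sum_ite_eq, hk]
    rw [hs]
    have hy : n 0 + 1 ≤ k 0 → MvPowerSeries.coeff (k - Finsupp.single 0 (n 0 + 1)) y =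
        MvPowerSeries.coeff k x := fun h0 => by
      change MvPowerSeries.coeff (k - Finsupp.single 0 (n 0 + 1) + Finsupp.single 0 (n 0 + 1)) x = _
      rw [tsub_add_cancel_of_le (Finsupp.single_le_iff.2 h0)]
    have hz : n 1 + 1 ≤ k 1 → MvPowerSeries.coeff (k - Finsupp.single 1 (n 1 + 1)) z =
        if k 0 ≤ n 0 then MvPowerSeries.coeff k x else 0 := fun h1 => by
      change (if (k - Finsupp.single 1 (n 1 + 1) : Fin 2 →₀ ℕ) 0 ≤ n 0 then MvPowerSeries.coeff
        (k - Finsupp.single 1 (n 1 + 1) + Finsupp.single 1 (n 1 + 1)) x else 0) = _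
      rw [tsub_add_cancel_of_le (Finsupp.single_le_iff.2 h1)]
      simp
    by_cases h0 : k 0 ≤ n 0 <;> by_cases h1 : k 1 ≤ n 1
    · rw [if_pos ⟨h0, h1⟩, if_neg (by lia), if_neg (by lia), add_zero, add_zero]
    · rw [if_neg (by tauto), if_neg (by lia), if_pos (by lia), hz (by lia), if_pos h0, zero_add,
        zero_add]
    · rw [if_neg (by tauto), if_pos (by lia), if_neg (by lia), hy (by lia), zero_add, add_zero]
    · rw [if_neg (by tauto), if_pos (by lia), if_pos (by lia), hy (by lia), hz (by lia), if_neg h0,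
        zero_add, add_zero]
  rw [LinearMap.zero_apply, map_zero, hx]
  simp only [map_add, map_sum, map_smul, h, smul_zero, Finset.sum_const_zero, coeff_X_pow_smul,
    zero_add]
  rw [if_neg (by lia), if_neg (by lia), add_zero]

/-- The same for a function that is linear in an unbundled way. -/
theorem apply_eq_zero_of_C {g : SymSeries 𝓛 → SymSeries 𝓛} (hadd : ∀ x y, g (x + y) = g x + g y)
    (hsmul : ∀ (r : Scalars K) x, g (r • x) = r • g x) (h : ∀ a, g (MvPowerSeries.C a) = 0) :
    ∀ x, g x = 0 :=
  LinearMap.congr_fun (eq_zero_of_C { toFun := g, map_add' := hadd, map_smul' := hsmul } h)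

variable [DirectSum.Decomposition 𝓛]

/-- The grading automorphism `x ↦ (-1)^{p|x|} x`. -/
def twist (𝓛 : ZMod 2 → Submodule K L) [DirectSum.Decomposition 𝓛] (p : ZMod 2) :
    Module.End (Scalars K) (SymSeries 𝓛) :=
  mapCoeff (SuperSym.twist (minusGrading 𝓛) p).toLinearMap

/-- The projection to the part of parity `p`. -/
def parityProj (𝓛 : ZMod 2 → Submodule K L) [DirectSum.Decomposition 𝓛] (p : ZMod 2) :
    Module.End K (SymMinus 𝓛) :=
  (2⁻¹ : K) • (1 + sgn p • (SuperSym.twist (minusGrading 𝓛) 1).toLinearMap)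

variable [CharZero K]

theorem parityProj_mem (p : ZMod 2) (s : SymMinus 𝓛) :
    parityProj 𝓛 p s ∈ SuperSym.parity (minusGrading 𝓛) p := by
  rw [SuperSym.mem_parity_iff]
  simp only [parityProj, LinearMap.smul_apply, LinearMap.add_apply, Module.End.one_apply,
    AlgHom.toLinearMap_apply, map_smul, map_add, map_zsmul, SuperSym.twist_twist,
    CharTwo.add_self_eq_zero, SuperSym.twist_zero, smul_add]
  rw [smul_comm (sgn p) (2⁻¹ : K) s, smul_comm (sgn p) (2⁻¹ : K), smul_smul, sgn_mul_self, one_smul,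
    add_comm]

theorem parityProj_of_mem {p : ZMod 2} {s : SymMinus 𝓛}
    (hs : s ∈ SuperSym.parity (minusGrading 𝓛) p) : parityProj 𝓛 p s = s := by
  rw [SuperSym.mem_parity_iff] at hs
  simp only [parityProj, LinearMap.smul_apply, LinearMap.add_apply, Module.End.one_apply,
    AlgHom.toLinearMap_apply, hs, smul_smul, sgn_mul_self, one_smul]
  rw [← two_smul K s, smul_smul, inv_mul_cancel₀ two_ne_zero, one_smul]

theorem parityProj_series_mem (p : ZMod 2) (x : SymSeries 𝓛) :
    mapCoeff (parityProj 𝓛 p) x ∈ SymSeries.parity 𝓛 p := fun _ => parityProj_mem p _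

/-- Writing a homogeneous `x` as its own projection turns an identity for homogeneous elements into
one that is linear in an unrestricted `x`. -/
theorem parityProj_series_of_mem {p : ZMod 2} {x : SymSeries 𝓛}
    (hx : x ∈ SymSeries.parity 𝓛 p) : mapCoeff (parityProj 𝓛 p) x = x :=
  MvPowerSeries.ext fun n => parityProj_of_mem (hx n)

theorem mem_parity_iff {p : ZMod 2} {x : SymSeries 𝓛} :
    x ∈ SymSeries.parity 𝓛 p ↔ twist 𝓛 1 x = sgn p • x := by
  refine ⟨fun h => MvPowerSeries.ext fun n => ?_, fun h n => ?_⟩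
  · rw [map_zsmul]
    exact SuperSym.mem_parity_iff.1 (h n)
  · rw [SuperSym.mem_parity_iff, ← map_zsmul, ← h]
    rfl

theorem parityProj_add (x : SymSeries 𝓛) :
    mapCoeff (parityProj 𝓛 0) x + mapCoeff (parityProj 𝓛 1) x = x := by
  refine MvPowerSeries.ext fun n => ?_
  rw [map_add, coeff_mapCoeff, coeff_mapCoeff]
  simp only [parityProj, LinearMap.smul_apply, LinearMap.add_apply, Module.End.one_apply,
    AlgHom.toLinearMap_apply, sgn_zero, sgn_one, ← smul_add]
  rw [one_smul, neg_one_smul, add_add_add_comm, add_neg_cancel, add_zero, ← two_smul K, smul_smul,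
    inv_mul_cancel₀ two_ne_zero, one_smul]

theorem isInternal_parity : DirectSum.IsInternal (SymSeries.parity 𝓛) := by
  rw [DirectSum.isInternal_submodule_iff_isCompl (SymSeries.parity 𝓛) (i := 0) (j := 1) (by decide)
    (by ext i; simpa using zmod_two_cases i)]
  constructor
  · rw [Submodule.disjoint_def]
    intro x h0 h1
    refine MvPowerSeries.ext fun n => SuperSym.smul_two_eq_zero (K := K) ?_
    have e0 := SuperSym.mem_parity_iff.1 (h0 n)
    have e1 := SuperSym.mem_parity_iff.1 (h1 n)
    rw [e0, sgn_zero, sgn_one, one_smul, neg_one_smul] at e1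
    exact e1
  · rw [codisjoint_iff, eq_top_iff]
    intro x _
    rw [← parityProj_add x]
    exact Submodule.add_mem_sup (parityProj_series_mem 0 x) (parityProj_series_mem 1 x)

end SymSeries

/-! ### The DGLA axioms -/

namespace CircleComplex

open SymSeries

variable {K L : Type*} [Field K] [AddCommGroup L] [Module K L]
  {𝓛 : ZMod 2 → Submodule K L} [DirectSum.Decomposition 𝓛] (X : CircleComplex 𝓛)

theorem minusDiff_minusDiff (α : ℕ →₀ L) : X.minusDiff (X.minusDiff α) = 0 := by
  ext n
  have h := X.b_B (α (n + 1))
  simp only [minusDiff_apply, map_add, X.b_b, X.B_B, zero_add, add_zero, Finsupp.zero_apply]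
  exact h

theorem symDiff_symDiff (s : SymMinus 𝓛) : X.symDiff (X.symDiff s) = 0 :=
  SuperSym.derivation_derivation _ X.minusDiff_minusDiff s

/-- The terms with `α_1` and `β_1` vanish by `B² = 0` and self-adjointness of `B`; those with `α_0`
and `β_0` cancel by `bB + Bb = 0` and compatibility of `b` with the pairing. -/
theorem Omega_diff (p : ZMod 2) (α β : ℕ →₀ L) (hα : α ∈ minusGrading 𝓛 p) :
    X.Omega (X.minusDiff α) β + sgn p • X.Omega α (X.minusDiff β) = 0 := by
  have h1 := X.pairing_b (p + 1) (X.B (α 0)) (β 0) (X.B_odd p _ (hα 0))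
  have h2 := X.pairing_B (p + 1) (X.B (α 0)) (β 1) (X.B_odd p _ (hα 0))
  have h3 : X.pairing (X.b (X.B (α 0)) + X.B (X.b (α 0))) (β 0) = 0 := by
    rw [X.b_B, map_zero, LinearMap.zero_apply]
  rw [X.B_B, map_zero, LinearMap.zero_apply, sgn_add, sgn_one, mul_neg_one, neg_smul,
    zero_eq_neg] at h2
  rw [sgn_add, sgn_one, mul_neg_one, neg_smul] at h1
  rw [map_add, LinearMap.add_apply] at h3
  simp only [Omega, LinearMap.compl₁₂_apply, LinearMap.comp_apply, Finsupp.lapply_apply,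
    minusDiff_apply, map_add, X.B_B, add_zero, smul_add, h2]
  simp only [zsmul_eq_mul] at h1 h3 ⊢
  linear_combination h3 - h1

/-- The commutator is the second order operator of the coboundary of `Ω`, which is zero. -/
theorem symDiff_Delta (s : SymMinus 𝓛) : X.symDiff (X.Delta s) = -X.Delta (X.symDiff s) := by
  have h := SuperSym.derivation_secondOrder X.minusDiff_odd (q' := 0) rfl X.Omega_odd X.Omega_symm
    (SuperSym.hasParity_zero 0) SuperSym.isGradedSymm_zero
    (fun i x y hx => by rw [X.Omega_diff i x y hx]; simp) s
  rw [SuperSym.secondOrder_zero, add_zero, sgn_one, neg_one_smul] at h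
  exact h

theorem Delta_Delta [CharZero K] (s : SymMinus 𝓛) : X.Delta (X.Delta s) = 0 :=
  SuperSym.secondOrder_odd_square _ _ s

/-- The bracket of `Sym(L_-)`. -/
def bracket (s t : SymMinus 𝓛) : SymMinus 𝓛 := SuperSym.antibracket X.Omega_odd X.Omega_symm s t

theorem dgla_bracket_apply (x y : SymSeries 𝓛) : X.dgla.bracket x y =
    mapCoeff X.Delta (x * y) - mapCoeff X.Delta x * y - twist 𝓛 1 x * mapCoeff X.Delta y := rfl

theorem dgla_bracket_C (s t : SymMinus 𝓛) :
    X.dgla.bracket (MvPowerSeries.C s) (MvPowerSeries.C t) = MvPowerSeries.C (X.bracket s t) := by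
  rw [dgla_bracket_apply, SymSeries.twist, ← map_mul, mapCoeff_C, mapCoeff_C, mapCoeff_C,
    mapCoeff_C, ← map_mul, ← map_mul, ← map_sub, ← map_sub]
  rfl

theorem dgla_d_apply (x : SymSeries 𝓛) : X.dgla.d x =
    mapCoeff X.symDiff x + (MvPowerSeries.X 0 : Scalars K) • mapCoeff X.Delta x := rfl

theorem dgla_d_d [CharZero K] (x : SymSeries 𝓛) : X.dgla.d (X.dgla.d x) = 0 := by
  have h1 : mapCoeff X.symDiff (mapCoeff X.symDiff x) = 0 :=
    MvPowerSeries.ext fun _ => X.symDiff_symDiff _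
  have h2 : mapCoeff X.Delta (mapCoeff X.Delta x) = 0 :=
    MvPowerSeries.ext fun _ => X.Delta_Delta _
  have h3 : mapCoeff X.symDiff (mapCoeff X.Delta x) = -mapCoeff X.Delta (mapCoeff X.symDiff x) :=
    MvPowerSeries.ext fun _ => X.symDiff_Delta _
  simp only [dgla_d_apply, map_add, map_smul, h1, h2, h3]
  simp

variable [CharZero K]

/-- A derivation that anticommutes with `Δ` respects every operation built from `Δ` and the product.
-/
theorem symDiff_bracket {i : ZMod 2} {s : SymMinus 𝓛}
    (hs : s ∈ SuperSym.parity (minusGrading 𝓛) i) (t : SymMinus 𝓛) :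
    X.symDiff (X.bracket s t) =
      -X.bracket (X.symDiff s) t - sgn i • X.bracket s (X.symDiff t) := by
  have hD := X.symDiff_Delta
  have hds : X.symDiff s ∈ SuperSym.parity (minusGrading 𝓛) (i + 1) :=
    SuperSym.derivation_mem_parity _ hs
  have hDs : X.Delta s ∈ SuperSym.parity (minusGrading 𝓛) (i + 1) :=
    SuperSym.secondOrder_mem_parity _ _ hs
  have hmul : ∀ s t, X.symDiff (s * t) = X.symDiff s * t +
    SuperSym.twist (minusGrading 𝓛) 1 s * X.symDiff t := SuperSym.derivation_mul _
  have hb : ∀ s t, X.bracket s t = X.Delta (s * t) - X.Delta s * t -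
    SuperSym.twist (minusGrading 𝓛) 1 s * X.Delta t := fun _ _ => rfl
  simp only [hb, SuperSym.twist_of_mem_parity 1 hs, SuperSym.twist_of_mem_parity 1 hds,
    SuperSym.twist_of_mem_parity 1 hDs, one_mul, smul_mul_assoc, map_sub, map_zsmul, hmul, hD,
    map_add, sgn_add, sgn_one, mul_one, neg_smul, smul_sub, smul_add, neg_mul,
    mul_neg, smul_neg, smul_smul, sgn_mul_self, one_smul]
  abel

/-- After inserting parity projections, the identities that involve the bracket are `K[[ħ,
λ]]`-linear in each argument, so they need checking only on constants, where they are properties of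
the antibracket. -/
theorem dgla_isDGLA : X.dgla.IsDGLA where
  isInternal := isInternal_parity
  d_odd i x hx n := by
    rw [dgla_d_apply, map_add, coeff_mapCoeff, ← pow_one (MvPowerSeries.X 0 : Scalars K),
      coeff_X_pow_smul, coeff_mapCoeff]
    refine add_mem (SuperSym.derivation_mem_parity _ (hx n)) ?_
    split_ifs
    · exact SuperSym.secondOrder_mem_parity _ _ (hx _)
    · exact zero_mem _
  bracket_odd i j x y hx hy := by
    change X.dgla.bracket x y ∈ SymSeries.parity 𝓛 (i + j + 1)
    rw [mem_parity_iff, ← sub_eq_zero, ← parityProj_series_of_mem hx,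
      ← parityProj_series_of_mem hy]
    clear hx hy
    revert x
    refine apply_eq_zero_of_C (fun x x' => ?_) (fun r x => ?_) (fun a => ?_)
    · simp only [map_add, LinearMap.add_apply, smul_add]; abel
    · simp only [map_smul, LinearMap.smul_apply, smul_sub]; rw [smul_comm]
    revert y
    refine apply_eq_zero_of_C (fun x x' => ?_) (fun r x => ?_) (fun b => ?_)
    · simp only [map_add, smul_add]; abel
    · simp only [map_smul, smul_sub]; rw [smul_comm]
    rw [mapCoeff_C, mapCoeff_C, dgla_bracket_C, SymSeries.twist, mapCoeff_C, sub_eq_zero,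
      ← map_zsmul]
    exact congrArg _ (SuperSym.mem_parity_iff.1 (SuperSym.antibracket_mem_parity X.Omega_odd
      X.Omega_symm (parityProj_mem i a) (parityProj_mem j b)))
  d_d := X.dgla_d_d
  bracket_symm i j x y hx hy := by
    rw [← sub_eq_zero, ← parityProj_series_of_mem hx, ← parityProj_series_of_mem hy]
    clear hx hy
    revert x
    refine apply_eq_zero_of_C (fun x x' => ?_) (fun r x => ?_) (fun a => ?_)
    · simp only [map_add, LinearMap.add_apply, smul_add]; abel
    · simp only [map_smul, LinearMap.smul_apply, smul_sub]; rw [smul_comm]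
    revert y
    refine apply_eq_zero_of_C (fun x x' => ?_) (fun r x => ?_) (fun b => ?_)
    · simp only [map_add, LinearMap.add_apply, smul_add]; abel
    · simp only [map_smul, LinearMap.smul_apply, smul_sub]; rw [smul_comm]
    rw [mapCoeff_C, mapCoeff_C, dgla_bracket_C, dgla_bracket_C, sub_eq_zero, ← map_zsmul]
    exact congrArg _ (SuperSym.antibracket_symm _ _ (parityProj_mem i a) (parityProj_mem j b))
  leibniz i x y hx := by
    rw [← parityProj_series_of_mem hx]
    clear hx
    revert x
    refine apply_eq_zero_of_C (fun x x' => ?_) (fun r x => ?_) (fun a => ?_)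
    · simp only [map_add, LinearMap.add_apply, smul_add]; abel
    · simp only [map_smul, LinearMap.smul_apply, smul_add]; rw [smul_comm]
    revert y
    refine apply_eq_zero_of_C (fun x x' => ?_) (fun r x => ?_) (fun b => ?_)
    · simp only [map_add, smul_add]; abel
    · simp only [map_smul, smul_add]; rw [smul_comm]
    have ha := parityProj_mem i a
    have h1 := X.symDiff_bracket ha b
    have h2 : X.Delta (X.bracket _ b) = -X.bracket _ b - sgn i • X.bracket _ (X.Delta b) :=
      SuperSym.secondOrder_antibracket X.Omega_odd X.Omega_symm ha b
    simp only [dgla_d_apply, mapCoeff_C, map_add, map_smul, LinearMap.add_apply,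
      LinearMap.smul_apply, dgla_bracket_C, smul_add, h1, h2, map_sub, map_neg, map_zsmul,
      smul_sub, smul_neg]
    rw [smul_comm (sgn i) (MvPowerSeries.X 0 : Scalars K)]
    simp only [Delta]
    abel
  jacobi i j k x y z hx hy hz := by
    rw [← parityProj_series_of_mem hx, ← parityProj_series_of_mem hy,
      ← parityProj_series_of_mem hz]
    clear hx hy hz
    revert x
    refine apply_eq_zero_of_C (fun x x' => ?_) (fun r x => ?_) (fun a => ?_)
    · simp only [map_add, LinearMap.add_apply, smul_add]; abel
    · simp only [map_smul, LinearMap.smul_apply, smul_add]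
      rw [smul_comm (sgn (k * j)), smul_comm (sgn (i * j + i * k))]
    revert y
    refine apply_eq_zero_of_C (fun x x' => ?_) (fun r x => ?_) (fun b => ?_)
    · simp only [map_add, LinearMap.add_apply, smul_add]; abel
    · simp only [map_smul, LinearMap.smul_apply, smul_add]
      rw [smul_comm (sgn (k * j)), smul_comm (sgn (i * j + i * k))]
    revert z
    refine apply_eq_zero_of_C (fun x x' => ?_) (fun r x => ?_) (fun c => ?_)
    · simp only [map_add, LinearMap.add_apply, smul_add]; abel
    · simp only [map_smul, LinearMap.smul_apply, smul_add]
      rw [smul_comm (sgn (k * j)), smul_comm (sgn (i * j + i * k))]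
    simp only [mapCoeff_C, dgla_bracket_C]
    rw [← map_zsmul, ← map_zsmul, ← map_add, ← map_add]
    exact (congrArg _ (SuperSym.antibracket_jacobi X.Omega_odd X.Omega_symm (parityProj_mem i a)
      (parityProj_mem j b) (parityProj_mem k c))).trans (map_zero _)

theorem trivialDgla_isDGLA : X.trivialDgla.IsDGLA where
  isInternal := isInternal_parity
  d_odd i x hx n := SuperSym.derivation_mem_parity X.minusDiff_odd (hx n)
  bracket_odd i j x y _ _ := zero_mem _
  d_d x := MvPowerSeries.ext fun _ => X.symDiff_symDiff _
  bracket_symm i j x y _ _ := (smul_zero _).symm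
  leibniz i x y _ := by simp [trivialDgla]
  jacobi i j k x y z _ _ _ := by simp [trivialDgla]

end CircleComplex

/-! ## Koszul signs -/

section KoszulSign

variable {N : ℕ} {ε : Fin N → ZMod 2}

theorem koszulSign_cons (a : Fin N) (l : List (Fin N)) : koszulSign ε (a :: l) =
    (l.map fun b => if b < a then sgn (ε a * ε b) else 1).prod * koszulSign ε l := rfl

/-- All other pairs keep their relative order, so only the factor of the pair `a, b` changes. -/
theorem koszulSign_swap {a b : Fin N} (hab : a ≠ b) (l₀ l : List (Fin N)) :
    koszulSign ε (l₀ ++ a :: b :: l) = sgn (ε a * ε b) * koszulSign ε (l₀ ++ b :: a :: l) := by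
  induction l₀ with
  | nil =>
    simp only [List.nil_append, koszulSign_cons, List.map_cons, List.prod_cons]
    obtain h | h := lt_or_gt_of_ne hab
    · rw [if_neg h.le.not_gt, if_pos h, mul_comm (ε b)]
      linear_combination (-(List.map (fun c => if c < a then sgn (ε a * ε c) else 1) l).prod *
        ((List.map (fun c => if c < b then sgn (ε b * ε c) else 1) l).prod * koszulSign ε l)) *
        sgn_mul_self (ε a * ε b)
    · rw [if_neg h.le.not_gt, if_pos h]
      ring
  | cons c l₀ ih =>
    rw [List.cons_append, List.cons_append, koszulSign_cons, koszulSign_cons, ih,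
      (((List.Perm.swap b a l).append_left l₀).map _).prod_eq]
    ring

/-- An adjacent exchange changes the sign and the product by the same factor. The prefix `l₀`
carries the induction under `List.Perm.cons`, where earlier indices still enter the sign. -/
theorem koszulSign_append_smul_prod {A : Type*} [Ring A] {z : Fin N → A}
    (hz : ∀ a b, z a * z b = sgn (ε a * ε b) • (z b * z a)) {l l' : List (Fin N)} (h : l.Perm l')
    (l₀ : List (Fin N)) : koszulSign ε (l₀ ++ l) • (l.map z).prod =
      koszulSign ε (l₀ ++ l') • (l'.map z).prod := by
  induction h generalizing l₀ with
  | nil => rfl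
  | cons a _ ih =>
    have := ih (l₀ ++ [a])
    simp only [List.append_assoc, List.singleton_append] at this
    rw [List.map_cons, List.map_cons, List.prod_cons, List.prod_cons, ← mul_smul_comm, this,
      mul_smul_comm]
  | swap a b l =>
    by_cases hab : a = b
    · rw [hab]
    · simp only [List.map_cons, List.prod_cons, ← mul_assoc]
      rw [koszulSign_swap hab l₀ l, hz b a, smul_mul_assoc, smul_smul, mul_comm (ε b),
        mul_comm (sgn _)]
  | trans _ _ h1 h2 => rw [h1, h2]

theorem koszulSign_eq_one {l : List (Fin N)} (h : l.Pairwise (· < ·)) : koszulSign ε l = 1 := by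
  induction h with
  | nil => rfl
  | @cons a l ha _ ih =>
    rw [koszulSign_cons, ih, mul_one]
    refine List.prod_eq_one fun x hx => ?_
    obtain ⟨b, hb, rfl⟩ := List.mem_map.1 hx
    exact if_neg (ha b hb).le.not_gt

theorem koszulSign_smul_prod {A : Type*} [Ring A] {z : Fin N → A}
    (hz : ∀ a b, z a * z b = sgn (ε a * ε b) • (z b * z a)) {l : List (Fin N)}
    (h : l.Perm (List.finRange N)) : koszulSign ε l • (l.map z).prod = (List.ofFn z).prod := by
  have := koszulSign_append_smul_prod hz h []
  rwa [List.nil_append, List.nil_append, koszulSign_eq_one (List.pairwise_lt_finRange N), one_smul,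
    ← List.ofFn_eq_map] at this

theorem koszulSign_mul_self (l : List (Fin N)) : koszulSign ε l * koszulSign ε l = 1 := by
  induction l with
  | nil => rfl
  | cons a l ih =>
    have : (l.map fun b => if b < a then sgn (ε a * ε b) else 1).prod *
        (l.map fun b => if b < a then sgn (ε a * ε b) else 1).prod = 1 := by
      rw [← List.prod_map_mul]
      refine List.prod_eq_one fun x hx => ?_
      obtain ⟨b, -, rfl⟩ := List.mem_map.1 hx
      split_ifs
      · exact sgn_mul_self _
      · exact one_mul 1
    rw [koszulSign_cons]
    linear_combination (koszulSign ε l * koszulSign ε l) * this + ih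

end KoszulSign

/-! ## Operators on ordered products -/

section OrderedProduct

theorem prod_Iio_succ {M : Type*} [CommMonoid M] {n : ℕ} (f : Fin (n + 1) → M) (i : Fin n) :
    ∏ k ∈ Finset.Iio i.succ, f k = f 0 * ∏ k ∈ Finset.Iio i, f k.succ := by
  have h : Finset.Iio i.succ = insert 0 ((Finset.Iio i).map (Fin.succEmb n)) := by
    ext k
    refine Fin.cases ?_ (fun k => ?_) k <;> simp
  rw [h, Finset.prod_insert (by simp), Finset.prod_map]
  rfl

theorem prod_Iio_zero {M : Type*} [CommMonoid M] {n : ℕ} (f : Fin (n + 1) → M) :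
    ∏ k ∈ Finset.Iio 0, f k = 1 := by
  refine Finset.prod_eq_one fun k hk => absurd (Finset.mem_Iio.1 hk) (Fin.not_lt_zero k)

theorem ofFn_update_zero {A : Type*} {n : ℕ} (z : Fin (n + 1) → A) (a : A) :
    List.ofFn (Function.update z 0 a) = a :: List.ofFn fun k => z (Fin.succ k) := by
  rw [List.ofFn_succ, Function.update_self]
  simp [Function.update]

theorem ofFn_update_succ {A : Type*} {n : ℕ} (z : Fin (n + 1) → A) (i : Fin n) (a : A) :
    List.ofFn (Function.update z i.succ a) =
      z 0 :: List.ofFn (Function.update (fun k => z (Fin.succ k)) i a) := by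
  rw [List.ofFn_succ, Function.update_of_ne (Fin.succ_ne_zero i).symm]
  congr 2
  funext k
  simp [Function.update]

variable {A : Type*} [Ring A] {D : A →+ A}

theorem map_ofFn_prod_of_derivation (hD1 : D 1 = 0) {n : ℕ} {z : Fin n → A} {ε : Fin n → ZMod 2}
    (hD : ∀ k w, D (z k * w) = D (z k) * w + sgn (ε k) • (z k * D w)) :
    D (List.ofFn z).prod = ∑ i, (∏ k ∈ Finset.Iio i, sgn (ε k)) •
      (List.ofFn (Function.update z i (D (z i)))).prod := by
  induction n with
  | zero => simpa using hD1
  | succ n ih =>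
    rw [List.ofFn_succ, List.prod_cons, hD, ih fun k => hD k.succ, Fin.sum_univ_succ]
    congr 1
    · rw [prod_Iio_zero, one_smul, ofFn_update_zero, List.prod_cons]
    · rw [Finset.mul_sum, Finset.smul_sum]
      refine Finset.sum_congr rfl fun i _ => ?_
      rw [prod_Iio_succ, ofFn_update_succ, List.prod_cons, mul_smul_comm, smul_smul]

/-- The operator touches only the factor `i`: it passes earlier factors with a sign, while the later
ones lie in `R` and are constants for it. -/
theorem map_ofFn_prod_of_local {n : ℕ} {z : Fin n → A} {ε : Fin n → ZMod 2} {i : Fin n}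
    {R : Submonoid A} (hR : ∀ k ≠ i, z k ∈ R)
    (h1 : ∀ k ≠ i, ∀ w, D (z k * w) = sgn (ε k) • (z k * D w))
    (h2 : ∀ w ∈ R, D (z i * w) = D (z i) * w) :
    D (List.ofFn z).prod = (∏ k ∈ Finset.Iio i, sgn (ε k)) •
      (List.ofFn (Function.update z i (D (z i)))).prod := by
  induction n with
  | zero => exact i.elim0
  | succ n ih =>
    rw [List.ofFn_succ, List.prod_cons]
    revert hR h1 h2
    refine Fin.cases ?_ (fun i => ?_) i
    · intro hR h1 h2
      rw [h2 _ (list_prod_mem ?_), ofFn_update_zero]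
      · rw [prod_Iio_zero, one_smul, List.prod_cons]
      · intro w hw
        obtain ⟨k, rfl⟩ := (List.mem_ofFn' _ _).1 hw
        exact hR _ (Fin.succ_ne_zero k)
    · intro hR h1 h2
      rw [h1 0 (Fin.succ_ne_zero i).symm, ih (fun k hk => hR _ fun h => hk (Fin.succ_injective _ h))
        (fun k hk => h1 _ fun h => hk (Fin.succ_injective _ h)) h2, prod_Iio_succ,
        ofFn_update_succ, List.prod_cons, mul_smul_comm, smul_smul]

end OrderedProduct

/-- Separates loops from edges between different vertices and groups the latter by unordered pairs,
matching the two sums of the bar differential. -/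
theorem sum_pairs {M : Type*} [AddCommMonoid M] {n : ℕ} (f : Fin n × Fin n → M) :
    ∑ e, f e = ∑ i, f (i, i) + ∑ i, ∑ j ∈ Finset.Ioi i, (f (i, j) + f (j, i)) := by
  have h : ∀ i : Fin n, ∑ j, f (i, j) =
      f (i, i) + (∑ j ∈ Finset.Ioi i, f (i, j) + ∑ j ∈ Finset.Iio i, f (i, j)) := by
    intro i
    rw [← Finset.sum_union (by
      rw [Finset.disjoint_left]; intro j h1 h2
      exact lt_asymm (Finset.mem_Ioi.1 h1) (Finset.mem_Iio.1 h2)),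
      ← Finset.sum_insert (f := fun j => f (i, j)) (by simp)]
    refine Finset.sum_congr ?_ fun _ _ => rfl
    ext j
    simp only [Finset.mem_univ, Finset.mem_insert, Finset.mem_union, Finset.mem_Ioi,
      Finset.mem_Iio, true_iff]
    obtain h | h | h := lt_trichotomy i j <;> tauto
  rw [Fintype.sum_prod_type, Finset.sum_congr rfl fun i _ => h i, Finset.sum_add_distrib,
    Finset.sum_add_distrib]
  simp only [Finset.sum_add_distrib]
  congr 2
  refine Finset.sum_comm' ?_
  intro i j
  simp

/-! ## Coefficientwise operators -/

section SeriesMap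

variable {K : Type*} [Field K] {A A' : Type*} [Ring A] [Algebra K A] [Ring A'] [Algebra K A']

/-- The coefficientwise action of a linear map on power series. -/
def seriesMap (T : A →ₗ[K] A') : MvPowerSeries (Fin 2) A →+ MvPowerSeries (Fin 2) A' where
  toFun z n := T (MvPowerSeries.coeff n z)
  map_zero' := funext fun n => by
    change T (MvPowerSeries.coeff n 0) = 0
    rw [map_zero, map_zero]
  map_add' z w := funext fun n => by
    change T (MvPowerSeries.coeff n (z + w)) = T (MvPowerSeries.coeff n z) + T (MvPowerSeries.coeff n w)
    rw [map_add, map_add]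

theorem coeff_seriesMap (T : A →ₗ[K] A') (z : MvPowerSeries (Fin 2) A) (n : Fin 2 →₀ ℕ) :
    MvPowerSeries.coeff n (seriesMap T z) = T (MvPowerSeries.coeff n z) := rfl

/-- The power series with coefficients in a subalgebra. -/
def seriesSubmonoid (R : Subalgebra K A) : Submonoid (MvPowerSeries (Fin 2) A) where
  carrier := {z | ∀ n, MvPowerSeries.coeff n z ∈ R}
  one_mem' n := by
    rw [MvPowerSeries.coeff_one]
    split_ifs
    · exact one_mem R
    · exact zero_mem R
  mul_mem' hz hw n := by
    rw [MvPowerSeries.coeff_mul]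
    exact sum_mem fun p _ => mul_mem (hz _) (hw _)

end SeriesMap

/-! ## The components of the morphism -/

section SlotSeries

open SuperSym

variable {K L : Type*} [Field K] [AddCommGroup L] [Module K L]

/-- The space `Sym((L_-)^J)`. -/
abbrev SlotSym (J : Type*) (𝓛 : ZMod 2 → Submodule K L) : Type _ :=
  SuperSym (piGrading J (minusGrading 𝓛))

/-- The space `Sym((L_-)^J)[[ħ, λ]]`. -/
abbrev SlotSeries (J : Type*) (𝓛 : ZMod 2 → Submodule K L) : Type _ :=
  MvPowerSeries (Fin 2) (SlotSym J 𝓛)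

variable {J J' : Type*} {𝓛 : ZMod 2 → Submodule K L}

instance SlotSeries.algebra : Algebra (Scalars K) (SlotSeries J 𝓛) :=
  (MvPowerSeries.map (algebraMap K (SlotSym J 𝓛))).toAlgebra' fun r x => by
    ext n
    simp only [MvPowerSeries.coeff_mul, MvPowerSeries.coeff_map]
    exact Finset.sum_nbij' Prod.swap Prod.swap (by simp [add_comm]) (by simp [add_comm])
      (by simp) (by simp) fun p _ => Algebra.commutes _ _

theorem SlotSeries.coeff_smul (r : Scalars K) (x : SlotSeries J 𝓛) (n : Fin 2 →₀ ℕ) :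
    MvPowerSeries.coeff n (r • x) = ∑ p ∈ Finset.HasAntidiagonal.antidiagonal n,
      MvPowerSeries.coeff p.1 r • MvPowerSeries.coeff p.2 x := by
  rw [Algebra.smul_def]
  simp only [MvPowerSeries.coeff_mul, Algebra.smul_def]
  rfl

/-- The operator `∑ l, ħ^l C_l`. -/
def hbarSum (C : ℕ → SlotSym J 𝓛 →ₗ[K] SymMinus 𝓛) :
    SlotSeries J 𝓛 →ₗ[Scalars K] SymSeries 𝓛 where
  toFun z n := ∑ l ∈ Finset.range (n 0 + 1), C l (MvPowerSeries.coeff (n - Finsupp.single 0 l) z)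
  map_add' z w := by
    funext n
    simp only [map_add, Finset.sum_add_distrib]
    rfl
  map_smul' r z := by
    refine MvPowerSeries.ext fun n => ?_
    rw [RingHom.id_apply]
    refine Eq.trans ?_ (SymSeries.coeff_smul r _ n).symm
    change ∑ l ∈ Finset.range (n 0 + 1),
      C l (MvPowerSeries.coeff (n - Finsupp.single 0 l) (r • z)) =
      ∑ p ∈ Finset.HasAntidiagonal.antidiagonal n, MvPowerSeries.coeff p.1 r •
        ∑ l ∈ Finset.range (p.2 0 + 1), C l (MvPowerSeries.coeff (p.2 - Finsupp.single 0 l) z)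
    simp only [SlotSeries.coeff_smul, map_sum, map_smul, Finset.smul_sum, Finset.sum_sigma']
    -- Both sides run over the ways to write `n` as an exponent from `r`, a power `ħ^l` and a
    -- remaining exponent; the bijection counts `ħ^l` with the remainder.
    refine Finset.sum_nbij' (fun a => ⟨(a.2.1, a.2.2 + Finsupp.single 0 a.1), a.1⟩)
      (fun a => ⟨a.2, (a.1.1, a.1.2 - Finsupp.single 0 a.2)⟩) ?_ ?_ ?_ ?_ ?_
    · rintro ⟨l, p, q⟩ h
      simp only [Finset.mem_sigma, Finset.mem_range,
        Finset.HasAntidiagonal.mem_antidiagonal] at h ⊢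
      refine ⟨?_, by simp⟩
      rw [← add_assoc, h.2, tsub_add_cancel_of_le (Finsupp.single_le_iff.2 (by lia))]
    · rintro ⟨⟨p, q⟩, l⟩ h
      simp only [Finset.mem_sigma, Finset.mem_range,
        Finset.HasAntidiagonal.mem_antidiagonal] at h ⊢
      have hl : Finsupp.single 0 l ≤ q := Finsupp.single_le_iff.2 (by lia)
      rw [← h.1]
      exact ⟨by simp; lia, (add_tsub_assoc_of_le hl p).symm⟩
    · rintro ⟨l, p, q⟩ _
      simp
    · rintro ⟨⟨p, q⟩, l⟩ h
      simp only [Finset.mem_sigma, Finset.mem_range] at h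
      have hl : Finsupp.single 0 l ≤ q := Finsupp.single_le_iff.2 (by lia)
      simp [tsub_add_cancel_of_le hl]
    · rintro ⟨l, p, q⟩ _
      simp

theorem coeff_hbarSum (C : ℕ → SlotSym J 𝓛 →ₗ[K] SymMinus 𝓛) (z : SlotSeries J 𝓛)
    (n : Fin 2 →₀ ℕ) : MvPowerSeries.coeff n (hbarSum C z) =
      ∑ l ∈ Finset.range (n 0 + 1), C l (MvPowerSeries.coeff (n - Finsupp.single 0 l) z) := rfl

/-- Raising the power of `ħ` by one. -/
theorem hbarSum_succ {C : ℕ → SlotSym J 𝓛 →ₗ[K] SymMinus 𝓛} (h0 : C 0 = 0)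
    (z : SlotSeries J 𝓛) :
    hbarSum C z = (MvPowerSeries.X 0 : Scalars K) • hbarSum (fun l => C (l + 1)) z := by
  refine MvPowerSeries.ext fun n => ?_
  rw [← pow_one (MvPowerSeries.X 0 : Scalars K), SymSeries.coeff_X_pow_smul, coeff_hbarSum,
    Finset.sum_range_succ', h0, LinearMap.zero_apply, add_zero]
  split_ifs with h
  · rw [coeff_hbarSum]
    have e : (n - Finsupp.single 0 1 : Fin 2 →₀ ℕ) 0 + 1 = n 0 := by simp; lia
    rw [e]
    refine Finset.sum_congr rfl fun l _ => ?_
    rw [tsub_tsub, ← Finsupp.single_add, add_comm 1 l]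
  · rw [show n 0 = 0 by lia, Finset.sum_range_zero]

variable [DirectSum.Decomposition 𝓛]

/-- The inclusion of the slot `v`. -/
def slotSeries [DecidableEq J] (𝓛 : ZMod 2 → Submodule K L) [DirectSum.Decomposition 𝓛] (v : J) :
    SymSeries 𝓛 →ₗ[Scalars K] SlotSeries J 𝓛 where
  toFun x := seriesMap (slotHom (minusGrading 𝓛) v).toLinearMap x
  map_add' x y := map_add _ x y
  map_smul' r x := by
    refine MvPowerSeries.ext fun n => ?_
    rw [RingHom.id_apply, SlotSeries.coeff_smul, coeff_seriesMap, SymSeries.coeff_smul, map_sum]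
    simp only [map_smul]
    rfl

theorem coeff_slotSeries [DecidableEq J] (v : J) (x : SymSeries 𝓛) (n : Fin 2 →₀ ℕ) :
    MvPowerSeries.coeff n (slotSeries 𝓛 v x) =
      slotHom (minusGrading 𝓛) v (MvPowerSeries.coeff n x) := rfl

/-- The product of elements in different slots. -/
def slotProd (𝓛 : ZMod 2 → Submodule K L) [DirectSum.Decomposition 𝓛] (m : ℕ) :
    MultilinearMap (Scalars K) (fun _ : Fin m => SymSeries 𝓛) (SlotSeries (Fin m) 𝓛) :=
  (MultilinearMap.mkPiAlgebraFin (Scalars K) m (SlotSeries (Fin m) 𝓛)).compLinearMap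
    (slotSeries 𝓛)

theorem slotProd_apply {m : ℕ} (x : Fin m → SymSeries 𝓛) :
    slotProd 𝓛 m x = (List.ofFn fun v => slotSeries 𝓛 v (x v)).prod := by
  simp [slotProd]

theorem slotProd_update {m : ℕ} (x : Fin m → SymSeries 𝓛) (i : Fin m) (y : SymSeries 𝓛) :
    slotProd 𝓛 m (Function.update x i y) =
      (List.ofFn (Function.update (fun v => slotSeries 𝓛 v (x v)) i (slotSeries 𝓛 i y))).prod := by
  rw [slotProd_apply]
  congr 2
  funext v
  by_cases h : v = i
  · subst h; simp
  · simp [h]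

variable [CharZero K]

theorem map_mem_parity {V V' : Type*} [AddCommGroup V] [Module K V] [AddCommGroup V'] [Module K V']
    {𝒱 : ZMod 2 → Submodule K V} {𝒱' : ZMod 2 → Submodule K V'} [DirectSum.Decomposition 𝒱]
    [DirectSum.Decomposition 𝒱'] {f : V →ₗ[K] V'} (hf : ∀ i x, x ∈ 𝒱 i → f x ∈ 𝒱' i) {p : ZMod 2}
    {s : SuperSym 𝒱} (hs : s ∈ SuperSym.parity 𝒱 p) :
    SuperSym.map hf s ∈ SuperSym.parity 𝒱' p := by
  rw [SuperSym.mem_parity_iff] at hs ⊢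
  rw [← map_twist, hs, map_zsmul]

theorem series_mul_comm {V : Type*} [AddCommGroup V] [Module K V] {𝒱 : ZMod 2 → Submodule K V}
    [DirectSum.Decomposition 𝒱] {i j : ZMod 2} {z w : MvPowerSeries (Fin 2) (SuperSym 𝒱)}
    (hz : ∀ n, MvPowerSeries.coeff n z ∈ SuperSym.parity 𝒱 i)
    (hw : ∀ n, MvPowerSeries.coeff n w ∈ SuperSym.parity 𝒱 j) :
    z * w = sgn (i * j) • (w * z) := by
  ext n
  rw [map_zsmul, MvPowerSeries.coeff_mul, MvPowerSeries.coeff_mul, Finset.smul_sum]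
  refine Finset.sum_nbij' Prod.swap Prod.swap (by simp [add_comm]) (by simp [add_comm])
    (by simp) (by simp) fun p _ => mul_comm_of_mem_parity (hz _) (hw _)

theorem coeff_slotSeries_mem [DecidableEq J] (v : J) {p : ZMod 2} {x : SymSeries 𝓛}
    (hx : x ∈ SymSeries.parity 𝓛 p) (n : Fin 2 →₀ ℕ) :
    MvPowerSeries.coeff n (slotSeries 𝓛 v x) ∈
      SuperSym.parity (piGrading J (minusGrading 𝓛)) p := map_mem_parity _ (hx n)

theorem slotSeries_mul_comm {m : ℕ} {ε : Fin m → ZMod 2} {x : Fin m → SymSeries 𝓛}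
    (hx : ∀ k, x k ∈ SymSeries.parity 𝓛 (ε k)) (a b : Fin m) :
    slotSeries 𝓛 a (x a) * slotSeries 𝓛 b (x b) =
      sgn (ε a * ε b) • (slotSeries 𝓛 b (x b) * slotSeries 𝓛 a (x a)) :=
  series_mul_comm (coeff_slotSeries_mem a (hx a)) (coeff_slotSeries_mem b (hx b))

theorem coeff_slotProd_mem {m : ℕ} {ε : Fin m → ZMod 2} {x : Fin m → SymSeries 𝓛}
    (hx : ∀ k, x k ∈ SymSeries.parity 𝓛 (ε k)) (n : Fin 2 →₀ ℕ) :
    MvPowerSeries.coeff n (slotProd 𝓛 m x) ∈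
      SuperSym.parity (piGrading (Fin m) (minusGrading 𝓛)) (∑ k, ε k) := by
  rw [slotProd_apply]
  -- The number `r` of factors varies in the induction while the set of slots stays `Fin m`.
  suffices h : ∀ (r : ℕ) (ε : Fin r → ZMod 2) (z : Fin r → SlotSeries (Fin m) 𝓛),
      (∀ k n, MvPowerSeries.coeff n (z k) ∈
        SuperSym.parity (piGrading (Fin m) (minusGrading 𝓛)) (ε k)) →
      ∀ n, MvPowerSeries.coeff n (List.ofFn z).prod ∈
        SuperSym.parity (piGrading (Fin m) (minusGrading 𝓛)) (∑ k, ε k) from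
    h m ε _ (fun k => coeff_slotSeries_mem k (hx k)) n
  intro r
  induction r with
  | zero =>
    intro ε z _ n
    rw [List.ofFn_zero, List.prod_nil, MvPowerSeries.coeff_one, Fin.sum_univ_zero]
    split_ifs
    · exact one_mem_parity
    · exact zero_mem _
  | succ r ih =>
    intro ε z hz n
    rw [List.ofFn_succ, List.prod_cons, MvPowerSeries.coeff_mul, Fin.sum_univ_succ]
    exact sum_mem fun p _ => mul_mem_parity (hz 0 _)
      (ih (fun k => ε k.succ) (fun k => z k.succ) (fun k => hz k.succ) _)

end SlotSeries

namespace ChainSplitting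

open SuperSym

variable {K L : Type*} [Field K] [AddCommGroup L] [Module K L]
  {𝓛 : ZMod 2 → Submodule K L} [DirectSum.Decomposition 𝓛] {X : CircleComplex 𝓛}
  (S : ChainSplitting X) {J J' : Type*} [Fintype J] [Fintype J']

/-- The contraction of `n` edges by `H^sym`, weighted by `χ`, followed by the multiplication of all
the slots. -/
def contraction (n : ℕ) (χ : Set (J × J) → K) : SlotSym J 𝓛 →ₗ[K] SymMinus 𝓛 :=
  (sumHom (minusGrading 𝓛)).toLinearMap ∘ₗ
    edgeOp (slotOp S.homotopySym_even S.homotopySym_symm) n χ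

theorem contraction_apply (n : ℕ) (χ : Set (J × J) → K) (z : SlotSym J 𝓛) :
    S.contraction n χ z = sumHom (minusGrading 𝓛)
      (edgeOp (slotOp S.homotopySym_even S.homotopySym_symm) n χ z) := rfl

/-- The final multiplication of the slots may be preceded by any merging `c`. Only the weight
changes: it is evaluated on the image of the set of edges. -/
theorem contraction_pushHom [DecidableEq J'] (c : J → J') (n : ℕ) (χ : Set (J' × J') → K)
    (z : SlotSym J 𝓛) : S.contraction n χ (pushHom (minusGrading 𝓛) c z) =
      S.contraction n (fun s => χ (Prod.map c c '' s)) z := by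
  have h := edgeOp_map (T' := slotOp (J := J') S.homotopySym_even S.homotopySym_symm)
    (T := slotOp (J := J) S.homotopySym_even S.homotopySym_symm)
    (pushHom (minusGrading 𝓛) c).toLinearMap (Prod.map c c)
    (fun e' x => slotOp_pushHom _ _ c e' x) n χ z
  rw [contraction_apply, contraction_apply]
  refine (congrArg _ h).trans (sumHom_pushHom c _)

/-- The component `𝒦_m`. -/
def component : ∀ m : ℕ, MultilinearMap (Scalars K) (fun _ : Fin m => SymSeries 𝓛) (SymSeries 𝓛)
  | 0 => 0
  -- A connected graph with `m + 1` vertices and first Betti number `l` has `l + m` edges.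
  | m + 1 => (hbarSum fun l => S.contraction (l + m) (connWeight K (Fin (m + 1)))).compMultilinearMap
      (slotProd 𝓛 (m + 1))

theorem component_succ_apply (m : ℕ) (x : Fin (m + 1) → SymSeries 𝓛) : S.component (m + 1) x =
    hbarSum (fun l => S.contraction (l + m) (connWeight K (Fin (m + 1)))) (slotProd 𝓛 (m + 1) x) :=
  rfl

variable [CharZero K]

theorem contraction_mem_parity (n : ℕ) (χ : Set (J × J) → K) {p : ZMod 2} {z : SlotSym J 𝓛}
    (hz : z ∈ SuperSym.parity (piGrading J (minusGrading 𝓛)) p) :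
    S.contraction n χ z ∈ SuperSym.parity (minusGrading 𝓛) p := by
  refine map_mem_parity _ ?_
  rw [mem_parity_iff] at hz ⊢
  have h := edgeOp_comm (T := slotOp (J := J) S.homotopySym_even S.homotopySym_symm)
    (Z := (twist (piGrading J (minusGrading 𝓛)) 1).toLinearMap) (fun e x => by
      have := twist_secondOrder (slotForm_parity (J := J) S.homotopySym_even e)
        (slotForm_symm S.homotopySym_symm e) 1 x
      rw [mul_zero, sgn_zero, one_smul] at this
      exact this.symm) n χ z
  rw [AlgHom.toLinearMap_apply, AlgHom.toLinearMap_apply, hz, map_zsmul] at h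
  exact h.symm

theorem component_even (m : ℕ) (ε : Fin m → ZMod 2) (x : Fin m → SymSeries 𝓛)
    (hx : ∀ k, x k ∈ SymSeries.parity 𝓛 (ε k)) :
    S.component m x ∈ SymSeries.parity 𝓛 (∑ k, ε k) := by
  cases m with
  | zero => exact zero_mem _
  | succ m =>
    intro n
    rw [component_succ_apply, coeff_hbarSum]
    exact sum_mem fun l _ => S.contraction_mem_parity _ _ (coeff_slotProd_mem hx _)

/-- Permuting the arguments relabels the slots, which preserves connectedness; reordering the
product of the slots costs the Koszul sign. -/
theorem component_symm (m : ℕ) (ε : Fin m → ZMod 2) (x : Fin m → SymSeries 𝓛)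
    (hx : ∀ k, x k ∈ SymSeries.parity 𝓛 (ε k)) (π : Equiv.Perm (Fin m)) :
    S.component m (fun k => x (π k)) = koszulSign ε (List.ofFn π) • S.component m x := by
  cases m with
  | zero => simp [component]
  | succ m =>
    have h1 : MvPowerSeries.map (pushHom (minusGrading 𝓛) π).toRingHom
        (slotProd 𝓛 (m + 1) fun k => x (π k)) =
          ((List.ofFn π).map fun v => slotSeries 𝓛 v (x v)).prod := by
      rw [slotProd_apply, map_list_prod, List.map_ofFn, List.map_ofFn]
      congr 2
      funext v
      exact MvPowerSeries.ext fun n => pushHom_slotHom _ _ _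
    have h2 : koszulSign ε (List.ofFn π) • ((List.ofFn π).map fun v => slotSeries 𝓛 v (x v)).prod =
        slotProd 𝓛 (m + 1) x := by
      rw [slotProd_apply]
      refine koszulSign_smul_prod (slotSeries_mul_comm hx) ?_
      rw [List.ofFn_eq_map]
      refine (List.perm_ext_iff_of_nodup ((List.nodup_finRange _).map π.injective)
        (List.nodup_finRange _)).2 fun a => ?_
      simp only [List.mem_map, List.mem_finRange, true_and, iff_true]
      exact ⟨π.symm a, π.apply_symm_apply a⟩
    have h3 : ∀ z : SlotSeries (Fin (m + 1)) 𝓛,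
        hbarSum (fun l => S.contraction (l + m) (connWeight K (Fin (m + 1))))
          (MvPowerSeries.map (pushHom (minusGrading 𝓛) π).toRingHom z) =
        hbarSum (fun l => S.contraction (l + m) (connWeight K (Fin (m + 1)))) z := by
      intro z
      refine MvPowerSeries.ext fun n => ?_
      rw [coeff_hbarSum, coeff_hbarSum]
      refine Finset.sum_congr rfl fun l _ => ?_
      refine (S.contraction_pushHom _ _ _ _).trans ?_
      congr 2
      funext s
      refine connWeight_congr ?_
      -- The loop at `0` is harmless and brings the claim into the form of `edgesConnect_insert_iff`
      -- with `i = j = 0`.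
      rw [← edgesConnect_insert_diag 0 s]
      exact (edgesConnect_insert_iff π.surjective rfl
        (fun a b hab => Or.inl (π.injective hab)) s).symm
    rw [component_succ_apply, component_succ_apply, ← h2, ← h1, map_zsmul, h3, smul_smul,
      koszulSign_mul_self, one_smul]

end ChainSplitting

/-! ## Compatibility with the bar differentials -/

namespace SuperSym

variable {K : Type*} [Field K] {V : Type*} [AddCommGroup V] [Module K V] {J : Type*}
  {𝒱 : ZMod 2 → Submodule K V} [DirectSum.Decomposition 𝒱] {D : V →ₗ[K] V}

theorem piMap_odd (hD : ∀ (i : ZMod 2) (x : V), x ∈ 𝒱 i → D x ∈ 𝒱 (i + 1)) (i : ZMod 2) (x : J → V)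
    (hx : x ∈ piGrading J 𝒱 i) :
    LinearMap.pi (fun j => D ∘ₗ LinearMap.proj j) x ∈ piGrading J 𝒱 (i + 1) :=
  fun j => hD i _ (hx j)

variable (J) in
/-- The derivation of `Sym(V^J)` that acts by `D` in every slot. -/
def slotDerivation (hD : ∀ (i : ZMod 2) (x : V), x ∈ 𝒱 i → D x ∈ 𝒱 (i + 1)) :
    Module.End K (SuperSym (piGrading J 𝒱)) :=
  derivation (piGrading J 𝒱) 1 _ (piMap_odd hD)

variable (hD : ∀ (i : ZMod 2) (x : V), x ∈ 𝒱 i → D x ∈ 𝒱 (i + 1))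

theorem slotDerivation_slotHom [DecidableEq J] (v : J) (s : SuperSym 𝒱) :
    slotDerivation J hD (slotHom 𝒱 v s) = slotHom 𝒱 v (derivation 𝒱 1 D hD s) := by
  refine (map_derivation _ hD (piMap_odd hD) (fun x => ?_) s).symm
  funext j
  by_cases h : j = v
  · subst h; simp
  · simp [h]

theorem derivation_sumHom [Fintype J] (s : SuperSym (piGrading J 𝒱)) :
    derivation 𝒱 1 D hD (sumHom 𝒱 s) = sumHom 𝒱 (slotDerivation J hD s) := by
  refine (map_derivation _ (piMap_odd hD) hD (fun x => ?_) s).symm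
  simp

/-- The slotwise form of `derivation_secondOrder`; its minus sign cancels the one in the coboundary
equation `hP`. -/
theorem slotDerivation_slotOp {Q P : V →ₗ[K] V →ₗ[K] K}
    (hq : HasParity 𝒱 0 Q) (hs : IsGradedSymm 𝒱 Q) (hp : HasParity 𝒱 1 P)
    (hs' : IsGradedSymm 𝒱 P)
    (hP : ∀ i x y, x ∈ 𝒱 i → Q (D x) y + sgn i • Q x (D y) = -P x y) (e : J × J)
    (s : SuperSym (piGrading J 𝒱)) :
    slotDerivation J hD (slotOp hq hs e s) =
      slotOp hq hs e (slotDerivation J hD s) + slotOp hp hs' e s := by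
  have := derivation_secondOrder (piMap_odd (J := J) hD) (zero_add 1).symm (slotForm_parity hq e)
    (slotForm_symm hs e) (slotForm_parity hp e) (slotForm_symm hs' e) (fun i x y hx => by
      have h1 := hP i _ (y e.2) (hx e.1)
      have h2 := hP i _ (y e.1) (hx e.2)
      rw [sgn_zero, one_smul, slotForm_apply, slotForm_apply, slotForm_apply,
        ← neg_eq_iff_eq_neg.2 h1, ← neg_eq_iff_eq_neg.2 h2]
      simp only [LinearMap.pi_apply, LinearMap.comp_apply, LinearMap.proj_apply, mul_add, smul_add,
        mul_smul_comm, mul_neg]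
      abel) s
  rwa [sgn_zero, one_smul] at this

end SuperSym

/-- The map that collapses `i` and `j` to `0` and numbers the other elements in increasing order. -/
theorem exists_collapse {m : ℕ} (i j : Fin m) :
    ∃ c : Fin m → Fin (({i, j}ᶜ : Finset (Fin m)).card + 1), (∀ k, c k = 0 ↔ k = i ∨ k = j) ∧
      (∀ k, c (({i, j}ᶜ : Finset (Fin m)).orderEmbOfFin rfl k) = k.succ) ∧
      ∀ a b, c a = c b → a = b ∨ (a = i ∧ b = j) ∨ (a = j ∧ b = i) := by
  let I : Finset (Fin m) := {i, j}ᶜ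
  have hI : ∀ k, k ∉ I ↔ k = i ∨ k = j := fun k => by simp [I]; tauto
  let c : Fin m → Fin (I.card + 1) := fun k =>
    if h : k ∈ I then ((I.orderIsoOfFin rfl).symm ⟨k, h⟩).succ else 0
  have h1 : ∀ k, c k = 0 ↔ k = i ∨ k = j := by
    intro k
    rw [← hI]
    by_cases h : k ∈ I
    · simp [c, h, Fin.succ_ne_zero]
    · simp [c, h]
  refine ⟨c, h1, fun k => ?_, fun a b hab => ?_⟩
  · have h : I.orderEmbOfFin rfl k ∈ I := I.orderEmbOfFin_mem rfl k
    have e : (⟨I.orderEmbOfFin rfl k, h⟩ : I) = I.orderIsoOfFin rfl k := rfl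
    simp only [c]
    refine (dif_pos h).trans ?_
    rw [e, OrderIso.symm_apply_apply]
  · by_cases ha : a ∈ I
    · by_cases hb : b ∈ I
      · simp only [c, dif_pos ha, dif_pos hb, Fin.succ_inj, EmbeddingLike.apply_eq_iff_eq,
          Subtype.mk.injEq] at hab
        exact Or.inl hab
      · simp [c, dif_pos ha, dif_neg hb, Fin.succ_ne_zero] at hab
    · have ha' := (hI a).1 ha
      have hb' := (h1 b).1 (hab ▸ (h1 a).2 ha')
      obtain rfl | rfl := ha' <;> obtain rfl | rfl := hb' <;> tauto

theorem mem_indexList {m : ℕ} (I : Finset (Fin m)) : ∀ a, a ∈ indexList I ↔ a ∈ I := by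
  intro a
  rw [indexList, List.mem_ofFn']
  have := I.range_orderEmbOfFin rfl
  exact (Set.ext_iff.1 this a)

theorem nodup_indexList {m : ℕ} (I : Finset (Fin m)) : (indexList I).Nodup :=
  List.nodup_ofFn.2 (I.orderEmbOfFin rfl).injective

theorem cons_cons_indexList_perm {m : ℕ} {i j : Fin m} (hij : i ≠ j) :
    (i :: j :: indexList ({i, j}ᶜ : Finset (Fin m))).Perm (List.finRange m) := by
  refine (List.perm_ext_iff_of_nodup ?_ (List.nodup_finRange _)).2 fun a => ?_
  · simp [nodup_indexList, mem_indexList, hij]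
  · simp only [List.mem_cons, mem_indexList, Finset.mem_compl, Finset.mem_insert,
      Finset.mem_singleton, List.mem_finRange, iff_true]
    tauto

namespace ChainSplitting

open SuperSym

variable {K L : Type*} [Field K] [CharZero K] [AddCommGroup L] [Module K L]
  {𝓛 : ZMod 2 → Submodule K L} [DirectSum.Decomposition 𝓛] {X : CircleComplex 𝓛}
  (S : ChainSplitting X) {J J' : Type*} [Fintype J] [Fintype J']

/-- The contraction of one edge less. -/
def contractionPred (n : ℕ) (χ : Set (J × J) → K) : SlotSym J 𝓛 →ₗ[K] SymMinus 𝓛 :=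
  match n with
  -- Without edges there is no commutator term, by `edgeOp_zero_mul`.
  | 0 => 0
  | n + 1 => S.contraction n χ

/-- Commuting `b + uB` through the contractions replaces each `H^sym`-edge in turn by an `Ω`-edge.
As `Ω`-contractions commute with `H^sym`-contractions, the new edge can be contracted first, while
the weight still counts it. -/
theorem symDiff_contraction (n : ℕ) (χ : Set (J × J) → K) (z : SlotSym J 𝓛) :
    X.symDiff (S.contraction n χ z) = S.contraction n χ (slotDerivation J X.minusDiff_odd z) +
      ∑ e, S.contractionPred n (fun s => χ (insert e s))
        (slotOp X.Omega_odd X.Omega_symm e z) := by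
  rw [contraction_apply, contraction_apply, CircleComplex.symDiff, derivation_sumHom]
  cases n with
  | zero =>
    have h := LinearMap.congr_fun (edgeOp_zero_mul
      (T := slotOp (J := J) S.homotopySym_even S.homotopySym_symm) χ
      (slotDerivation J X.minusDiff_odd)) z
    simp only [Module.End.mul_apply] at h
    rw [h]
    simp [contractionPred]
  | succ n =>
    have h := LinearMap.congr_fun (edgeOp_succ_mul
      (T := slotOp (J := J) S.homotopySym_even S.homotopySym_symm)
      (Y := slotDerivation J X.minusDiff_odd)
      (Z := fun e => -slotOp X.Omega_odd X.Omega_symm e) (fun e => by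
        ext1 s
        simp only [Module.End.mul_apply, LinearMap.add_apply, LinearMap.neg_apply]
        rw [slotDerivation_slotOp X.minusDiff_odd S.homotopySym_even S.homotopySym_symm X.Omega_odd
          X.Omega_symm (fun i x y hx => S.homotopySym_diff i x y hx)]
        abel) (fun e f => by
        ext1 s
        simp only [Module.End.mul_apply, LinearMap.neg_apply, map_neg]
        refine congrArg _ ((secondOrder_secondOrder _ _ _ _ s).trans ?_)
        rw [mul_zero, sgn_zero, one_smul]
        rfl) n χ) z
    simp only [Module.End.mul_apply, LinearMap.add_apply, LinearMap.sum_apply, LinearMap.neg_apply,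
      map_neg, Finset.sum_neg_distrib] at h
    have h' := (eq_sub_iff_add_eq.2 h.symm).trans (sub_neg_eq_add _ _)
    exact (congrArg (sumHom (minusGrading 𝓛)) h').trans (by rw [map_add, map_sum]; rfl)

theorem mapCoeff_symDiff_hbarSum (n : ℕ → ℕ) (χ : Set (J × J) → K) (z : SlotSeries J 𝓛) :
    SymSeries.mapCoeff X.symDiff (hbarSum (fun l => S.contraction (n l) χ) z) =
      hbarSum (fun l => S.contraction (n l) χ)
        (seriesMap (slotDerivation J X.minusDiff_odd) z) +
      ∑ e, hbarSum (fun l => S.contractionPred (n l) fun s => χ (insert e s))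
        (seriesMap (slotOp X.Omega_odd X.Omega_symm e) z) := by
  refine MvPowerSeries.ext fun k => ?_
  rw [SymSeries.coeff_mapCoeff, map_add, map_sum]
  simp only [coeff_hbarSum, coeff_seriesMap, map_sum, symDiff_contraction, Finset.sum_add_distrib]
  rw [Finset.sum_comm]

variable {m : ℕ} {ε : Fin m → ZMod 2} {x : Fin m → SymSeries 𝓛}

theorem seriesMap_slotDerivation_slotProd (hx : ∀ k, x k ∈ SymSeries.parity 𝓛 (ε k)) :
    seriesMap (slotDerivation (Fin m) X.minusDiff_odd) (slotProd 𝓛 m x) =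
      ∑ i, (∏ k ∈ Finset.Iio i, sgn (ε k)) •
        slotProd 𝓛 m (Function.update x i (SymSeries.mapCoeff X.symDiff (x i))) := by
  rw [slotProd_apply]
  refine (map_ofFn_prod_of_derivation (ε := ε) ?_ fun k w => ?_).trans ?_
  · refine MvPowerSeries.ext fun n => ?_
    rw [coeff_seriesMap, MvPowerSeries.coeff_one, map_zero]
    split_ifs
    · exact derivation_one _
    · exact map_zero _
  · ext n
    rw [coeff_seriesMap, map_add, map_zsmul, MvPowerSeries.coeff_mul, MvPowerSeries.coeff_mul,
      MvPowerSeries.coeff_mul, map_sum, Finset.smul_sum, ← Finset.sum_add_distrib]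
    refine Finset.sum_congr rfl fun p _ => ?_
    rw [coeff_seriesMap, coeff_seriesMap]
    refine (derivation_mul _ _ _).trans ?_
    rw [twist_of_mem_parity 1 (coeff_slotSeries_mem k (hx k) _), one_mul, smul_mul_assoc]
    rfl
  · refine Finset.sum_congr rfl fun i _ => ?_
    rw [slotProd_update]
    congr 4
    exact MvPowerSeries.ext fun n => slotDerivation_slotHom X.minusDiff_odd _ _

theorem slotSeries_mem_radical {J : Type*} [DecidableEq J] {v w u : J} (hv : u ≠ v)
    (hw : u ≠ w) (y : SymSeries 𝓛) :
    slotSeries 𝓛 u y ∈ seriesSubmonoid (radical (piGrading J (minusGrading 𝓛))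
      (slotForm X.Omega (v, w))) := fun _ => slotHom_mem_radical hv hw _

/-- The factors in the other slots lie in the radical of the form, so `Ω` at the pair `(i, i)` acts
on the `i`-th factor alone, as `Δ`. -/
theorem seriesMap_slotOp_diag_slotProd (hx : ∀ k, x k ∈ SymSeries.parity 𝓛 (ε k)) (i : Fin m) :
    seriesMap (slotOp X.Omega_odd X.Omega_symm (i, i)) (slotProd 𝓛 m x) =
      (∏ k ∈ Finset.Iio i, sgn (ε k)) •
        slotProd 𝓛 m (Function.update x i (SymSeries.mapCoeff X.Delta (x i))) := by
  rw [slotProd_apply]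
  refine (map_ofFn_prod_of_local (ε := ε)
    (R := seriesSubmonoid (radical (piGrading (Fin m) (minusGrading 𝓛)) (slotForm X.Omega (i, i))))
    (fun k hk => slotSeries_mem_radical hk hk _) (fun k hk w => ?_) fun w hw => ?_).trans ?_
  · ext n
    rw [coeff_seriesMap, map_zsmul, MvPowerSeries.coeff_mul, MvPowerSeries.coeff_mul, map_sum,
      Finset.smul_sum]
    refine Finset.sum_congr rfl fun p _ => ?_
    refine (secondOrder_radical_mul _ _ (slotHom_mem_radical hk hk _) _).trans ?_
    refine (congrArg (· * _) (twist_of_mem_parity 1 (coeff_slotSeries_mem k (hx k) _))).trans ?_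
    rw [one_mul]
    exact smul_mul_assoc _ _ _
  · ext n
    rw [coeff_seriesMap, MvPowerSeries.coeff_mul, MvPowerSeries.coeff_mul, map_sum]
    exact Finset.sum_congr rfl fun p _ => secondOrder_mul_radical _ _ (hw _) _
  · rw [slotProd_update]
    congr 4
    exact MvPowerSeries.ext fun n => slotOp_slotHom X.Omega_odd X.Omega_symm _ _

/-- A loop leaves connectedness alone and raises the Betti number, hence the factor `ħ`. The lowest
term vanishes: with `m = 0` there is no edge to spare, and otherwise `m - 1` edges cannot connect `m
+ 1` vertices. -/
theorem hbarSum_contractionPred_diag (v : Fin (m + 1)) (z : SlotSeries (Fin (m + 1)) 𝓛) :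
    hbarSum (fun l => S.contractionPred (l + m)
      fun s => connWeight K (Fin (m + 1)) (insert (v, v) s)) z =
    (MvPowerSeries.X 0 : Scalars K) •
      hbarSum (fun l => S.contraction (l + m) (connWeight K (Fin (m + 1)))) z := by
  have h : (fun s => connWeight K (Fin (m + 1)) (insert (v, v) s)) = connWeight K (Fin (m + 1)) :=
    funext fun s => connWeight_congr (edgesConnect_insert_diag v s)
  rw [h, hbarSum_succ]
  · congr 3
    funext l
    rw [Nat.add_right_comm]
    rfl
  · rw [zero_add]
    cases m with
    | zero => rfl
    | succ m =>
      rw [contractionPred, contraction, edgeOp_connWeight_eq_zero, LinearMap.comp_zero]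
      simp

/-- Contracting an edge between two different vertices. -/
theorem hbarSum_contractionPred_offDiag {x : Fin (m + 1) → SymSeries 𝓛}
    {ε : Fin (m + 1) → ZMod 2}
    (hx : ∀ k, x k ∈ SymSeries.parity 𝓛 (ε k)) {i j : Fin (m + 1)} (hij : i < j) :
    hbarSum (fun l => S.contractionPred (l + m)
        fun s => connWeight K (Fin (m + 1)) (insert (i, j) s))
          (seriesMap (slotOp X.Omega_odd X.Omega_symm (i, j)) (slotProd 𝓛 (m + 1) x)) +
      hbarSum (fun l => S.contractionPred (l + m)
        fun s => connWeight K (Fin (m + 1)) (insert (j, i) s))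
          (seriesMap (slotOp X.Omega_odd X.Omega_symm (j, i)) (slotProd 𝓛 (m + 1) x)) =
      koszulSign ε (i :: j :: indexList {i, j}ᶜ) •
        S.component (({i, j}ᶜ : Finset (Fin (m + 1))).card + 1)
          (Fin.cons (X.dgla.bracket (x i) (x j)) (subfamily x {i, j}ᶜ)) := by
  have hex := exists_collapse i j
  set I : Finset (Fin (m + 1)) := {i, j}ᶜ with hI
  obtain ⟨c, hc0, hcs, hc⟩ := hex
  have hm : m = I.card + 1 := by
    have := Finset.card_compl_add_card ({i, j} : Finset (Fin (m + 1)))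
    rw [Finset.card_pair hij.ne, Fintype.card_fin] at this
    lia
  have hsurj : Function.Surjective c := fun k => by
    refine Fin.cases ⟨i, (hc0 i).2 (Or.inl rfl)⟩ (fun k => ⟨_, hcs k⟩) k
  have hswap : (fun s => connWeight K (Fin (m + 1)) (insert (j, i) s)) =
      fun s => connWeight K (Fin (m + 1)) (insert (i, j) s) :=
    funext fun s => connWeight_congr (edgesConnect_insert_swap j i s)
  -- Collapsing the `Ω`-edge removes one edge and one vertex, so the index `l` of the power of `ħ`
  -- is unchanged.
  have hpush : ∀ z : SlotSeries (Fin (m + 1)) 𝓛,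
      hbarSum (fun l => S.contractionPred (l + m)
        fun s => connWeight K (Fin (m + 1)) (insert (i, j) s)) z =
      hbarSum (fun l => S.contraction (l + I.card) (connWeight K (Fin (I.card + 1))))
        (MvPowerSeries.map (pushHom (minusGrading 𝓛) c).toRingHom z) := by
    intro z
    refine MvPowerSeries.ext fun n => ?_
    rw [coeff_hbarSum, coeff_hbarSum]
    refine Finset.sum_congr rfl fun l _ => ?_
    refine Eq.trans ?_ (S.contraction_pushHom c _ _ _).symm
    rw [show l + m = l + I.card + 1 by lia, contractionPred]
    congr 2
    funext s
    exact connWeight_congr (edgesConnect_insert_iff hsurj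
      (((hc0 i).2 (Or.inl rfl)).trans ((hc0 j).2 (Or.inr rfl)).symm) hc s)
  -- The factors `i` and `j` are moved to the front; this is the Koszul sign of the bracket term.
  have hz : koszulSign ε (i :: j :: indexList I) • (slotSeries 𝓛 i (x i) * slotSeries 𝓛 j (x j) *
      ((indexList I).map fun v => slotSeries 𝓛 v (x v)).prod) = slotProd 𝓛 (m + 1) x := by
    rw [slotProd_apply, ← koszulSign_smul_prod (slotSeries_mul_comm hx)
      (cons_cons_indexList_perm hij.ne), List.map_cons, List.map_cons, List.prod_cons,
      List.prod_cons, mul_assoc]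
  have hrest : ((indexList I).map fun v => slotSeries 𝓛 v (x v)).prod ∈
      seriesSubmonoid (radical (piGrading (Fin (m + 1)) (minusGrading 𝓛))
        (slotForm X.Omega (i, j))) := by
    refine list_prod_mem fun y hy => ?_
    obtain ⟨k, hk, rfl⟩ := List.mem_map.1 hy
    rw [mem_indexList, hI, Finset.mem_compl, Finset.mem_insert, Finset.mem_singleton,
      not_or] at hk
    exact slotSeries_mem_radical hk.1 hk.2 _
  have hbr : MvPowerSeries.map (pushHom (minusGrading 𝓛) c).toRingHom
      (seriesMap (slotOp X.Omega_odd X.Omega_symm (i, j) + slotOp X.Omega_odd X.Omega_symm (j, i))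
        (slotSeries 𝓛 i (x i) * slotSeries 𝓛 j (x j))) =
      slotSeries 𝓛 0 (X.dgla.bracket (x i) (x j)) := by
    refine MvPowerSeries.ext fun n => ?_
    rw [MvPowerSeries.coeff_map, coeff_seriesMap, MvPowerSeries.coeff_mul, coeff_slotSeries,
      CircleComplex.dgla_bracket_apply, map_sub (MvPowerSeries.coeff n),
      map_sub (MvPowerSeries.coeff n), SymSeries.coeff_mapCoeff,
      MvPowerSeries.coeff_mul, MvPowerSeries.coeff_mul, MvPowerSeries.coeff_mul, map_sum, map_sum,
      map_sum X.Delta, ← Finset.sum_sub_distrib, ← Finset.sum_sub_distrib, map_sum]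
    refine Finset.sum_congr rfl fun p _ => ?_
    exact pushHom_slotOp_bracket X.Omega_odd X.Omega_symm hij.ne hc0 _ _
  -- All the other slots are constants for the two operators, so they split off on the right.
  have hmul : seriesMap (slotOp X.Omega_odd X.Omega_symm (i, j) +
      slotOp X.Omega_odd X.Omega_symm (j, i)) (slotSeries 𝓛 i (x i) * slotSeries 𝓛 j (x j) *
        ((indexList I).map fun v => slotSeries 𝓛 v (x v)).prod) =
      seriesMap (slotOp X.Omega_odd X.Omega_symm (i, j) + slotOp X.Omega_odd X.Omega_symm (j, i))
        (slotSeries 𝓛 i (x i) * slotSeries 𝓛 j (x j)) *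
        ((indexList I).map fun v => slotSeries 𝓛 v (x v)).prod := by
    rw [slotOp_swap X.Omega_odd X.Omega_symm j i]
    ext n
    rw [coeff_seriesMap, MvPowerSeries.coeff_mul, MvPowerSeries.coeff_mul, map_sum]
    refine Finset.sum_congr rfl fun p _ => ?_
    rw [coeff_seriesMap, LinearMap.add_apply, LinearMap.add_apply, add_mul]
    exact congrArg (fun a => a + a) (secondOrder_mul_radical _ _ (hrest _) _)
  have hlist : MvPowerSeries.map (pushHom (minusGrading 𝓛) c).toRingHom
      ((indexList I).map fun v => slotSeries 𝓛 v (x v)).prod =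
      (List.ofFn fun k : Fin I.card => slotSeries 𝓛 k.succ (subfamily x I k)).prod := by
    rw [map_list_prod, List.map_map, indexList, List.map_ofFn]
    congr 2
    funext k
    refine MvPowerSeries.ext fun n => (pushHom_slotHom c _ _).trans ?_
    rw [hcs]
    rfl
  have hadd : ∀ z : SlotSeries (Fin (m + 1)) 𝓛,
      seriesMap (slotOp X.Omega_odd X.Omega_symm (i, j)) z +
        seriesMap (slotOp X.Omega_odd X.Omega_symm (j, i)) z =
      seriesMap (slotOp X.Omega_odd X.Omega_symm (i, j) +
        slotOp X.Omega_odd X.Omega_symm (j, i)) z := fun z => rfl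
  rw [hswap, ← map_add, hadd, ← hz, map_zsmul, map_zsmul, hpush, hmul, map_mul, hbr, hlist,
    component_succ_apply, slotProd_apply, List.ofFn_succ, List.prod_cons]
  rfl

/-- Sort the result of commuting `b + uB` through: the derivation acts on the arguments, `Ω`-loops
supply the summand `ħΔ` of the differential of `𝔥`, and the `Ω`-edges `(i, j)` and `(j, i)` together
supply `{x_i, x_j}`. -/
theorem component_map_bar (m : ℕ) (ε : Fin (m + 1) → ZMod 2) (x : Fin (m + 1) → SymSeries 𝓛)
    (hx : ∀ k, x k ∈ SymSeries.parity 𝓛 (ε k)) :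
    SymSeries.mapCoeff X.symDiff (S.component (m + 1) x) =
      ∑ i : Fin (m + 1),
        (∏ k ∈ Finset.Iio i, sgn (ε k)) •
          S.component (m + 1) (Function.update x i (X.dgla.d (x i))) +
      ∑ i : Fin (m + 1), ∑ j ∈ Finset.Ioi i,
        koszulSign ε (i :: j :: indexList {i, j}ᶜ) •
          S.component (({i, j}ᶜ : Finset (Fin (m + 1))).card + 1)
            (Fin.cons (X.dgla.bracket (x i) (x j)) (subfamily x {i, j}ᶜ)) := by
  rw [component_succ_apply, mapCoeff_symDiff_hbarSum S (fun l => l + m), sum_pairs, ← add_assoc]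
  congr 1
  · rw [seriesMap_slotDerivation_slotProd hx, map_sum, ← Finset.sum_add_distrib]
    refine Finset.sum_congr rfl fun i _ => ?_
    rw [hbarSum_contractionPred_diag, seriesMap_slotOp_diag_slotProd hx, map_zsmul, map_zsmul,
      ← component_succ_apply, ← component_succ_apply, CircleComplex.dgla_d_apply,
      MultilinearMap.map_update_add, MultilinearMap.map_update_smul, smul_add]
    rw [smul_comm]
  · exact Finset.sum_congr rfl fun i _ => Finset.sum_congr rfl fun j hj =>
      S.hbarSum_contractionPred_offDiag hx (Finset.mem_Ioi.1 hj)

end ChainSplitting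

/-! ## Values of contractions -/

section ContractionValue

/-- The list of the members of a list of pairs. -/
def pairEntries {α : Type*} (P : List (α × α)) : List α := P.flatMap fun p => [p.1, p.2]

theorem pairEntries_cons {α : Type*} (p : α × α) (P : List (α × α)) :
    pairEntries (p :: P) = p.1 :: p.2 :: pairEntries P := rfl

variable {K A : Type*} [Field K] [Ring A] [Algebra K A] {N : ℕ} {ε : Fin N → ZMod 2}

/-- The value of the contraction of the pairs in `P` by `q`, with the elements in `l` left over. -/
def contractionValue (ε : Fin N → ZMod 2) (q : Fin N → Fin N → K) (y : Fin N → A)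
    (P : List (Fin N × Fin N)) (l : List (Fin N)) : A :=
  koszulSign ε (pairEntries P ++ l) • (P.map fun p => q p.1 p.2).prod • (l.map y).prod

variable {q : Fin N → Fin N → K} {y : Fin N → A}

theorem contractionValue_perm_right (hy : ∀ a b, y a * y b = sgn (ε a * ε b) • (y b * y a))
    (P : List (Fin N × Fin N)) {l l' : List (Fin N)} (h : l.Perm l') :
    contractionValue ε q y P l = contractionValue ε q y P l' := by
  have := koszulSign_append_smul_prod hy h (pairEntries P)
  rw [contractionValue, smul_comm, this, smul_comm, contractionValue]

theorem koszulSign_swap_pair {a b c d : Fin N} (hac : a ≠ c) (had : a ≠ d) (hbc : b ≠ c)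
    (hbd : b ≠ d) (l₀ l : List (Fin N)) : koszulSign ε (l₀ ++ a :: b :: c :: d :: l) =
      sgn ((ε a + ε b) * (ε c + ε d)) * koszulSign ε (l₀ ++ c :: d :: a :: b :: l) := by
  have h1 := koszulSign_swap (ε := ε) hbc (l₀ ++ [a]) (d :: l)
  have h2 := koszulSign_swap (ε := ε) hbd (l₀ ++ [a, c]) l
  have h3 := koszulSign_swap (ε := ε) hac l₀ (d :: b :: l)
  have h4 := koszulSign_swap (ε := ε) had (l₀ ++ [c]) (b :: l)
  simp only [List.append_assoc, List.cons_append, List.nil_append] at h1 h2 h3 h4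
  rw [h1, h2, h3, h4, add_mul, mul_add, mul_add, sgn_add, sgn_add, sgn_add]
  ring

/-- A contraction is nonzero only on pairs of even total parity, and such pairs move past each other
without a sign. -/
theorem koszulSign_smul_perm
    (hq : ∀ a b, ε a + ε b ≠ 0 → q a b = 0) {P P' : List (Fin N × Fin N)} (h : P.Perm P')
    (hP : (pairEntries P).Nodup) (l₀ l : List (Fin N)) :
    koszulSign ε (l₀ ++ (pairEntries P ++ l)) • (P.map fun p => q p.1 p.2).prod =
      koszulSign ε (l₀ ++ (pairEntries P' ++ l)) • (P'.map fun p => q p.1 p.2).prod := by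
  induction h generalizing l₀ with
  | nil => rfl
  | cons p _ ih =>
    have := ih (by simp only [pairEntries_cons, List.nodup_cons] at hP; exact hP.2.2)
      (l₀ ++ [p.1, p.2])
    simp only [List.append_assoc, List.cons_append, List.nil_append] at this
    simp only [pairEntries_cons, List.cons_append, List.map_cons, List.prod_cons]
    rw [← mul_smul_comm, this, mul_smul_comm]
  | swap p r P =>
    simp only [pairEntries_cons, List.nodup_cons, List.mem_cons, not_or] at hP
    simp only [pairEntries_cons, List.cons_append, List.map_cons, List.prod_cons]
    rw [koszulSign_swap_pair hP.1.2.1 hP.1.2.2.1 hP.2.1.1 hP.2.1.2.1, mul_left_comm]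
    by_cases hr : ε r.1 + ε r.2 = 0
    · rw [hr, zero_mul, sgn_zero, one_mul]
    · rw [hq _ _ hr, zero_mul, mul_zero, smul_zero, smul_zero]
  | trans h1 _ ih1 ih2 =>
    exact (ih1 hP l₀).trans (ih2 ((h1.flatMap_right _).nodup_iff.1 hP) l₀)

theorem contractionValue_perm_left
    (hq : ∀ a b, ε a + ε b ≠ 0 → q a b = 0) {P P' : List (Fin N × Fin N)} (h : P.Perm P')
    (hP : (pairEntries P).Nodup) (l : List (Fin N)) :
    contractionValue ε q y P l = contractionValue ε q y P' l := by
  have := koszulSign_smul_perm hq h hP [] l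
  rw [contractionValue, ← smul_assoc, contractionValue, ← smul_assoc]
  exact congrArg (· • _) this

/-- Reversing a pair changes the Koszul sign by exactly the factor that graded symmetry of `q`
returns. -/
theorem koszulSign_smul_map_swap (hs : ∀ a b, q a b = sgn (ε a * ε b) • q b a)
    {f : Fin N × Fin N → Fin N × Fin N} (hf : ∀ p, f p = p ∨ f p = p.swap)
    {P : List (Fin N × Fin N)} (hP : (pairEntries P).Nodup) (l₀ l : List (Fin N)) :
    koszulSign ε (l₀ ++ (pairEntries P ++ l)) • (P.map fun p => q p.1 p.2).prod =
      koszulSign ε (l₀ ++ (pairEntries (P.map f) ++ l)) •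
        ((P.map f).map fun p => q p.1 p.2).prod := by
  induction P generalizing l₀ with
  | nil => rfl
  | cons p P ih =>
    simp only [pairEntries_cons, List.nodup_cons, List.mem_cons, not_or] at hP
    have := ih hP.2.2 (l₀ ++ [(f p).1, (f p).2])
    simp only [List.append_assoc, List.cons_append, List.nil_append] at this
    simp only [pairEntries_cons, List.cons_append, List.map_cons, List.prod_cons]
    rw [← mul_smul_comm (koszulSign ε (l₀ ++ (f p).1 :: _)), ← this]
    obtain h | h := hf p
    · rw [h, mul_smul_comm]
    · rw [h, Prod.fst_swap, Prod.snd_swap, koszulSign_swap hP.1.1, hs p.1 p.2, smul_mul_assoc,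
        smul_smul, mul_smul_comm]
      congr 1
      linear_combination koszulSign ε (l₀ ++ p.2 :: p.1 :: (pairEntries P ++ l)) *
        sgn_mul_self (ε p.1 * ε p.2)

theorem contractionValue_map_swap (hs : ∀ a b, q a b = sgn (ε a * ε b) • q b a)
    {f : Fin N × Fin N → Fin N × Fin N} (hf : ∀ p, f p = p ∨ f p = p.swap)
    {P : List (Fin N × Fin N)} (hP : (pairEntries P).Nodup) (l : List (Fin N)) :
    contractionValue ε q y P l = contractionValue ε q y (P.map f) l := by
  have := koszulSign_smul_map_swap hs hf hP [] l
  rw [contractionValue, ← smul_assoc, contractionValue, ← smul_assoc]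
  exact congrArg (· • _) this

theorem koszulSign_cons_of_lt {a : Fin N} {l : List (Fin N)} (h : ∀ b ∈ l, a < b) :
    koszulSign ε (a :: l) = koszulSign ε l := by
  rw [koszulSign_cons, List.prod_eq_one, one_mul]
  intro r hr
  obtain ⟨b, hb, rfl⟩ := List.mem_map.1 hr
  exact if_neg (h b hb).le.not_gt

/-- The smallest index stands in front without a sign, and it gets there past pairs that are even
whenever they contribute. -/
theorem contractionValue_cons_right
    (hq : ∀ a b, ε a + ε b ≠ 0 → q a b = 0) {a : Fin N} {P : List (Fin N × Fin N)} {l : List (Fin N)}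
    (h : ∀ b ∈ pairEntries P ++ l, a < b) :
    contractionValue ε q y P (a :: l) = y a * contractionValue ε q y P l := by
  have key : ∀ (P : List (Fin N × Fin N)) (l₀ : List (Fin N)), (∀ b ∈ pairEntries P, a < b) →
      koszulSign ε (l₀ ++ (pairEntries P ++ a :: l)) • (P.map fun p => q p.1 p.2).prod =
        koszulSign ε (l₀ ++ a :: (pairEntries P ++ l)) • (P.map fun p => q p.1 p.2).prod := by
    intro P
    induction P with
    | nil => intro l₀ _; rfl
    | cons p P ih =>
      intro l₀ hP
      simp only [pairEntries_cons, List.mem_cons, forall_eq_or_imp] at hP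
      have := ih (l₀ ++ [p.1, p.2]) hP.2.2
      simp only [List.append_assoc, List.cons_append, List.nil_append] at this
      simp only [pairEntries_cons, List.cons_append, List.map_cons, List.prod_cons]
      rw [← mul_smul_comm, this]
      have h1 := koszulSign_swap (ε := ε) hP.2.1.ne' (l₀ ++ [p.1]) (pairEntries P ++ l)
      simp only [List.append_assoc, List.cons_append, List.nil_append] at h1
      rw [h1, koszulSign_swap hP.1.ne', ← mul_assoc, ← sgn_add, ← add_mul, add_comm (ε p.2)]
      by_cases hp : ε p.1 + ε p.2 = 0
      · rw [hp, zero_mul, sgn_zero, one_mul, mul_smul_comm]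
      · rw [hq _ _ hp, zero_mul, zero_mul, smul_zero]
  have := key P [] fun b hb => h b (List.mem_append_left _ hb)
  rw [List.nil_append, List.nil_append, koszulSign_cons_of_lt h] at this
  rw [contractionValue, ← smul_assoc, this, contractionValue, List.map_cons, List.prod_cons,
    mul_smul_comm, mul_smul_comm, smul_assoc]

/-- In front position `a` produces no sign, and `b` one for each smaller remaining index. That
product does not depend on the order, so it can be taken over any rearrangement `t`. -/
theorem contractionValue_cons_left {a b : Fin N} {P : List (Fin N × Fin N)} {l t : List (Fin N)}
    (ht : (pairEntries P ++ l).Perm t) (hb : a < b) (h : ∀ c ∈ t, a < c) :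
    contractionValue ε q y ((a, b) :: P) l =
      ((t.map fun c => if c < b then sgn (ε b * ε c) else 1).prod • q a b) •
        contractionValue ε q y P l := by
  rw [contractionValue, pairEntries_cons, List.cons_append, List.cons_append,
    koszulSign_cons_of_lt, koszulSign_cons, (ht.map _).prod_eq, contractionValue, List.map_cons,
    List.prod_cons, mul_smul, mul_smul]
  · rw [smul_comm (koszulSign _ _) (q a b), smul_assoc]
  · intro c hc
    obtain rfl | hc := List.mem_cons.1 hc
    · exact hb
    · exact h c (ht.mem_iff.1 hc)

end ContractionValue

/-! ## Involutions -/

section Involutions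

variable {N : ℕ}

/-- The involutions of the elements of a list. -/
def involutions (s : List (Fin N)) : Finset (Equiv.Perm (Fin N)) :=
  {τ | (∀ h, τ (τ h) = h) ∧ ∀ h, h ∉ s → τ h = h}

theorem mem_involutions {s : List (Fin N)} {τ : Equiv.Perm (Fin N)} :
    τ ∈ involutions s ↔ (∀ h, τ (τ h) = h) ∧ ∀ h, h ∉ s → τ h = h := by
  simp [involutions]

theorem involutions_apply_mem {s : List (Fin N)} {τ : Equiv.Perm (Fin N)} (hτ : τ ∈ involutions s)
    {h : Fin N} (hh : h ∈ s) : τ h ∈ s := by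
  rw [mem_involutions] at hτ
  by_contra h1
  have h2 := hτ.2 _ h1
  rw [hτ.1] at h2
  exact h1 (h2 ▸ hh)

theorem swap_mul_involutions {a b : Fin N} {t : List (Fin N)} (ha : a ∉ t) (ht : t.Nodup)
    {τ : Equiv.Perm (Fin N)} (hτ : τ ∈ involutions (t.erase b)) :
    (Equiv.swap a b * τ) a = b ∧ (Equiv.swap a b * τ) b = a ∧
      ∀ h, h ≠ a → h ≠ b → (Equiv.swap a b * τ) h = τ h := by
  rw [mem_involutions] at hτ
  have h1 : τ a = a := hτ.2 a fun h => ha (List.mem_of_mem_erase h)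
  have h2 : τ b = b := hτ.2 b ht.not_mem_erase
  refine ⟨by simp [h1], by simp [h2], fun h hha hhb => ?_⟩
  rw [Equiv.Perm.mul_apply, Equiv.swap_apply_of_ne_of_ne]
  · exact fun h3 => hha (τ.injective (h3.trans h1.symm))
  · exact fun h3 => hhb (τ.injective (h3.trans h2.symm))

/-- An involution either fixes `a` or exchanges it with some `b`; in the latter case composing with
the transposition leaves an involution of the rest. This is the recursion that Wick's theorem
follows. -/
theorem sum_involutions_cons {M : Type*} [AddCommMonoid M] {a : Fin N} {t : List (Fin N)}
    (ha : a ∉ t) (ht : t.Nodup) (f : Equiv.Perm (Fin N) → M) :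
    ∑ τ ∈ involutions (a :: t), f τ = ∑ τ ∈ involutions t, f τ +
      ∑ b ∈ t.toFinset, ∑ τ ∈ involutions (t.erase b), f (Equiv.swap a b * τ) := by
  rw [← Finset.sum_fiberwise_of_maps_to (g := fun τ : Equiv.Perm (Fin N) => τ a)
    (t := (a :: t).toFinset) (fun τ hτ => List.mem_toFinset.2
      (involutions_apply_mem hτ List.mem_cons_self)), List.toFinset_cons,
    Finset.sum_insert (by simpa using ha)]
  congr 1
  · refine Finset.sum_congr ?_ fun _ _ => rfl
    ext τ
    simp only [Finset.mem_filter, mem_involutions, List.mem_cons, not_or]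
    constructor
    · rintro ⟨⟨h1, h2⟩, h3⟩
      refine ⟨h1, fun h hh => ?_⟩
      by_cases hha : h = a
      · rw [hha, h3]
      · exact h2 h ⟨hha, hh⟩
    · rintro ⟨h1, h2⟩
      exact ⟨⟨h1, fun h hh => h2 h hh.2⟩, h2 a ha⟩
  · refine Finset.sum_congr rfl fun b hb => ?_
    rw [List.mem_toFinset] at hb
    have hab : a ≠ b := fun h => ha (h ▸ hb)
    refine Finset.sum_nbij' (fun τ => Equiv.swap a b * τ) (fun τ => Equiv.swap a b * τ) ?_ ?_ ?_ ?_
      ?_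
    · intro τ hτ
      obtain ⟨hτ, hτa⟩ := Finset.mem_filter.1 hτ
      rw [mem_involutions] at hτ
      obtain ⟨h1, h2⟩ := hτ
      have hτb : τ b = a := by rw [← hτa, h1]
      have e1 : (Equiv.swap a b * τ) a = a := by simp [hτa]
      have e2 : (Equiv.swap a b * τ) b = b := by simp [hτb]
      have e3 : ∀ h, h ≠ a → h ≠ b → (Equiv.swap a b * τ) h = τ h := by
        intro h hha hhb
        rw [Equiv.Perm.mul_apply, Equiv.swap_apply_of_ne_of_ne]
        · exact fun h3 => hhb (τ.injective (h3.trans hτb.symm))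
        · exact fun h3 => hha (τ.injective (h3.trans hτa.symm))
      rw [mem_involutions]
      refine ⟨fun h => ?_, fun h hh => ?_⟩
      · by_cases hha : h = a
        · rw [hha, e1, e1]
        by_cases hhb : h = b
        · rw [hhb, e2, e2]
        rw [e3 h hha hhb, e3, h1]
        · exact fun h3 => hhb (τ.injective (h3.trans hτb.symm))
        · exact fun h3 => hha (τ.injective (h3.trans hτa.symm))
      · by_cases hha : h = a
        · rw [hha, e1]
        by_cases hhb : h = b
        · rw [hhb, e2]
        rw [e3 h hha hhb]
        refine h2 h fun h4 => ?_
        obtain h4 | h4 := List.mem_cons.1 h4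
        · exact hha h4
        · exact hh ((List.mem_erase_of_ne hhb).2 h4)
    · intro τ hτ
      obtain ⟨e1, e2, e3⟩ := swap_mul_involutions ha ht hτ
      rw [mem_involutions] at hτ
      rw [Finset.mem_filter, mem_involutions]
      have h1 : τ a = a := hτ.2 a fun h => ha (List.mem_of_mem_erase h)
      have h2 : τ b = b := hτ.2 b ht.not_mem_erase
      refine ⟨⟨fun h => ?_, fun h hh => ?_⟩, e1⟩
      · by_cases hha : h = a
        · rw [hha, e1, e2]
        by_cases hhb : h = b
        · rw [hhb, e2, e1]
        rw [e3 h hha hhb, e3, hτ.1]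
        · exact fun h3 => hha (τ.injective (h3.trans h1.symm))
        · exact fun h3 => hhb (τ.injective (h3.trans h2.symm))
      · rw [List.mem_cons, not_or] at hh
        rw [e3 h hh.1 fun h3 => hh.2 (h3 ▸ hb)]
        exact hτ.2 h fun h3 => hh.2 (List.mem_of_mem_erase h3)
    · intro τ _
      simp [← mul_assoc]
    · intro τ _
      simp [← mul_assoc]
    · intro τ _
      simp [← mul_assoc]

/-- The two-element orbits of an involution. -/
def orbitPairs (s : List (Fin N)) (τ : Equiv.Perm (Fin N)) : List (Fin N × Fin N) :=
  (s.filter fun h => h < τ h).map fun h => (h, τ h)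

/-- The fixed points of an involution. -/
def fixedList (s : List (Fin N)) (τ : Equiv.Perm (Fin N)) : List (Fin N) :=
  s.filter fun h => τ h = h

theorem mem_pairEntries_orbitPairs {s : List (Fin N)} {τ : Equiv.Perm (Fin N)} {h : Fin N} :
    h ∈ pairEntries (orbitPairs s τ) ↔ ∃ k ∈ s, k < τ k ∧ (h = k ∨ h = τ k) := by
  simp only [pairEntries, orbitPairs, List.mem_flatMap, List.mem_map, List.mem_filter,
    decide_eq_true_eq, List.mem_cons, List.not_mem_nil, or_false]
  constructor
  · rintro ⟨_, ⟨k, ⟨hk, hk'⟩, rfl⟩, h⟩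
    exact ⟨k, hk, hk', h⟩
  · rintro ⟨k, hk, hk', h⟩
    exact ⟨_, ⟨k, ⟨hk, hk'⟩, rfl⟩, h⟩

theorem nodup_pairEntries_orbitPairs {s : List (Fin N)} (hs : s.Nodup) {τ : Equiv.Perm (Fin N)}
    (hτ : ∀ h, τ (τ h) = h) : (pairEntries (orbitPairs s τ)).Nodup := by
  rw [pairEntries, orbitPairs, List.flatMap_map, List.nodup_flatMap]
  constructor
  · intro h hh
    simpa using (of_decide_eq_true (List.mem_filter.1 hh).2).ne
  · refine (hs.filter _).pairwise_of_forall_ne fun a ha b hb hab => ?_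
    have ha' := of_decide_eq_true (List.mem_filter.1 ha).2
    have hb' := of_decide_eq_true (List.mem_filter.1 hb).2
    intro c hca hcb
    simp only [List.mem_cons, List.not_mem_nil, or_false] at hca hcb
    obtain rfl | rfl := hca
    · obtain h | h := hcb
      · exact hab h
      · rw [h, hτ] at ha'
        exact lt_asymm ha' hb'
    · obtain h | h := hcb
      · rw [← h, hτ] at hb'
        exact lt_asymm ha' hb'
      · exact hab (τ.injective h)

theorem orbitPairs_append_perm {s : List (Fin N)} (hs : s.Nodup) {τ : Equiv.Perm (Fin N)}
    (hτ : τ ∈ involutions s) : (pairEntries (orbitPairs s τ) ++ fixedList s τ).Perm s := by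
  have hτ' := (mem_involutions.1 hτ).1
  refine (List.perm_ext_iff_of_nodup ?_ hs).2 fun h => ?_
  · refine (nodup_pairEntries_orbitPairs hs hτ').append (hs.filter _) fun h h1 h2 => ?_
    obtain ⟨k, -, hk, h1⟩ := mem_pairEntries_orbitPairs.1 h1
    have h3 := of_decide_eq_true (List.mem_filter.1 h2).2
    obtain rfl | rfl := h1
    · exact hk.ne' h3
    · rw [hτ'] at h3
      exact hk.ne h3
  · rw [List.mem_append, mem_pairEntries_orbitPairs, fixedList, List.mem_filter, decide_eq_true_eq]
    constructor
    · rintro (⟨k, hk, -, rfl | rfl⟩ | h)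
      · exact hk
      · exact involutions_apply_mem hτ hk
      · exact h.1
    · intro hh
      obtain h1 | h1 | h1 := lt_trichotomy h (τ h)
      · exact Or.inl ⟨h, hh, h1, Or.inl rfl⟩
      · exact Or.inr ⟨hh, h1.symm⟩
      · exact Or.inl ⟨τ h, involutions_apply_mem hτ hh, by rwa [hτ'], Or.inr (hτ' h).symm⟩

theorem orbitPairs_cons_of_eq {a : Fin N} {t : List (Fin N)} {τ : Equiv.Perm (Fin N)}
    (h : τ a = a) : orbitPairs (a :: t) τ = orbitPairs t τ := by
  simp [orbitPairs, h]

theorem fixedList_cons_of_eq {a : Fin N} {t : List (Fin N)} {τ : Equiv.Perm (Fin N)}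
    (h : τ a = a) : fixedList (a :: t) τ = a :: fixedList t τ := by
  simp [fixedList, h]

theorem orbitPairs_cons_swap {a b : Fin N} {t : List (Fin N)} (ha : ∀ c ∈ t, a < c) (ht : t.Nodup)
    (hb : b ∈ t) {τ : Equiv.Perm (Fin N)} (hτ : τ ∈ involutions (t.erase b)) :
    orbitPairs (a :: t) (Equiv.swap a b * τ) = (a, b) :: orbitPairs (t.erase b) τ := by
  obtain ⟨e1, e2, e3⟩ := swap_mul_involutions (fun h => (ha a h).false) ht hτ
  rw [orbitPairs, List.filter_cons_of_pos (by rw [e1]; exact decide_eq_true (ha b hb)),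
    List.map_cons, e1, orbitPairs, ht.erase_eq_filter, List.filter_filter]
  congr 1
  have h1 : t.filter (fun h => h < (Equiv.swap a b * τ) h) =
      t.filter fun h => decide (h < τ h) && (h != b) := by
    refine List.filter_congr fun h hh => ?_
    by_cases hhb : h = b
    · subst hhb
      rw [e2]
      simp [(ha _ hh).le]
    · rw [e3 h (ha h hh).ne' hhb]
      simp [hhb]
  rw [h1]
  refine List.map_congr_left fun h hh => ?_
  have hh' := List.mem_filter.1 hh
  simp only [Bool.and_eq_true, bne_iff_ne] at hh'
  rw [e3 h (ha h hh'.1).ne' hh'.2.2]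

theorem fixedList_cons_swap {a b : Fin N} {t : List (Fin N)} (ha : ∀ c ∈ t, a < c) (ht : t.Nodup)
    (hb : b ∈ t) {τ : Equiv.Perm (Fin N)} (hτ : τ ∈ involutions (t.erase b)) :
    fixedList (a :: t) (Equiv.swap a b * τ) = fixedList (t.erase b) τ := by
  obtain ⟨e1, e2, e3⟩ := swap_mul_involutions (fun h => (ha a h).false) ht hτ
  rw [fixedList, List.filter_cons_of_neg (by rw [e1]; simpa using (ha b hb).ne'),
    fixedList, ht.erase_eq_filter, List.filter_filter]
  refine List.filter_congr fun h hh => ?_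
  by_cases hhb : h = b
  · subst hhb
    rw [e2]
    simp [(ha _ hh).ne]
  · rw [e3 h (ha h hh).ne' hhb]
    simp [hhb]

end Involutions

/-! ## Wick's theorem -/

namespace SuperSym

variable {K : Type*} [Field K] {V : Type*} [AddCommGroup V] [Module K V]
  {𝒱 : ZMod 2 → Submodule K V} [DirectSum.Decomposition 𝒱] {N : ℕ} {ε : Fin N → ZMod 2}

theorem contract_list_prod {x : Fin N → V} (hx : ∀ k, x k ∈ 𝒱 (ε k)) {p : ZMod 2} {φ : V →ₗ[K] K}
    (hφ : IsHom 𝒱 p φ) {t : List (Fin N)} (ht : t.Pairwise (· < ·)) :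
    contract 𝒱 φ (t.map fun k => ι 𝒱 (x k)).prod = ∑ b ∈ t.toFinset,
      ((t.map fun c => if c < b then sgn (ε b * ε c) else 1).prod • φ (x b)) •
        ((t.erase b).map fun k => ι 𝒱 (x k)).prod := by
  induction ht with
  | nil => simp [contract_one]
  | @cons a t ha ht ih =>
    have hat : a ∉ t.toFinset := fun h => (ha a (List.mem_toFinset.1 h)).false
    rw [List.map_cons, List.prod_cons, isHom_contract_ι_mul hφ (hx a), ih, List.toFinset_cons,
      Finset.sum_insert hat]
    congr 1
    · have h1 : ((a :: t).map fun c => if c < a then sgn (ε a * ε c) else 1).prod = 1 := by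
        refine List.prod_eq_one fun r hr => ?_
        obtain ⟨c, hc, rfl⟩ := List.mem_map.1 hr
        obtain rfl | hc := List.mem_cons.1 hc
        · exact if_neg (lt_irrefl _)
        · exact if_neg (ha c hc).le.not_gt
      rw [List.erase_cons_head, h1, one_smul]
    · rw [Finset.mul_sum, Finset.smul_sum]
      refine Finset.sum_congr rfl fun b hb => ?_
      have hab := ha b (List.mem_toFinset.1 hb)
      rw [List.erase_cons_tail (by simpa using hab.ne), List.map_cons, List.prod_cons,
        List.map_cons, List.prod_cons, if_pos hab, mul_smul_comm]
      -- Only factors of parity `p` are hit by `φ`, so `p` in the sign can be replaced by the parity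
      -- of the factor.
      by_cases hb' : ε b = p
      · rw [hb', mul_smul, smul_assoc (sgn (p * ε a))]
      · rw [hφ (ε b) _ (hx b) hb']
        simp

variable [CharZero K] {J : Type*} [Fintype J] {Q : V →ₗ[K] V →ₗ[K] K}

/-- The two halves come from `(v, w)` and `(w, v)`, which coincide if `v = w`; they add up because
`g` agrees on them. -/
theorem sum_slotForm_single [DecidableEq J] (v w : J) (x y : V) {M : Type*} [AddCommGroup M]
    [Module K M] {g : J × J → M} (hg : g (v, w) = g (w, v)) :
    ∑ e, slotForm Q e (Pi.single v x) (Pi.single w y) • g e = Q x y • g (v, w) := by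
  have h1 : ∑ e : J × J, Q ((Pi.single v x : J → V) e.1) ((Pi.single w y : J → V) e.2) • g e =
      Q x y • g (v, w) := by
    rw [Finset.sum_eq_single (v, w)]
    · simp
    · rintro ⟨a, b⟩ _ h
      by_cases ha : a = v
      · have hb : b ≠ w := fun hb => h (by rw [ha, hb])
        simp [hb]
      · simp [ha]
    · simp
  have h2 : ∑ e : J × J, Q ((Pi.single v x : J → V) e.2) ((Pi.single w y : J → V) e.1) • g e =
      Q x y • g (v, w) := by
    rw [Finset.sum_eq_single (w, v)]
    · simp [hg]
    · rintro ⟨a, b⟩ _ h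
      by_cases ha : b = v
      · have hb : a ≠ w := fun hb => h (by rw [ha, hb])
        simp [hb]
      · simp [ha]
    · simp
  simp only [slotForm_apply, mul_smul, add_smul, ← Finset.smul_sum, Finset.sum_add_distrib, h1, h2]
  rw [← two_smul K, smul_smul, inv_mul_cancel₀ two_ne_zero, one_smul]

/-- The pairs of slots of the two-element orbits. -/
def slotPairs (β : Fin N → J) (P : List (Fin N × Fin N)) : Set (J × J) :=
  {e | ∃ p ∈ P, (β p.1, β p.2) = e}

theorem slotPairs_cons (β : Fin N → J) (p : Fin N × Fin N) (P : List (Fin N × Fin N)) :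
    slotPairs β (p :: P) = insert (β p.1, β p.2) (slotPairs β P) := by
  ext e
  simp [slotPairs, eq_comm]

/-- Wick's theorem: contracting `n` edges in a product is summing over all the ways to pair `2n` of
the factors. -/
theorem edgeOp_list_prod [DecidableEq J] (hq : HasParity 𝒱 0 Q) (hs : IsGradedSymm 𝒱 Q)
    {x : Fin N → V} (hx : ∀ k, x k ∈ 𝒱 (ε k)) (β : Fin N → J) (n : ℕ) (χ : Set (J × J) → K)
    (hχ : ∀ v w s, χ (insert (v, w) s) = χ (insert (w, v) s)) {s : List (Fin N)}
    (h : s.Pairwise (· < ·)) :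
    edgeOp (slotOp hq hs) n χ
      (s.map fun k => ι (piGrading J 𝒱) (Pi.single (β k) (x k))).prod =
      ∑ τ ∈ involutions s, if (orbitPairs s τ).length = n then
        χ (slotPairs β (orbitPairs s τ)) • contractionValue ε (fun a b => Q (x a) (x b))
          (fun k => ι (piGrading J 𝒱) (Pi.single (β k) (x k))) (orbitPairs s τ) (fixedList s τ)
      else 0 := by
  have hX : ∀ k, Pi.single (β k) (x k) ∈ piGrading J 𝒱 (ε k) :=
    fun k => single_mem_piGrading (β k) (ε k) (x k) (hx k)
  have hQ : ∀ a b, ε a + ε b ≠ 0 → Q (x a) (x b) = 0 := fun a b => hq _ _ _ _ (hx a) (hx b)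
  induction hr : s.length using Nat.strong_induction_on generalizing s n χ with
  | _ r ih =>
  match s, h with
  | [], _ =>
    have h1 : involutions ([] : List (Fin N)) = {1} := by
      ext τ
      rw [mem_involutions, Finset.mem_singleton]
      constructor
      · rintro ⟨-, h⟩
        exact Equiv.ext fun k => h k List.not_mem_nil
      · rintro rfl
        simp
    have h2 : slotPairs β [] = ∅ := by simp [slotPairs]
    rw [h1, Finset.sum_singleton]
    cases n with
    | zero => simp [edgeOp, orbitPairs, fixedList, contractionValue, pairEntries, koszulSign, h2]
    | succ n => simp [edgeOp, slotOp, secondOrder_one, orbitPairs]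
  | a :: t, h =>
    obtain ⟨ha, ht⟩ := List.pairwise_cons.1 h
    have hat : a ∉ t := fun h => (ha a h).false
    have htn : t.Nodup := ht.imp fun h => h.ne
    subst hr
    rw [sum_involutions_cons hat htn, List.map_cons, List.prod_cons]
    -- Commuting multiplication by the smallest factor `a` out of the divided power yields this
    -- term, in which `a` stays unpaired, and a contraction term, in which `a` is paired with some
    -- `b`.
    have hfirst : ∀ (n : ℕ) (χ : Set (J × J) → K),
        (∀ v w s, χ (insert (v, w) s) = χ (insert (w, v) s)) →
        ι (piGrading J 𝒱) (Pi.single (β a) (x a)) * edgeOp (slotOp hq hs) n χ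
          (t.map fun k => ι (piGrading J 𝒱) (Pi.single (β k) (x k))).prod =
        ∑ τ ∈ involutions t, if (orbitPairs (a :: t) τ).length = n then
          χ (slotPairs β (orbitPairs (a :: t) τ)) • contractionValue ε (fun a b => Q (x a) (x b))
            (fun k => ι (piGrading J 𝒱) (Pi.single (β k) (x k))) (orbitPairs (a :: t) τ)
            (fixedList (a :: t) τ)
        else 0 := by
      intro n χ hχ
      rw [ih t.length (by simp) n χ hχ ht rfl, Finset.mul_sum]
      refine Finset.sum_congr rfl fun τ hτ => ?_
      have hτa : τ a = a := (mem_involutions.1 hτ).2 a hat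
      rw [orbitPairs_cons_of_eq hτa, fixedList_cons_of_eq hτa, mul_ite, mul_zero, mul_smul_comm,
        contractionValue_cons_right hQ fun b hb =>
          ha b ((orbitPairs_append_perm htn hτ).mem_iff.1 hb)]
    cases n with
    | zero =>
      have h1 := LinearMap.congr_fun (edgeOp_zero_mul (T := slotOp hq hs) χ
        (LinearMap.mulLeft K (ι (piGrading J 𝒱) (Pi.single (β a) (x a)))))
        (t.map fun k => ι (piGrading J 𝒱) (Pi.single (β k) (x k))).prod
      simp only [Module.End.mul_apply, LinearMap.mulLeft_apply] at h1
      rw [h1, hfirst 0 χ hχ, left_eq_add]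
      refine Finset.sum_eq_zero fun b hb => Finset.sum_eq_zero fun τ hτ => ?_
      rw [orbitPairs_cons_swap ha htn (List.mem_toFinset.1 hb) hτ, List.length_cons,
        if_neg (Nat.succ_ne_zero _)]
    | succ n =>
      have h1 := LinearMap.congr_fun (edgeOp_succ_mul (T := slotOp hq hs)
        (Y := LinearMap.mulLeft K (ι (piGrading J 𝒱) (Pi.single (β a) (x a))))
        (Z := fun e => contract (piGrading J 𝒱) (slotForm Q e (Pi.single (β a) (x a))))
        (fun e => by
          ext1 z
          simp only [Module.End.mul_apply, LinearMap.mulLeft_apply, LinearMap.add_apply]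
          refine (secondOrder_ι_mul _ _ _ _ _ (hX a) z).trans ?_
          rw [zero_mul, sgn_zero, one_smul]
          rfl)
        (fun e f => by
          ext1 z
          have := secondOrder_contract (slotForm_parity hq e) (slotForm_symm hs e)
            ((slotForm_parity hq f).isHom (hX a)) z
          rw [zero_mul, sgn_zero, one_smul] at this
          exact this.symm) n χ)
        (t.map fun k => ι (piGrading J 𝒱) (Pi.single (β k) (x k))).prod
      simp only [Module.End.mul_apply, LinearMap.mulLeft_apply, LinearMap.add_apply,
        LinearMap.sum_apply] at h1
      rw [h1, hfirst (n + 1) χ hχ]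
      congr 1
      have h2 : ∀ e : J × J, contract (piGrading J 𝒱) (slotForm Q e (Pi.single (β a) (x a)))
          (t.map fun k => ι (piGrading J 𝒱) (Pi.single (β k) (x k))).prod = _ :=
        fun e => contract_list_prod hX ((slotForm_parity hq e).isHom (hX a)) ht
      simp only [h2, map_sum, map_smul]
      rw [Finset.sum_comm]
      refine Finset.sum_congr rfl fun b hb => ?_
      have hb' := List.mem_toFinset.1 hb
      simp only [smul_assoc, ← Finset.smul_sum]
      -- The sum over all edges collapses to the slots of `a` and `b`; the symmetry of `χ` makes
      -- both orientations count alike.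
      rw [sum_slotForm_single (β a) (β b) (x a) (x b)
        (g := fun e => edgeOp (slotOp hq hs) n (fun s => χ (insert e s))
          ((t.erase b).map fun k => ι (piGrading J 𝒱) (Pi.single (β k) (x k))).prod)
        (by simp only [hχ (β a) (β b)])]
      rw [ih (t.erase b).length
        (by rw [List.length_erase_of_mem hb', List.length_cons]; lia) n _
        (fun v w s => by rw [Set.insert_comm, hχ, Set.insert_comm])
        (ht.sublist List.erase_sublist) rfl, Finset.smul_sum, Finset.smul_sum]
      refine Finset.sum_congr rfl fun τ hτ => ?_
      rw [orbitPairs_cons_swap ha htn hb' hτ, fixedList_cons_swap ha htn hb' hτ, List.length_cons,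
        slotPairs_cons]
      by_cases hn : (orbitPairs (t.erase b) τ).length = n
      -- Removing `b` does not change the sign, as `b` is not smaller than itself.
      · have hperm : ((t.map fun c => if c < b then sgn (ε b * ε c) else 1).prod : ℤ) =
            ((t.erase b).map fun c => if c < b then sgn (ε b * ε c) else 1).prod := by
          rw [((List.perm_cons_erase hb').map _).prod_eq, List.map_cons, List.prod_cons,
            if_neg (lt_irrefl _), one_mul]
        rw [if_pos hn, if_pos (by rw [hn]), contractionValue_cons_left
          (orbitPairs_append_perm (htn.erase b) hτ) (ha b hb')
          (fun c hc => ha c (List.mem_of_mem_erase hc)), hperm, smul_assoc, smul_comm (χ _)]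
        congr 1
        rw [smul_comm (Q _ _)]
      · rw [if_neg hn, if_neg (by lia), smul_zero, smul_zero]

end SuperSym

/-! ## Feynman sums -/

/-- A sum over a finite set with a group action, computed on the orbits. -/
theorem sum_orbits {K Γ α M : Type*} [Field K] [CharZero K] [AddCommGroup M] [Module K M] [Group Γ]
    [Fintype Γ] [MulAction Γ α] [Fintype α] [Fintype (MulAction.orbitRel.Quotient Γ α)]
    (F : α → M) :
    ∑ c : MulAction.orbitRel.Quotient Γ α,
      (Nat.card (MulAction.stabilizer Γ (Quotient.out c)) : K)⁻¹ •
        ∑ g : Γ, F (g • Quotient.out c) = ∑ a, F a := by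
  classical
  let p : α → MulAction.orbitRel.Quotient Γ α := Quotient.mk _
  rw [← Finset.sum_fiberwise Finset.univ p]
  refine Finset.sum_congr rfl fun c _ => ?_
  set a₀ := Quotient.out c with ha₀
  have hp : ∀ a, p a = c ↔ ∃ g : Γ, g • a₀ = a := by
    intro a
    have : p a₀ = c := Quotient.out_eq c
    rw [← this]
    exact Quotient.eq.trans (MulAction.orbitRel_apply.trans Iff.rfl)
  rw [← Finset.sum_fiberwise_of_maps_to (s := Finset.univ) (t := Finset.univ.filter (p · = c))
    (g := fun g : Γ => g • a₀)
    (fun g _ => Finset.mem_filter.2 ⟨Finset.mem_univ _, (hp _).2 ⟨g, rfl⟩⟩), Finset.smul_sum]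
  refine Finset.sum_congr rfl fun a ha => ?_
  obtain ⟨g₀, hg₀⟩ := (hp a).1 (Finset.mem_filter.1 ha).2
  -- The group elements that take `a₀` to `a` form a coset of the stabilizer.
  have hcard : (Finset.univ.filter fun g : Γ => g • a₀ = a).card =
      Nat.card (MulAction.stabilizer Γ a₀) := by
    rw [← Fintype.card_subtype, ← Nat.card_eq_fintype_card]
    refine Nat.card_congr
      { toFun := fun g => ⟨g₀⁻¹ * g.1, ?_⟩
        invFun := fun g => ⟨g₀ * g.1, ?_⟩
        left_inv := fun g => by simp
        right_inv := fun g => by simp }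
    · rw [MulAction.mem_stabilizer_iff, mul_smul, g.2, ← hg₀, inv_smul_smul]
    · rw [mul_smul, MulAction.mem_stabilizer_iff.1 g.2, hg₀]
  rw [Finset.sum_congr rfl fun g hg => congrArg F (Finset.mem_filter.1 hg).2, Finset.sum_const,
    hcard, ← Nat.cast_smul_eq_nsmul K, smul_smul, inv_mul_cancel₀, one_smul]
  exact Nat.cast_ne_zero.2 Nat.card_pos.ne'

theorem perm_inv_apply {α : Type*} (π : Equiv.Perm α) (a : α) : π⁻¹ (π a) = a :=
  π.symm_apply_apply a

theorem perm_apply_inv {α : Type*} (π : Equiv.Perm α) (a : α) : π (π⁻¹ a) = a :=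
  π.apply_symm_apply a

namespace MarkedGraph

variable {m N : ℕ}

theorem smul_inv (π : Equiv.Perm (Fin N)) (G : MarkedGraph m N) :
    (π • G).inv = π * G.inv * π⁻¹ := rfl

theorem smul_vert (π : Equiv.Perm (Fin N)) (G : MarkedGraph m N) (h : Fin N) :
    (π • G).vert h = G.vert (π⁻¹ h) := rfl

theorem smul_vert_eq_iff (π : Equiv.Perm (Fin N)) (G : MarkedGraph m N) (β : Fin N → Fin m) :
    (π • G).vert = β ↔ ∀ h, β (π h) = G.vert h := by
  rw [funext_iff]
  constructor
  · intro h k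
    rw [← h, smul_vert, perm_inv_apply]
  · intro h k
    rw [smul_vert, ← h, perm_apply_inv]

theorem connected_smul (π : Equiv.Perm (Fin N)) (G : MarkedGraph m N) :
    (π • G).Connected ↔ G.Connected := by
  have h : (fun v w => ∃ h, (π • G).vert h = v ∧ (π • G).vert ((π • G).inv h) = w) =
      fun v w => ∃ h, G.vert h = v ∧ G.vert (G.inv h) = w := by
    funext v w
    refine propext ⟨?_, ?_⟩
    · rintro ⟨h, h1, h2⟩
      refine ⟨π⁻¹ h, h1, ?_⟩
      rwa [smul_vert, smul_inv, Equiv.Perm.mul_apply, Equiv.Perm.mul_apply,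
        perm_inv_apply] at h2
    · rintro ⟨h, h1, h2⟩
      refine ⟨π h, ?_, ?_⟩
      · rwa [smul_vert, perm_inv_apply]
      · rwa [smul_vert, smul_inv, Equiv.Perm.mul_apply, Equiv.Perm.mul_apply,
          perm_inv_apply, perm_inv_apply]
  rw [Connected, h, Connected]

/-- An unordered pair, in increasing order. -/
def sortPair (p : Fin N × Fin N) : Fin N × Fin N := if p.1 < p.2 then p else p.swap

theorem sortPair_eq (p : Fin N × Fin N) : sortPair p = p ∨ sortPair p = p.swap := by
  unfold sortPair
  split_ifs <;> tauto

/-- Conjugation carries orbits to orbits, but `π` may reverse the order within a pair, so the images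
have to be sorted. -/
theorem map_orbitPairs_perm (π τ : Equiv.Perm (Fin N)) (hτ : ∀ h, τ (τ h) = h) :
    (((orbitPairs (List.finRange N) τ).map (Prod.map π π)).map sortPair).Perm
      (orbitPairs (List.finRange N) (π * τ * π⁻¹)) := by
  have hnd : ∀ σ : Equiv.Perm (Fin N), (orbitPairs (List.finRange N) σ).Nodup := fun σ =>
    ((List.nodup_finRange N).filter _).map fun a b h => congrArg Prod.fst h
  have hmem : ∀ (σ : Equiv.Perm (Fin N)) p, p ∈ orbitPairs (List.finRange N) σ ↔
      p.1 < p.2 ∧ p.2 = σ p.1 := by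
    rintro σ ⟨a, b⟩
    simp only [orbitPairs, List.mem_map, List.mem_filter, List.mem_finRange, true_and,
      decide_eq_true_eq, Prod.mk.injEq]
    constructor
    · rintro ⟨h, h1, rfl, rfl⟩
      exact ⟨h1, rfl⟩
    · rintro ⟨h1, rfl⟩
      exact ⟨a, h1, rfl, rfl⟩
  refine (List.perm_ext_iff_of_nodup ?_ (hnd _)).2 ?_
  · rw [List.map_map]
    refine (hnd τ).map_on ?_
    rintro ⟨a, b⟩ h1 ⟨c, d⟩ h2 h
    rw [hmem] at h1 h2
    obtain ⟨h1, h1'⟩ := h1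
    obtain ⟨h2, h2'⟩ := h2
    simp only [Function.comp_apply, Prod.map_apply, sortPair] at *
    split_ifs at h with h3 h4 h4
    · simpa using h
    · simp only [Prod.swap_prod_mk, Prod.mk.injEq, EmbeddingLike.apply_eq_iff_eq] at h
      exact absurd (h.1 ▸ h.2 ▸ h1) h2.not_gt
    · simp only [Prod.swap_prod_mk, Prod.mk.injEq, EmbeddingLike.apply_eq_iff_eq] at h
      exact absurd (h.1 ▸ h.2 ▸ h1) h2.not_gt
    · simp only [Prod.swap_prod_mk, Prod.mk.injEq, EmbeddingLike.apply_eq_iff_eq] at h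
      rw [h.1, h.2]
  · rintro ⟨c, d⟩
    rw [hmem, List.map_map, List.mem_map]
    simp only [Prod.exists, hmem, Function.comp_apply, Prod.map_apply, Equiv.Perm.mul_apply]
    constructor
    · rintro ⟨a, b, ⟨h1, rfl⟩, h⟩
      unfold sortPair at h
      split_ifs at h with h3
      · simp only [Prod.mk.injEq] at h
        obtain ⟨rfl, rfl⟩ := h
        exact ⟨h3, by simp⟩
      · simp only [Prod.swap_prod_mk, Prod.mk.injEq] at h
        obtain ⟨rfl, rfl⟩ := h
        refine ⟨lt_of_le_of_ne (not_lt.1 h3) fun h => h1.ne' (π.injective h), by simp [hτ]⟩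
    · rintro ⟨h1, h2⟩
      have e : π (π⁻¹ c) = c := perm_apply_inv π c
      obtain h3 | h3 | h3 := lt_trichotomy (π⁻¹ c) (τ (π⁻¹ c))
      · refine ⟨_, _, ⟨h3, rfl⟩, ?_⟩
        rw [e, ← h2]
        exact if_pos h1
      · rw [← h3, e] at h2
        exact absurd h2 h1.ne'
      · refine ⟨_, _, ⟨h3, (hτ _).symm⟩, ?_⟩
        rw [e, ← h2]
        exact if_neg h1.not_gt

theorem edges_smul_length (π : Equiv.Perm (Fin N)) (G : MarkedGraph m N) :
    (π • G).edges.length = G.edges.length := by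
  have h := (map_orbitPairs_perm π G.inv G.inv_inv).length_eq
  simp only [orbitPairs, List.length_map] at h
  exact h.symm

theorem genus_smul (π : Equiv.Perm (Fin N)) (G : MarkedGraph m N) (g : Fin m → ℕ) :
    (π • G).genus g = G.genus g := by
  rw [genus, edges_smul_length, genus]

variable {K A : Type*} [Field K] [Ring A] [Algebra K A] {ε : Fin N → ZMod 2}
  {q : Fin N → Fin N → K} {y : Fin N → A}

/-- A relabelling of the half-edges turns a decoration into the identity. -/
theorem smul_contractionValue (hq : ∀ a b, ε a + ε b ≠ 0 → q a b = 0)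
    (hs : ∀ a b, q a b = sgn (ε a * ε b) • q b a)
    (hy : ∀ a b, y a * y b = sgn (ε a * ε b) • (y b * y a))
    (π : Equiv.Perm (Fin N)) (G : MarkedGraph m N) :
    koszulSign ε (G.contractionOrder.map π) •
      (G.edges.map fun h => q (π h) (π (G.inv h))).prod • (G.leaves.map fun h => y (π h)).prod =
    contractionValue ε q y (orbitPairs (List.finRange N) (π • G).inv)
      (fixedList (List.finRange N) (π • G).inv) := by
  have hP : pairEntries ((orbitPairs (List.finRange N) G.inv).map (Prod.map π π)) =
      (pairEntries (orbitPairs (List.finRange N) G.inv)).map π := by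
    simp [pairEntries, List.flatMap_map, List.map_flatMap]
  have h1 : koszulSign ε (G.contractionOrder.map π) •
      (G.edges.map fun h => q (π h) (π (G.inv h))).prod • (G.leaves.map fun h => y (π h)).prod =
      contractionValue ε q y ((orbitPairs (List.finRange N) G.inv).map (Prod.map π π))
        ((fixedList (List.finRange N) G.inv).map π) := by
    rw [contractionValue, hP, ← List.map_append, orbitPairs, List.map_map, List.map_map,
      pairEntries, List.flatMap_map, List.map_map]
    rfl
  have h2 : ((fixedList (List.finRange N) G.inv).map π).Perm
      (fixedList (List.finRange N) (π • G).inv) := by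
    refine (List.perm_ext_iff_of_nodup (((List.nodup_finRange N).filter _).map π.injective)
      ((List.nodup_finRange N).filter _)).2 fun a => ?_
    simp only [List.mem_map, List.mem_filter, List.mem_finRange, true_and,
      decide_eq_true_eq, smul_inv, Equiv.Perm.mul_apply]
    constructor
    · rintro ⟨k, hk, rfl⟩
      simp [hk]
    · intro h
      exact ⟨π⁻¹ a, π.injective ((of_decide_eq_true h).trans (perm_apply_inv π a).symm),
        perm_apply_inv π a⟩
  rw [h1, contractionValue_perm_right hy _ h2, contractionValue_map_swap hs sortPair_eq
    (hP ▸ (nodup_pairEntries_orbitPairs (List.nodup_finRange N) G.inv_inv).map π.injective)]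
  exact (contractionValue_perm_left hq (map_orbitPairs_perm π G.inv G.inv_inv).symm
    (nodup_pairEntries_orbitPairs (List.nodup_finRange N) (π • G).inv_inv) _).symm

/-- Leaves add only trivial relations, and listing each edge in one direction suffices since the
generated relation is symmetric. -/
theorem connected_iff (G : MarkedGraph m N) :
    G.Connected ↔ EdgesConnect (SuperSym.slotPairs G.vert (orbitPairs (List.finRange N) G.inv)) := by
  have hmem : ∀ v w, (v, w) ∈ SuperSym.slotPairs G.vert (orbitPairs (List.finRange N) G.inv) ↔
      ∃ h, h < G.inv h ∧ G.vert h = v ∧ G.vert (G.inv h) = w := by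
    intro v w
    simp only [SuperSym.slotPairs, orbitPairs, Set.mem_ofPred_eq, List.mem_map, List.mem_filter,
      List.mem_finRange, true_and, decide_eq_true_eq, Prod.mk.injEq]
    constructor
    · rintro ⟨_, ⟨h, h1, rfl⟩, h2, h3⟩
      exact ⟨h, h1, h2, h3⟩
    · rintro ⟨h, h1, h2, h3⟩
      exact ⟨_, ⟨h, h1, rfl⟩, h2, h3⟩
  constructor
  · intro h v w
    have h1 := h v w
    induction h1 with
    | rel v w h =>
      obtain ⟨k, rfl, rfl⟩ := h
      obtain h1 | h1 | h1 := lt_trichotomy k (G.inv k)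
      · exact .rel _ _ ((hmem _ _).2 ⟨k, h1, rfl, rfl⟩)
      · rw [← h1]
        exact .refl _
      · refine .symm _ _ (.rel _ _ ((hmem _ _).2 ⟨G.inv k, ?_, rfl, ?_⟩))
        · rwa [G.inv_inv]
        · rw [G.inv_inv]
    | refl v => exact .refl v
    | symm v w _ h => exact h.symm
    | trans u v w _ _ h1 h2 => exact h1.trans _ _ _ h2
  · intro h v w
    refine Relation.EqvGen.mono (fun v w hvw => ?_) _ _ (h v w)
    obtain ⟨k, -, h1, h2⟩ := (hmem v w).1 hvw
    exact ⟨k, h1, h2⟩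

end MarkedGraph

section

variable {K L : Type*} [Field K] [AddCommGroup L] [Module K L] {𝓛 : ZMod 2 → Submodule K L}

theorem SymSeries.coeff_X_pow_smul_C (a : SymMinus 𝓛) (k : ℕ) (n : Fin 2 →₀ ℕ) :
    MvPowerSeries.coeff n ((MvPowerSeries.X 0 : Scalars K) ^ k • (MvPowerSeries.C a : SymSeries 𝓛)) =
      if n = Finsupp.single 0 k then a else 0 := by
  rw [SymSeries.coeff_X_pow_smul, MvPowerSeries.coeff_C]
  by_cases h : n = Finsupp.single 0 k
  · subst h
    simp
  · rw [if_neg h]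
    split_ifs with h1 h2
    · refine absurd ?_ h
      rw [← tsub_add_cancel_of_le (Finsupp.single_le_iff.2 h1), h2, zero_add]
    · rfl
    · rfl

theorem coeff_hbarSum_C {J : Type*} (C : ℕ → SlotSym J 𝓛 →ₗ[K] SymMinus 𝓛) (z : SlotSym J 𝓛)
    (n : Fin 2 →₀ ℕ) : MvPowerSeries.coeff n (hbarSum C (MvPowerSeries.C z)) =
      if n = Finsupp.single 0 (n 0) then C (n 0) z else 0 := by
  rw [coeff_hbarSum]
  split_ifs with h
  · rw [Finset.sum_eq_single (n 0), ← h, tsub_self, MvPowerSeries.coeff_zero_C]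
    · intro l hl hl'
      rw [MvPowerSeries.coeff_C, if_neg, map_zero]
      intro h1
      have := DFunLike.congr_fun h1 0
      simp only [Finsupp.tsub_apply, Finsupp.single_eq_same, Finsupp.zero_apply] at this
      have := Finset.mem_range.1 hl
      lia
    · intro h1
      simp at h1
  · refine Finset.sum_eq_zero fun l hl => ?_
    rw [MvPowerSeries.coeff_C, if_neg, map_zero]
    intro h1
    have hl' : Finsupp.single 0 l ≤ n := Finsupp.single_le_iff.2 (Nat.lt_succ_iff.1 (Finset.mem_range.1 hl))
    have h2 : n = Finsupp.single 0 l := by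
      rw [← tsub_add_cancel_of_le hl', h1, zero_add]
    refine h ?_
    rw [h2]
    simp

/-- For monotone `β` the fibres are consecutive intervals, so the blocks are concatenated without
any Koszul sign. -/
theorem finRange_eq_flatMap {m N : ℕ} {β : Fin N → Fin m} (hβ : Monotone β) :
    (List.finRange m).flatMap (fun v => (List.finRange N).filter fun k => β k = v) =
      List.finRange N := by
  have hp : ((List.finRange m).flatMap fun v =>
      (List.finRange N).filter fun k => β k = v).Pairwise (· < ·) := by
    rw [List.pairwise_flatMap]
    refine ⟨fun v _ => (List.pairwise_lt_finRange N).filter _, ?_⟩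
    refine (List.pairwise_lt_finRange m).imp fun {v w} hvw a ha b hb => ?_
    have h1 := of_decide_eq_true (List.mem_filter.1 ha).2
    have h2 := of_decide_eq_true (List.mem_filter.1 hb).2
    exact hβ.reflect_lt (by rwa [h1, h2])
  refine List.Perm.eq_of_pairwise' (r := (· < ·)) hp (List.pairwise_lt_finRange N) ?_
  refine (List.perm_ext_iff_of_nodup (hp.imp fun h => h.ne) (List.nodup_finRange N)).2 fun a => ?_
  simp

theorem map_contractionValue {A A' : Type*} [Ring A] [Algebra K A] [Ring A'] [Algebra K A'] {N : ℕ}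
    (ε : Fin N → ZMod 2) (q : Fin N → Fin N → K) (y : Fin N → A) (f : A →ₐ[K] A')
    (P : List (Fin N × Fin N)) (l : List (Fin N)) :
    f (contractionValue ε q y P l) = contractionValue ε q (fun k => f (y k)) P l := by
  rw [contractionValue, map_zsmul, map_smul, map_list_prod, List.map_map]
  rfl

variable [DirectSum.Decomposition 𝓛]

theorem slotProd_C_blockProduct {m N : ℕ} {β : Fin N → Fin m} (hβ : Monotone β)
    (x : Fin N → ℕ →₀ L) :
    slotProd 𝓛 m (fun v => MvPowerSeries.C (blockProduct (minusGrading 𝓛) β x v)) =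
      MvPowerSeries.C ((List.finRange N).map fun k =>
        SuperSym.ι (SuperSym.piGrading (Fin m) (minusGrading 𝓛)) (Pi.single (β k) (x k))).prod := by
  have h1 : ∀ (v : Fin m) (s : SymMinus 𝓛), slotSeries 𝓛 v (MvPowerSeries.C s) =
      MvPowerSeries.C (SuperSym.slotHom (minusGrading 𝓛) v s) := by
    intro v s
    refine MvPowerSeries.ext fun n => ?_
    rw [coeff_slotSeries, MvPowerSeries.coeff_C, MvPowerSeries.coeff_C]
    split_ifs
    · rfl
    · exact map_zero _
  have h2 : ∀ v : Fin m, SuperSym.slotHom (minusGrading 𝓛) v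
      (blockProduct (minusGrading 𝓛) β x v) =
      (((List.finRange N).filter fun k => β k = v).map fun k =>
        SuperSym.ι (SuperSym.piGrading (Fin m) (minusGrading 𝓛)) (Pi.single (β k) (x k))).prod := by
    intro v
    rw [blockProduct, map_list_prod, List.map_map]
    congr 1
    refine List.map_congr_left fun k hk => ?_
    rw [Function.comp_apply, SuperSym.slotHom_ι, of_decide_eq_true (List.mem_filter.1 hk).2]
  rw [slotProd_apply]
  simp only [h1, h2]
  have h3 : ((List.finRange N).map fun k =>
      SuperSym.ι (SuperSym.piGrading (Fin m) (minusGrading 𝓛)) (Pi.single (β k) (x k))) = _ :=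
    congrArg _ (finRange_eq_flatMap hβ).symm
  rw [h3, List.map_flatMap, List.flatMap, List.prod_flatten, List.map_map, map_list_prod,
    List.map_map, List.ofFn_eq_map]
  rfl

end

/-! ### The components as Feynman sums -/

namespace ChainSplitting

variable {K L : Type*} [Field K] [CharZero K] [AddCommGroup L] [Module K L]
  {𝓛 : ZMod 2 → Submodule K L} [DirectSum.Decomposition 𝓛] {X : CircleComplex 𝓛}
  (S : ChainSplitting X)

open Classical in
/-- The contribution of an involution of the half-edges to the coefficient at `n` of a Feynman
sum. -/
def feynmanTerm {m N : ℕ} (g : Fin m → ℕ) (β : Fin N → Fin m) (ε : Fin N → ZMod 2)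
    (x : Fin N → ℕ →₀ L) (n : Fin 2 →₀ ℕ) (τ : Equiv.Perm (Fin N)) : SymMinus 𝓛 :=
  if EdgesConnect (SuperSym.slotPairs β (orbitPairs (List.finRange N) τ)) ∧
      n = Finsupp.single 0 (∑ v, g v + ((orbitPairs (List.finRange N) τ).length + 1 - m)) then
    contractionValue ε (fun a b => S.homotopySym (x a) (x b))
      (fun k => SuperSym.ι (minusGrading 𝓛) (x k)) (orbitPairs (List.finRange N) τ)
      (fixedList (List.finRange N) τ)
  else 0

variable {m N : ℕ} (g : Fin m → ℕ) {β : Fin N → Fin m} {ε : Fin N → ZMod 2} {x : Fin N → ℕ →₀ L}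

theorem slotPairs_ncard_le {J : Type*} [Fintype J] (β : Fin N → J) (P : List (Fin N × Fin N)) :
    (SuperSym.slotPairs β P).ncard ≤ P.length := by
  induction P with
  | nil => simp [SuperSym.slotPairs]
  | cons p P ih =>
    rw [SuperSym.slotPairs_cons, List.length_cons]
    exact (Set.ncard_insert_le _ _).trans (by lia)

/-- Wick's theorem for the concatenated product, where an involution with `r` pairs contributes in
degree `∑ g + r - (m - 1)` of `ħ`. -/
theorem coeff_component_blockProduct (hm : 0 < m) (hβ : Monotone β)
    (hx : ∀ k, x k ∈ minusGrading 𝓛 (ε k)) (n : Fin 2 →₀ ℕ) :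
    MvPowerSeries.coeff n (S.component m (fun v => (MvPowerSeries.X 0 : Scalars K) ^ g v •
      MvPowerSeries.C (blockProduct (minusGrading 𝓛) β x v))) =
      ∑ τ ∈ involutions (List.finRange N), S.feynmanTerm g β ε x n τ := by
  obtain ⟨m, rfl⟩ := Nat.exists_eq_succ_of_ne_zero hm.ne'
  rw [MultilinearMap.map_smul_univ, component_succ_apply, slotProd_C_blockProduct hβ,
    Finset.prod_pow_eq_pow_sum, SymSeries.coeff_X_pow_smul, coeff_hbarSum_C, contraction_apply,
    SuperSym.edgeOp_list_prod S.homotopySym_even S.homotopySym_symm hx β _ _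
      (fun v w s => connWeight_congr (edgesConnect_insert_swap v w s))
      (List.pairwise_lt_finRange N), map_sum]
  have hsum : ∀ τ ∈ involutions (List.finRange N), S.feynmanTerm g β ε x n τ =
      if ∑ v, g v ≤ n 0 then if n - Finsupp.single 0 (∑ v, g v) =
        Finsupp.single 0 ((n - Finsupp.single 0 (∑ v, g v) : Fin 2 →₀ ℕ) 0) then
          SuperSym.sumHom (minusGrading 𝓛)
            (if (orbitPairs (List.finRange N) τ).length =
              (n - Finsupp.single 0 (∑ v, g v) : Fin 2 →₀ ℕ) 0 + m then
              connWeight K (Fin (m + 1)) (SuperSym.slotPairs β (orbitPairs (List.finRange N) τ)) •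
                contractionValue ε (fun a b => S.homotopySym (x a) (x b))
                  (fun k => SuperSym.ι (SuperSym.piGrading (Fin (m + 1)) (minusGrading 𝓛))
                    (Pi.single (β k) (x k)))
                  (orbitPairs (List.finRange N) τ) (fixedList (List.finRange N) τ)
            else 0) else 0 else 0 := by
    intro τ _
    have hval : SuperSym.sumHom (minusGrading 𝓛) (contractionValue ε
        (fun a b => S.homotopySym (x a) (x b))
        (fun k => SuperSym.ι (SuperSym.piGrading (Fin (m + 1)) (minusGrading 𝓛)) (Pi.single (β k) (x k)))
        (orbitPairs (List.finRange N) τ) (fixedList (List.finRange N) τ)) =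
        contractionValue ε (fun a b => S.homotopySym (x a) (x b))
          (fun k => SuperSym.ι (minusGrading 𝓛) (x k)) (orbitPairs (List.finRange N) τ)
          (fixedList (List.finRange N) τ) := by
      rw [map_contractionValue]
      congr 1
      funext k
      rw [← SuperSym.slotHom_ι, SuperSym.sumHom_slotHom]
    set s := SuperSym.slotPairs β (orbitPairs (List.finRange N) τ) with hs
    set r := (orbitPairs (List.finRange N) τ).length with hr
    rw [feynmanTerm]
    by_cases hc : EdgesConnect s
    -- Connectedness forces at least `m` edges on `m + 1` vertices, so the truncated subtraction in
    -- the genus is exact.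
    · have hle : m ≤ r := by
        have h1 := hc.card_le
        have h2 := slotPairs_ncard_le β (orbitPairs (List.finRange N) τ)
        rw [Nat.card_eq_fintype_card, Fintype.card_fin] at h1
        lia
      have hcw : connWeight K (Fin (m + 1)) s = 1 := if_pos hc
      rw [hcw, one_smul]
      by_cases hn : n = Finsupp.single 0 (∑ v, g v + (r + 1 - (m + 1)))
      · have e1 : n - Finsupp.single 0 (∑ v, g v) = Finsupp.single 0 (r - m) := by
          rw [hn, Finsupp.single_add, add_tsub_cancel_left]
          congr 1
          lia
        have e2 : ∑ v, g v ≤ n 0 := by rw [hn]; simp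
        rw [if_pos ⟨hc, hn⟩, e1, if_pos e2, Finsupp.single_eq_same, if_pos rfl,
          if_pos (by lia), hval]
      · rw [if_neg fun h => hn h.2]
        split_ifs with h1 h2 h3
        · refine absurd ?_ hn
          rw [← tsub_add_cancel_of_le (Finsupp.single_le_iff.2 h1), h2, ← Finsupp.single_add]
          congr 1
          lia
        · exact (map_zero _).symm
        · rfl
        · rfl
    · have hcw : connWeight K (Fin (m + 1)) s = 0 := if_neg hc
      rw [if_neg fun h => hc h.1, hcw, zero_smul, ite_self,
        map_zero (SuperSym.sumHom (minusGrading 𝓛)), ite_self, ite_self]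
  rw [Finset.sum_congr rfl hsum]
  split_ifs <;> simp

/-- A sum over involutions is a sum over the labelled graphs with vertex map `β`. Grouping it by
orbits under renaming of the half-edges gives `1/|Aut|` times a sum over all renamings of a
representative. -/
theorem isFeynmanSum_of_comp_eq {𝒦 : LInftyMorphism X.dgla X.trivialDgla}
    (h𝒦 : ∀ m, 𝒦.comp m = S.component m) : IsFeynmanSum S 𝒦 := by
  classical
  intro m N hm g β hβ ε x hx
  refine MvPowerSeries.ext fun n => ?_
  rw [h𝒦, S.coeff_component_blockProduct g hm hβ hx, map_sum]
  simp only [SymSeries.coeff_X_pow_smul_C]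
  have := Fintype.ofFinite (MarkedGraph m N)
  -- Extended by zero to all vertex maps, in order to sum over a set on which the renamings act.
  let F : MarkedGraph m N → SymMinus 𝓛 := fun G =>
    if G.vert = β then S.feynmanTerm g β ε x n G.inv else 0
  have hF : ∑ G, F G = ∑ τ ∈ involutions (List.finRange N), S.feynmanTerm g β ε x n τ := by
    rw [← Finset.sum_filter]
    refine Finset.sum_bij (fun G _ => G.inv) ?_ ?_ ?_ ?_
    · intro G _
      exact mem_involutions.2 ⟨G.inv_inv, fun h hh => absurd (List.mem_finRange h) hh⟩
    · intro G hG G' hG' h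
      exact MarkedGraph.ext ((Finset.mem_filter.1 hG).2.trans (Finset.mem_filter.1 hG').2.symm) h
    · intro τ hτ
      exact ⟨⟨β, τ, (mem_involutions.1 hτ).1⟩, by simp, rfl⟩
    · intro G _
      rfl
  rw [← hF, ← sum_orbits (K := K) (Γ := Equiv.Perm (Fin N)) F, Finset.sum_filter]
  refine Finset.sum_congr rfl fun c _ => ?_
  set G := Quotient.out c
  -- A renaming `π` of the representative is read as the decoration of the half-edge `h` by `x (π
  -- h)`; it counts exactly if the decorations at each vertex come from its own block.
  have hterm : ∀ π : Equiv.Perm (Fin N), F (π • G) =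
      if G.Connected ∧ n = Finsupp.single 0 (G.genus g) then
        if ∀ h, β (π h) = G.vert h then
          koszulSign ε (G.contractionOrder.map π) •
            (G.edges.map fun h => S.homotopySym (x (π h)) (x (π (G.inv h)))).prod •
              (G.leaves.map fun h => SuperSym.ι (minusGrading 𝓛) (x (π h))).prod
        else 0
      else 0 := by
    intro π
    have h1 := MarkedGraph.smul_vert_eq_iff π G β
    have h3 := MarkedGraph.smul_contractionValue (ε := ε)
      (q := fun a b => S.homotopySym (x a) (x b))
      (y := fun k => SuperSym.ι (minusGrading 𝓛) (x k))
      (fun a b => S.homotopySym_even _ _ _ _ (hx a) (hx b))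
      (fun a b => S.homotopySym_symm _ _ _ _ (hx a) (hx b))
      (fun a b => SuperSym.ι_mul_ι (hx a) (hx b)) π G
    simp only [F]
    by_cases hv : (π • G).vert = β
    · have h2 := MarkedGraph.connected_iff (π • G)
      rw [hv, MarkedGraph.connected_smul] at h2
      have h4 := MarkedGraph.genus_smul π G g
      have h5 : (π • G).genus g =
          ∑ v, g v + ((orbitPairs (List.finRange N) (π • G).inv).length + 1 - m) := by
        rw [MarkedGraph.genus, orbitPairs, List.length_map]
        rfl
      rw [if_pos hv, feynmanTerm, ← h2, ← h5, h4, if_pos (h1.1 hv), h3]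
    · rw [if_neg hv, if_neg fun h => hv (h1.2 h), ite_self]
  simp only [hterm]
  by_cases hc : G.Connected
  · by_cases hn : n = Finsupp.single 0 (G.genus g)
    · simp only [hc, true_and, if_pos hn, if_true]
      rw [feynmanContraction, Finset.sum_filter]
      rfl
    · simp only [hn, and_false, if_false, Finset.sum_const_zero, smul_zero, ite_self]
  · simp only [hc, false_and, if_false, Finset.sum_const_zero, smul_zero]

end ChainSplitting

/-! ## The exponential -/

namespace SymSeries

variable {K L : Type*} [Field K] [CharZero K] [AddCommGroup L] [Module K L]
  {𝓛 : ZMod 2 → Submodule K L}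

theorem coeff_expHbar (T : Module.End K (SymMinus 𝓛)) (x : SymSeries 𝓛) (n : Fin 2 →₀ ℕ) :
    MvPowerSeries.coeff n (expHbar T x) = ∑ l ∈ Finset.range (n 0 + 1),
      ((Nat.factorial l : K)⁻¹) • (T ^ l) (MvPowerSeries.coeff (n - Finsupp.single 0 l) x) := rfl

/-- The binomial theorem for the commuting operators `-T` and `T`, divided by `j!`. -/
theorem sum_neg_pow_mul_pow {A : Type*} [Ring A] [Algebra K A] (T : A) (j : ℕ) :
    ∑ k ∈ Finset.range (j + 1), ((k.factorial : K)⁻¹ * ((j - k).factorial : K)⁻¹) •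
      ((-T) ^ k * T ^ (j - k)) = if j = 0 then 1 else 0 := by
  have h := (Commute.neg_left (Commute.refl T)).add_pow j
  rw [neg_add_cancel] at h
  have h2 : ∑ k ∈ Finset.range (j + 1), ((k.factorial : K)⁻¹ * ((j - k).factorial : K)⁻¹) •
      ((-T) ^ k * T ^ (j - k)) = (j.factorial : K)⁻¹ • (0 : A) ^ j := by
    rw [h, Finset.smul_sum]
    refine Finset.sum_congr rfl fun k hk => ?_
    rw [(Nat.cast_commute _ _).symm.eq, ← nsmul_eq_mul, ← Nat.cast_smul_eq_nsmul K, smul_smul,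
      Nat.cast_choose K (Nat.lt_succ_iff.1 (Finset.mem_range.1 hk))]
    congr 1
    have := Nat.factorial_ne_zero j
    field_simp
  rw [h2]
  split_ifs with hj
  · simp [hj]
  · rw [zero_pow hj, smul_zero]

/-- Collecting the double sum by the total power `ħ^j` leaves only `j = 0`, by
`sum_neg_pow_mul_pow`. -/
theorem expHbar_neg_expHbar (T : Module.End K (SymMinus 𝓛)) (x : SymSeries 𝓛) :
    expHbar (-T) (expHbar T x) = x := by
  refine MvPowerSeries.ext fun n => ?_
  have h : ∀ l ∈ Finset.range (n 0 + 1), ((Nat.factorial l : K)⁻¹) • ((-T) ^ l)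
      (MvPowerSeries.coeff (n - Finsupp.single 0 l) (expHbar T x)) =
      ∑ k ∈ Finset.range (n 0 + 1 - l), (((l.factorial : K)⁻¹ * (k.factorial : K)⁻¹) •
        ((-T) ^ l * T ^ k)) (MvPowerSeries.coeff (n - Finsupp.single 0 (l + k)) x) := by
    intro l hl
    have e : (n - Finsupp.single 0 l : Fin 2 →₀ ℕ) 0 + 1 = n 0 + 1 - l := by
      have := Finset.mem_range.1 hl
      simp
      lia
    rw [coeff_expHbar, e, map_sum, Finset.smul_sum]
    refine Finset.sum_congr rfl fun k _ => ?_
    rw [tsub_tsub, ← Finsupp.single_add, map_smul, smul_smul]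
    rfl
  rw [coeff_expHbar, Finset.sum_congr rfl h, ← Finset.sum_range_diag_flip (n 0 + 1) fun l k =>
    (((l.factorial : K)⁻¹ * (k.factorial : K)⁻¹) •
      ((-T) ^ l * T ^ k)) (MvPowerSeries.coeff (n - Finsupp.single 0 (l + k)) x)]
  have h2 : ∀ j ∈ Finset.range (n 0 + 1), ∑ k ∈ Finset.range (j + 1),
      (((k.factorial : K)⁻¹ * ((j - k).factorial : K)⁻¹) • ((-T) ^ k * T ^ (j - k)))
        (MvPowerSeries.coeff (n - Finsupp.single 0 (k + (j - k))) x) =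
      (if j = 0 then (1 : Module.End K (SymMinus 𝓛)) else 0)
        (MvPowerSeries.coeff (n - Finsupp.single 0 j) x) := by
    intro j _
    rw [← sum_neg_pow_mul_pow (K := K) T j, LinearMap.sum_apply]
    refine Finset.sum_congr rfl fun k hk => ?_
    rw [Nat.add_sub_cancel' (Nat.lt_succ_iff.1 (Finset.mem_range.1 hk))]
  rw [Finset.sum_congr rfl h2, Finset.sum_range_succ', if_pos rfl, Finset.sum_eq_zero]
  · simp
  · intro j _
    rw [if_neg (Nat.succ_ne_zero j), LinearMap.zero_apply]

theorem expHbar_injective (T : Module.End K (SymMinus 𝓛)) : Function.Injective (expHbar T) :=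
  Function.LeftInverse.injective (expHbar_neg_expHbar T)

theorem expHbar_surjective (T : Module.End K (SymMinus 𝓛)) : Function.Surjective (expHbar T) :=
  fun x => ⟨expHbar (-T) x, by
    have := expHbar_neg_expHbar (-T) x
    rwa [neg_neg] at this⟩

end SymSeries

namespace ChainSplitting

variable {K L : Type*} [Field K] [CharZero K] [AddCommGroup L] [Module K L]
  {𝓛 : ZMod 2 → Submodule K L} [DirectSum.Decomposition 𝓛] {X : CircleComplex 𝓛}
  (S : ChainSplitting X)

/-- With a single vertex every set of edges is connected, so `edgeOp` is the full divided power, and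
`sumHom` intertwines the sum of the slot operators with `Δ^{H^sym}`. -/
theorem component_one (x : SymSeries 𝓛) :
    S.component 1 (fun _ => x) = SymSeries.expHbar S.deltaHSym x := by
  refine MvPowerSeries.ext fun n => ?_
  have h1 : connWeight K (Fin 1) = fun _ => 1 := funext fun s => if_pos fun v w => by
    rw [Subsingleton.elim v w]
    exact .refl _
  have h2 : slotProd 𝓛 1 (fun _ => x) = slotSeries 𝓛 0 x := by
    rw [slotProd_apply]
    simp
  have h3 : ∀ (l : ℕ) (z : SlotSym (Fin 1) 𝓛), SuperSym.sumHom (minusGrading 𝓛)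
      (((∑ e, SuperSym.slotOp S.homotopySym_even S.homotopySym_symm e) ^ l) z) =
      (S.deltaHSym ^ l) (SuperSym.sumHom (minusGrading 𝓛) z) := by
    intro l
    induction l with
    | zero => intro z; rfl
    | succ l ih =>
      intro z
      rw [pow_succ, pow_succ, Module.End.mul_apply, Module.End.mul_apply, ih, deltaHSym,
        SuperSym.secondOrder_sumHom, LinearMap.sum_apply]
  rw [component_succ_apply, coeff_hbarSum, SymSeries.coeff_expHbar, h1, h2]
  refine Finset.sum_congr rfl fun l _ => ?_
  rw [contraction_apply, add_zero, edgeOp_const, LinearMap.smul_apply, map_smul, h3,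
    coeff_slotSeries, SuperSym.sumHom_slotHom]

/-- The bar equation with one argument, where no bracket occurs; additivity extends it beyond
homogeneous elements. -/
theorem component_one_diff (x : SymSeries 𝓛) :
    SymSeries.mapCoeff X.symDiff (SymSeries.expHbar S.deltaHSym x) =
      SymSeries.expHbar S.deltaHSym (X.dgla.d x) := by
  have h0 : ∀ (p : ZMod 2) (x : SymSeries 𝓛), x ∈ SymSeries.parity 𝓛 p →
      SymSeries.mapCoeff X.symDiff (S.component 1 fun _ => x) =
        S.component 1 fun _ => X.dgla.d x := by
    intro p x hx
    have h := S.component_map_bar 0 (fun _ => p) (fun _ => x) fun _ => hx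
    rw [Fin.sum_univ_one, Fin.sum_univ_one, prod_Iio_zero, one_smul] at h
    have h1 : Function.update (fun _ : Fin 1 => x) 0 (X.dgla.d x) = fun _ => X.dgla.d x := by
      funext k
      rw [Subsingleton.elim k 0, Function.update_self]
    rw [h, h1, Finset.sum_eq_zero, add_zero]
    intro j hj
    have := Finset.mem_Ioi.1 hj
    lia
  have hadd : ∀ x y : SymSeries 𝓛, S.component 1 (fun _ => x + y) =
      S.component 1 (fun _ => x) + S.component 1 fun _ => y := by
    intro x y
    have := (S.component 1).map_update_add (fun _ => 0) 0 x y
    have h1 : ∀ z : SymSeries 𝓛, Function.update (fun _ : Fin 1 => 0) 0 z = fun _ => z := by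
      intro z
      funext k
      rw [Subsingleton.elim k 0, Function.update_self]
    rwa [h1, h1, h1] at this
  rw [← component_one, ← component_one, ← SymSeries.parityProj_add x, map_add X.dgla.d, hadd, hadd,
    map_add, h0 0 _ (SymSeries.parityProj_series_mem 0 x),
    h0 1 _ (SymSeries.parityProj_series_mem 1 x)]

/-- The `L_∞` morphism of a chain-level splitting. -/
def lInftyMorphism : LInftyMorphism X.dgla X.trivialDgla where
  comp := S.component
  comp_zero := rfl
  even := S.component_even
  symm := S.component_symm
  map_bar m ε x hx := by
    have h : ∀ a b : SymSeries 𝓛, X.trivialDgla.bracket a b = 0 := fun a b => rfl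
    simp only [h, smul_zero, Finset.sum_const_zero, add_zero]
    exact S.component_map_bar m ε x hx

/-- The first component is a bijective chain map, so it is already an isomorphism of complexes. -/
theorem lInftyMorphism_isQuasiIso : S.lInftyMorphism.IsQuasiIso where
  injective x _ hw := by
    obtain ⟨w, hw⟩ := hw
    obtain ⟨v, rfl⟩ := SymSeries.expHbar_surjective S.deltaHSym w
    refine ⟨v, SymSeries.expHbar_injective S.deltaHSym ?_⟩
    rw [← component_one_diff]
    exact (S.component_one x).symm.trans hw
  surjective y hy := by
    obtain ⟨x, rfl⟩ := SymSeries.expHbar_surjective S.deltaHSym y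
    refine ⟨x, SymSeries.expHbar_injective S.deltaHSym ?_, 0, ?_⟩
    · rw [← component_one_diff]
      refine Eq.trans hy ?_
      rw [← component_one]
      exact ((S.component 1).map_zero).symm
    · rw [map_zero, add_zero]
      exact (S.component_one x).symm

end ChainSplitting

/-! ## Uniqueness -/

section Uniqueness

variable {K : Type*} [Field K] {V : Type*} [AddCommGroup V] [Module K V]
  {𝒱 : ZMod 2 → Submodule K V}

/-- Every family of products is a family of blocks of one product. -/
theorem exists_blockProduct {m : ℕ} {n : Fin m → ℕ} {ε : ∀ v, Fin (n v) → ZMod 2}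
    {x : ∀ v, Fin (n v) → V} (hx : ∀ v k, x v k ∈ 𝒱 (ε v k)) :
    ∃ (N : ℕ) (β : Fin N → Fin m) (ε' : Fin N → ZMod 2) (x' : Fin N → V), Monotone β ∧
      (∀ k, x' k ∈ 𝒱 (ε' k)) ∧
      ∀ v, blockProduct 𝒱 β x' v = (List.ofFn fun k => SuperSym.ι 𝒱 (x v k)).prod := by
  -- The lexicographic order makes the blocks consecutive, so that `β` is monotone.
  let α := Σₗ v : Fin m, Fin (n v)
  let e : Fin (Fintype.card α) ≃o α := Fintype.orderIsoFinOfCardEq α rfl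
  refine ⟨Fintype.card α, fun k => (ofLex (e k)).1, fun k => ε _ (ofLex (e k)).2,
    fun k => x _ (ofLex (e k)).2, fun a b hab => ?_, fun k => hx _ _, fun v => ?_⟩
  · obtain h | ⟨h, -⟩ := Sigma.Lex.le_def.1 (e.monotone hab)
    · exact h.le
    · exact h.le
  · have h : ((List.finRange (Fintype.card α)).filter fun k => (ofLex (e k)).1 = v) =
        List.ofFn fun k : Fin (n v) => e.symm (toLex ⟨v, k⟩) := by
      have hp : (List.ofFn fun k : Fin (n v) => e.symm (toLex ⟨v, k⟩)).Pairwise (· < ·) := by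
        rw [List.pairwise_ofFn]
        intro i j hij
        refine e.symm.strictMono (Sigma.Lex.lt_def.2 (Or.inr ⟨rfl, hij⟩))
      refine List.Perm.eq_of_pairwise' (r := (· < ·))
        ((List.pairwise_lt_finRange _).filter _) hp ?_
      refine (List.perm_ext_iff_of_nodup ((List.nodup_finRange _).filter _)
        (hp.imp fun h => h.ne)).2 fun a => ?_
      rw [List.mem_filter, List.mem_ofFn']
      simp only [List.mem_finRange, true_and, decide_eq_true_eq, Set.mem_range]
      constructor
      · rintro rfl
        exact ⟨(ofLex (e a)).2, e.symm_apply_apply a⟩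
      · rintro ⟨k, rfl⟩
        rw [e.apply_symm_apply]
        rfl
    rw [blockProduct, h, List.map_ofFn]
    congr 2
    funext k
    rw [Function.comp_apply, e.apply_symm_apply]
    rfl

variable {L : Type*} [AddCommGroup L] [Module K L] {𝓛 : ZMod 2 → Submodule K L}
  [DirectSum.Decomposition 𝓛]

/-- A multilinear map is determined by its values on products of homogeneous elements. -/
theorem multilinearMap_eq_zero {m : ℕ}
    (f : MultilinearMap (Scalars K) (fun _ : Fin m => SymSeries 𝓛) (SymSeries 𝓛))
    (hf : ∀ (n : Fin m → ℕ) (ε : ∀ v, Fin (n v) → ZMod 2) (x : ∀ v, Fin (n v) → ℕ →₀ L),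
      (∀ v k, x v k ∈ minusGrading 𝓛 (ε v k)) → f (fun v => MvPowerSeries.C
        (List.ofFn fun k => SuperSym.ι (minusGrading 𝓛) (x v k)).prod) = 0) : f = 0 := by
  classical
  -- The arguments are released one at a time: `T` consists of those that may be arbitrary, the
  -- others being products of homogeneous elements.
  suffices h : ∀ (T : Finset (Fin m)) (y : Fin m → SymSeries 𝓛),
      (∀ v ∉ T, ∃ (n : ℕ) (ε : Fin n → ZMod 2) (x : Fin n → ℕ →₀ L),
        (∀ k, x k ∈ minusGrading 𝓛 (ε k)) ∧
        y v = MvPowerSeries.C (List.ofFn fun k => SuperSym.ι (minusGrading 𝓛) (x k)).prod) →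
      f y = 0 from
    MultilinearMap.ext fun y => h Finset.univ y fun v hv => absurd (Finset.mem_univ v) hv
  intro T
  induction T using Finset.induction_on with
  | empty =>
    intro y hy
    choose n ε x hx hy using fun v => hy v (Finset.notMem_empty v)
    rw [show y = _ from funext hy]
    exact hf n ε x hx
  | insert v T _ ih =>
    intro y hy
    have hspan : ∀ (p : ZMod 2), ∀ a ∈ SuperSym.parity (minusGrading 𝓛) p,
        f (Function.update y v (MvPowerSeries.C a)) = 0 := by
      intro p a ha
      induction ha using Submodule.span_induction with
      | mem a h =>
        obtain ⟨n, ε, x, hx, -, rfl⟩ := h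
        refine ih _ fun w hw => ?_
        by_cases hwv : w = v
        · subst hwv
          exact ⟨n, ε, x, hx, Function.update_self _ _ _⟩
        · rw [Function.update_of_ne hwv]
          exact hy w fun h => (Finset.mem_insert.1 h).elim hwv hw
      | zero => rw [map_zero, MultilinearMap.map_update_zero]
      | add a b _ _ ha hb => rw [map_add, MultilinearMap.map_update_add, ha, hb, add_zero]
      | smul r a _ ha =>
        have h : (MvPowerSeries.C (r • a) : SymSeries 𝓛) =
            (MvPowerSeries.C r : Scalars K) • (MvPowerSeries.C a : SymSeries 𝓛) := by
          ext n
          rw [SymSeries.coeff_smul_C, MvPowerSeries.coeff_C, MvPowerSeries.coeff_C]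
          split_ifs
          · rfl
          · exact (zero_smul K a).symm
        rw [h, MultilinearMap.map_update_smul, ha, smul_zero]
    have hz : f.toLinearMap y v = 0 := SymSeries.eq_zero_of_C _ fun a => by
      obtain ⟨a, ha, b, hb, rfl⟩ := SuperSym.exists_parity_add a
      rw [MultilinearMap.toLinearMap_apply, map_add, MultilinearMap.map_update_add,
        hspan 0 a ha, hspan 1 b hb, add_zero]
    have := LinearMap.congr_fun hz (y v)
    rwa [MultilinearMap.toLinearMap_apply, Function.update_eq_self] at this

theorem IsFeynmanSum.unique {X : CircleComplex 𝓛} {S : ChainSplitting X}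
    {𝒦 𝒦' : LInftyMorphism X.dgla X.trivialDgla} (h : IsFeynmanSum S 𝒦)
    (h' : IsFeynmanSum S 𝒦') : 𝒦' = 𝒦 := by
  have hcomp : 𝒦'.comp = 𝒦.comp := by
    funext m
    obtain rfl | hm := Nat.eq_zero_or_pos m
    · rw [𝒦.comp_zero, 𝒦'.comp_zero]
    · refine sub_eq_zero.1 (multilinearMap_eq_zero _ fun n ε x hx => ?_)
      obtain ⟨N, β, ε', x', hβ, hx', hblock⟩ := exists_blockProduct hx
      -- Genus labels `0` suffice, because powers of `ħ` are scalars for the components.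
      have e1 := h m N hm 0 β hβ ε' x' hx'
      have e2 := h' m N hm 0 β hβ ε' x' hx'
      simp only [Pi.zero_apply, pow_zero, one_smul, hblock] at e1 e2
      rw [sub_apply, e1, e2, sub_self]
  cases 𝒦
  cases 𝒦'
  simpa using hcomp

end Uniqueness

end

theorem theorem6p1 {K L : Type*} [Field K] [CharZero K] [AddCommGroup L] [Module K L]
    (𝓛 : ZMod 2 → Submodule K L) [DirectSum.Decomposition 𝓛]
    (X : CircleComplex 𝓛) (S : ChainSplitting X) :
    X.dgla.IsDGLA ∧ X.trivialDgla.IsDGLA ∧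
      ∃ 𝒦 : LInftyMorphism X.dgla X.trivialDgla,
        𝒦.IsQuasiIso ∧
        IsFeynmanSum S 𝒦 ∧
        (∀ 𝒦' : LInftyMorphism X.dgla X.trivialDgla, IsFeynmanSum S 𝒦' → 𝒦' = 𝒦) ∧
        ∀ x : SymSeries 𝓛, 𝒦.comp 1 (fun _ => x) = SymSeries.expHbar S.deltaHSym x :=
  ⟨X.dgla_isDGLA, X.trivialDgla_isDGLA, S.lInftyMorphism, S.lInftyMorphism_isQuasiIso,
    S.isFeynmanSum_of_comp_eq fun _ => rfl,
    fun _ h => IsFeynmanSum.unique (S.isFeynmanSum_of_comp_eq fun _ => rfl) h, S.component_one⟩
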